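/- **Input.** Let $n,d\ge 1$, let $D_1,\dots,D_n$ be independent discrete distributions, where $D_i$ takes the location $q_{i,j}\in\mathbb R^d\cup\{\bot\}$ with probability $p_{i,j}\ge 0$ for $j=1,\dots,z$, $\sum_{j=1}^z p_{i,j}=1$ ($\bot$ means that the $i$-th point is absent), and let $0<\varepsilon<1/9$. Let $X$ be the random finite set of the points that are present when every $D_i$ is sampled, so that the index choice $(j_1,\dots,j_n)$ has probability $\prod_i p_{i,j_i}$. For finite $P\subset\mathbb R^d$ put $m(c,P)=\max_{p\in P}\|c-p\|$, and $m(c,\emptyset)=0$. The probabilistic smallest enclosing ball problem is to minimize $\mathbb E_X[m(c,X)]$ over $c\in\mathbb R^d$. **Algorithm.** Put $\eta=\varepsilon/12$, $\ell=\lceil(68/\eta)^2\rceil$, $J=\lceil\log_2(2/\eta^4)\rceil+1$, and $k=1+\lceil1/\eta\rceil+J\ell+\lceil (64/\eta^2)\ln(8(J\ell+1))\rceil$, so $k\in O(\varepsilon^{-2}\log(1/\varepsilon))$. 1. If $\sum_{q_{i,j}\ne\bot}p_{i,j}\le\eta$, sample $k$ independent locations $q_{i,j}\neq\bot$ with probability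 proportional to $p_{i,j}$ by weighted reservoir sampling, and regard each as a one-point set. (If all these $p_{i,j}$ are $0$, output the origin.) Otherwise sample realizations of $(D_1,\dots,D_n)$ until $k$ non-empty ones have been found, but at most $\lceil 8k/\eta\rceil$ realizations; continue with those found (if none was found, output the origin). 2. Use the sampled sets $P$ one by one in the following set median algorithm. Let $c_0$ be a point of the first set, and let $\tilde R=\sum_P m(c_0,P)$ over the next $\lceil1/\eta\rceil$ sets. For each $j=0,\dots,J-1$ perform $\ell$ steps $c\leftarrow c-s\,\frac{c-p}{\|c-p\|}$ of the stochastic subgradient method, starting from $c_0$, with step size $s=2^{j-1}\eta^3\tilde R/\sqrt{\ell+1}$, where each step uses a new sampled set $P$ and a point $p\in P$ farthest from the current center $c$ (the center stays if $c=p$). Output, among $c_0$ and all centers reached, one that minimizes $\sum_P m(c,P)$ over the remaining sampled sets. The running time is the number of instructions executed in the unit-cost randomized real RAM model: arithmetic, square root, logarithm and comparison of real numbers, rounding up and natural-number arithmetic (used for the numbers of samples and iterations), reading an input number, and tossing a coin with a given bias. **Theorem.** A minimizer of $c\mapsto\mathbb E_X[m(c,X)]$ exists, and with probability at least $1/8$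 the output $\tilde c$ of the algorithm satisfies $$\mathbb E_X[m(\tilde c,X)]\le(1+\varepsilon)\min_{c\in\mathbb R^d}\mathbb E_X[m(c,X)].$$ There is an absolute constant $K$ (independent of $n,z,d,\varepsilon$ and the distributions) such that every run of the algorithm takes at most $$K\,dn\left(\frac{z}{\varepsilon^3}\log\frac1\varepsilon+\frac1{\varepsilon^4}\log^2\frac1\varepsilon\right)$$ steps. -/

import Mathlib

namespace PSEB

/-! ### The probabilistic smallest enclosing ball problem -/

/-- `n` independent discrete distributions, each over `z` locations in `ℝ^d ∪ {⊥}` (`none` is `⊥`,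
"the point is absent"); location `loc i j` has probability `prob i j`. -/
structure ProbPoints (n z d : ℕ) where
  loc : Fin n → Fin z → Option (EuclideanSpace ℝ (Fin d))
  prob : Fin n → Fin z → ℝ
  prob_nonneg : ∀ i j, 0 ≤ prob i j
  sum_prob : ∀ i, ∑ j, prob i j = 1

/-- `m(c, P) = max_{p ∈ P} ‖c - p‖`, with `m(c, ∅) = 0`. -/
noncomputable def maxDist {d : ℕ} (c : EuclideanSpace ℝ (Fin d))
    (P : Finset (EuclideanSpace ℝ (Fin d))) : ℝ :=
  if h : P.Nonempty then P.sup' h (fun p => ‖c - p‖) else 0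

namespace ProbPoints

variable {n z d : ℕ}

open Classical in
/-- The set of points that are present when the `i`-th distribution takes its `j i`-th location. -/
noncomputable def realization (D : ProbPoints n z d) (j : Fin n → Fin z) :
    Finset (EuclideanSpace ℝ (Fin d)) :=
  Finset.eraseNone (Finset.univ.image fun i => D.loc i (j i))

/-- `E_X[m(c, X)]`: by independence the index choice `j` has probability `∏ i, prob i (j i)`. -/
noncomputable def expCost (D : ProbPoints n z d) (c : EuclideanSpace ℝ (Fin d)) : ℝ :=
  ∑ j : Fin n → Fin z, (∏ i, D.prob i (j i)) * maxDist c (D.realization j)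

end ProbPoints

/-! ### The machine model: a randomized real RAM with unit cost per instruction

A program is a tree of instructions. The type `V` of machine numbers is left abstract when programs
are written, so that numbers can only be produced, combined, compared and read from the input through
instructions; it becomes `ℝ` when programs are run. The input is not visible to the program text
either: only its dimensions `n, z, d` are. -/

/-- The instructions, indexed by the type of their result. -/
inductive Instr (V : Type) (n z d : ℕ) : Type → Type
  | cast (m : ℕ) : Instr V n z d V
  | add (x y : V) : Instr V n z d V
  | sub (x y : V) : Instr V n z d V
  | mul (x y : V) : Instr V n z d V
  | div (x y : V) : Instr V n z d V
  | sqrt (x : V) : Instr V n z d V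
  | log (x : V) : Instr V n z d V
  /-- rounding up to a natural number; the algorithm rounds only its sample and iteration numbers -/
  | ceil (x : V) : Instr V n z d ℕ
  | natAdd (a b : ℕ) : Instr V n z d ℕ
  | natMul (a b : ℕ) : Instr V n z d ℕ
  /-- the test `x ≤ y` -/
  | le (x y : V) : Instr V n z d Bool
  /-- a fresh independent coin that shows `true` with probability `q` (that is, compare `q` with a
  uniform random number from `[0, 1]`) -/
  | coin (q : V) : Instr V n z d Bool
  /-- read the approximation parameter -/
  | readEps : Instr V n z d V
  /-- read the probability of a location -/
  | readProb (i : Fin n) (j : Fin z) : Instr V n z d V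
  /-- is the location `⊥`? -/
  | isBot (i : Fin n) (j : Fin z) : Instr V n z d Bool
  /-- read one coordinate of a location -/
  | readCoord (i : Fin n) (j : Fin z) (a : Fin d) : Instr V n z d V

/-- Programs with results in `α`. -/
inductive Prog (V : Type) (n z d : ℕ) (α : Type) : Type 1
  | ret (a : α) : Prog V n z d α
  | step {β : Type} (i : Instr V n z d β) (k : β → Prog V n z d α) : Prog V n z d α

variable {V : Type} {n z d : ℕ}

/-- Sequential composition. -/
def Prog.bind {α γ : Type} : Prog V n z d α → (α → Prog V n z d γ) → Prog V n z d γ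
  | .ret a, f => f a
  | .step i k, f => .step i fun b => (k b).bind f

instance : Monad (Prog V n z d) where
  pure := Prog.ret
  bind := Prog.bind

/-- The program that executes one instruction. -/
def exec {β : Type} (i : Instr V n z d β) : Prog V n z d β := .step i .ret

/-- The law of a coin with bias `q` (clamped to `[0, 1]`). -/
noncomputable def coinLaw (q : ℝ) : PMF Bool :=
  PMF.ofFintype (fun b => cond b (ENNReal.ofReal (min q 1)) (1 - ENNReal.ofReal (min q 1))) (by
    simp)

/-- The law of the result of one instruction, on input `D` and `ε`. -/
noncomputable def Instr.law (D : ProbPoints n z d) (ε : ℝ) {β : Type} :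
    Instr ℝ n z d β → PMF β
  | .cast m => PMF.pure (m : ℝ)
  | .add x y => PMF.pure (x + y)
  | .sub x y => PMF.pure (x - y)
  | .mul x y => PMF.pure (x * y)
  | .div x y => PMF.pure (x / y)
  | .sqrt x => PMF.pure (Real.sqrt x)
  | .log x => PMF.pure (Real.log x)
  | .ceil x => PMF.pure ⌈x⌉₊
  | .natAdd a b => PMF.pure (a + b)
  | .natMul a b => PMF.pure (a * b)
  | .le x y => PMF.pure (@decide (x ≤ y) (Classical.propDecidable _))
  | .coin q => coinLaw q
  | .readEps => PMF.pure ε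
  | .readProb i j => PMF.pure (D.prob i j)
  | .isBot i j => PMF.pure (D.loc i j).isNone
  | .readCoord i j a => PMF.pure ((D.loc i j).elim 0 fun q => q a)

/-- The joint law of the output of a program and of the number of instructions it executes. -/
noncomputable def Prog.law (D : ProbPoints n z d) (ε : ℝ) {α : Type} :
    Prog ℝ n z d α → PMF (α × ℕ)
  | .ret a => PMF.pure (a, 0)
  | .step i k => (i.law D ε).bind fun b => ((k b).law D ε).map fun r => (r.1, r.2 + 1)

/-! ### Geometry -/

/-- A stored vector. -/
abbrev Vec (V : Type) (d : ℕ) : Type := Fin d → V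

/-- A stored non-empty finite set of points: one point and the list of the others. -/
abbrev PointSet (V : Type) (d : ℕ) : Type := Vec V d × List (Vec V d)

/-- Compute the entries of a vector one after the other. -/
def tabulate : {m : ℕ} → (Fin m → Prog V n z d V) → Prog V n z d (Fin m → V)
  | 0, _ => pure Fin.elim0
  | _ + 1, f => do
    let x ← f 0
    let xs ← tabulate fun a => f a.succ
    pure (Fin.cons x xs)

/-- The Euclidean distance of two vectors. -/
def distance (x y : Vec V d) : Prog V n z d V := do
  let o ← exec (.cast 0)
  let q ← (List.finRange d).foldlM (fun acc a => do
    let u ← exec (.sub (x a) (y a))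
    let w ← exec (.mul u u)
    exec (.add acc w)) o
  exec (.sqrt q)

/-- A point of `P` farthest from `c`, and its distance `m(c, P)`. -/
def farthest (c : Vec V d) (P : PointSet V d) : Prog V n z d (Vec V d × V) := do
  let r₀ ← distance c P.1
  P.2.foldlM (fun best p => do
    let r ← distance c p
    let b ← exec (.le r best.2)
    pure (if b then best else (p, r))) (P.1, r₀)

/-- The cost `∑ m(c, P)` of `c` on a list of sets. -/
def totalCost (c : Vec V d) (Ps : List (PointSet V d)) : Prog V n z d V := do
  let o ← exec (.cast 0)
  Ps.foldlM (fun acc P => do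
    let r ← farthest c P
    exec (.add acc r.2)) o

/-! ### The set median algorithm

It receives the list of the sampled sets and uses them one by one. -/

/-- One step of the stochastic subgradient method: from `c` move by `s` in the direction
`-(c - p) / ‖c - p‖`, where `p` is a point of the sampled set `P` farthest from `c`
(and stay if `c = p`). -/
def subgradientStep (s : V) (c : Vec V d) (P : PointSet V d) : Prog V n z d (Vec V d) := do
  let r ← farthest c P
  let o ← exec (.cast 0)
  let b ← exec (.le r.2 o)
  if b then pure c
  else do
    let t ← exec (.div s r.2)
    tabulate fun a => do
      let u ← exec (.sub (c a) (r.1 a))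
      let w ← exec (.mul t u)
      exec (.sub (c a) w)

/-- The stochastic subgradient method from `c₀` with step size `s`, one step for each sampled set;
returns the list of the centers reached after `c₀`. -/
def descent (s : V) (c₀ : Vec V d) (Ps : List (PointSet V d)) :
    Prog V n z d (List (Vec V d)) := do
  let r ← Ps.foldlM (fun (r : Vec V d × List (Vec V d)) P => do
    let c ← subgradientStep s r.1 P
    pure (c, c :: r.2)) (c₀, [])
  pure r.2

/-- Runs of the subgradient method from `c₀`, of `l` steps each, with the step sizes
`s, 2 s, 4 s, …`; the first argument is the number of runs. Returns all centers reached and the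
sampled sets not used. -/
def descents (l : ℕ) (c₀ : Vec V d) :
    ℕ → V → List (PointSet V d) → Prog V n z d (List (Vec V d) × List (PointSet V d))
  | 0, _, R => pure ([], R)
  | m + 1, s, R => do
    let cs ← descent s c₀ (R.take l)
    let s' ← exec (.add s s)
    let r ← descents l c₀ m s' (R.drop l)
    pure (cs ++ r.1, r.2)

/-- The center among `c₀` and `cs` with the smallest cost on the sets in `E`. -/
def selectBest (E : List (PointSet V d)) (c₀ : Vec V d) (cs : List (Vec V d)) :
    Prog V n z d (Vec V d) := do
  let f₀ ← totalCost c₀ E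
  let r ← cs.foldlM (fun (best : Vec V d × V) c => do
    let f ← totalCost c E
    let b ← exec (.le best.2 f)
    pure (if b then best else (c, f))) (c₀, f₀)
  pure r.1

/-- The iteration and sample numbers. -/
structure Sizes where
  /-- number of sampled sets for the estimate of the average cost -/
  est : ℕ
  /-- number of steps of one run of the subgradient method -/
  steps : ℕ
  /-- number of runs (of step sizes tried) -/
  runs : ℕ
  /-- total number `k` of sampled sets -/
  total : ℕ
  /-- maximal number of realizations drawn in order to obtain `k` non-empty ones -/
  trials : ℕ

/-- `est = ⌈1/η⌉`, `steps = ⌈(68/η)²⌉`, `runs = ⌈log₂ (2/η⁴)⌉ + 1`; with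
`N = runs * steps + 1` candidate centers, `⌈64/η² * ln (8 N)⌉` sets are sampled for their comparison;
`total` adds all samples, including the one for the initial center, and `trials = ⌈8 total / η⌉`. -/
def computeSizes (η : V) : Prog V n z d Sizes := do
  let one ← exec (.cast 1)
  let two ← exec (.cast 2)
  let c64 ← exec (.cast 64)
  let c68 ← exec (.cast 68)
  let inv ← exec (.div one η)
  let est ← exec (.ceil inv)
  let a ← exec (.div c68 η)
  let a2 ← exec (.mul a a)
  let steps ← exec (.ceil a2)
  let η2 ← exec (.mul η η)
  let η4 ← exec (.mul η2 η2)
  let x ← exec (.div two η4)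
  let lx ← exec (.log x)
  let l2 ← exec (.log two)
  let y ← exec (.div lx l2)
  let j ← exec (.ceil y)
  let runs ← exec (.natAdd j 1)
  let rs ← exec (.natMul runs steps)
  let cand ← exec (.natAdd rs 1)
  let cand8 ← exec (.natMul 8 cand)
  let u ← exec (.cast cand8)
  let lu ← exec (.log u)
  let w ← exec (.div c64 η2)
  let v ← exec (.mul w lu)
  let cmp ← exec (.ceil v)
  let k₁ ← exec (.natAdd 1 est)
  let k₂ ← exec (.natAdd k₁ rs)
  let k ← exec (.natAdd k₂ cmp)
  let k8 ← exec (.natMul 8 k)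
  let kr ← exec (.cast k8)
  let t ← exec (.div kr η)
  let trials ← exec (.ceil t)
  pure ⟨est, steps, runs, k, trials⟩

/-- The set median algorithm. The first sampled set gives the initial center `c₀`, the next `est` ones
the estimate `R' = ∑ m(c₀, P)`; then the subgradient method is run with the step sizes
`2^(j-1) η³ R' / √(steps + 1)`, `j = 0, …, runs - 1`; the remaining sets are used to choose the
output among `c₀` and all centers reached. Without any sampled set the output is the origin. -/
def setMedian (η : V) (sz : Sizes) : List (PointSet V d) → Prog V n z d (Vec V d)
  | [] => tabulate fun _ => exec (.cast 0)
  | P₀ :: R => do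
    let est ← totalCost P₀.1 (R.take sz.est)
    let η2 ← exec (.mul η η)
    let η3 ← exec (.mul η2 η)
    let x ← exec (.mul η3 est)
    let l₁ ← exec (.natAdd sz.steps 1)
    let l₂ ← exec (.cast l₁)
    let l₃ ← exec (.sqrt l₂)
    let l₄ ← exec (.add l₃ l₃)
    let s ← exec (.div x l₄)
    let r ← descents sz.steps P₀.1 sz.runs s (R.drop sz.est)
    selectBest r.2 P₀.1 r.1

/-! ### Sampling -/

/-- Weighted reservoir sampling: one pass over `items` that keeps each item with a probability
proportional to its weight (`none` if no item has positive weight). -/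
def reservoir {ι : Type} (weight : ι → Prog V n z d V) (items : List ι) :
    Prog V n z d (Option ι) := do
  let o ← exec (.cast 0)
  let r ← items.foldlM (fun (st : V × Option ι) x => do
    let w ← weight x
    let b ← exec (.le w o)
    if b then pure st
    else do
      let W ← exec (.add st.1 w)
      let q ← exec (.div w W)
      let h ← exec (.coin q)
      pure (W, if h then some x else st.2)) (o, none)
  pure r.2

/-- All index pairs `(i, j)`. -/
def allPairs (n z : ℕ) : List (Fin n × Fin z) := (List.finRange n).product (List.finRange z)

/-- The probability of a location if it is not `⊥`, and `0` if it is. -/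
def presentProb (x : Fin n × Fin z) : Prog V n z d V := do
  let b ← exec (.isBot x.1 x.2)
  if b then exec (.cast 0) else exec (.readProb x.1 x.2)

/-- The sum of the probabilities of all non-`⊥` locations. -/
def presentMass : Prog V n z d V := do
  let o ← exec (.cast 0)
  (allPairs n z).foldlM (fun acc x => do
    let w ← presentProb x
    exec (.add acc w)) o

/-- Copy a location from the input. -/
def readPoint (i : Fin n) (j : Fin z) : Prog V n z d (Vec V d) :=
  tabulate fun a => exec (.readCoord i j a)

/-- Sample a non-`⊥` location with probability proportional to its probability `p_{i,j}`;
it is returned as a one-point set. -/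
def sampleLocation : Prog V n z d (Option (PointSet V d)) := do
  let r ← reservoir presentProb (allPairs n z)
  match r with
  | none => pure none
  | some x => do
    let p ← readPoint x.1 x.2
    pure (some (p, []))

/-- Sample a realization of all `n` distributions; `none` if it is empty. -/
def sampleRealization : Prog V n z d (Option (PointSet V d)) := do
  let pts ← (List.finRange n).foldlM (fun (acc : List (Vec V d)) i => do
    let r ← reservoir (fun j => exec (.readProb i j)) (List.finRange z)
    match r with
    | none => pure acc
    | some j => do
      let b ← exec (.isBot i j)
      if b then pure acc
      else do
        let p ← readPoint i j
        pure (p :: acc)) []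
  match pts with
  | [] => pure none
  | p :: ps => pure (some (p, ps))

/-- Call `sampler` until it has returned `k` sets, but at most `trials` times. -/
def collect (sampler : Prog V n z d (Option (PointSet V d))) :
    (trials k : ℕ) → Prog V n z d (List (PointSet V d))
  | 0, _ => pure []
  | _ + 1, 0 => pure []
  | t + 1, k + 1 => do
    let r ← sampler
    match r with
    | none => collect sampler t (k + 1)
    | some P => do
      let R ← collect sampler t k
      pure (P :: R)

/-! ### The algorithm for the probabilistic smallest enclosing ball -/

/-- The algorithm, with the accuracy `η = ε / 12` used internally. -/
def pSEB : Prog V n z d (Vec V d) := do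
  let ε ← exec .readEps
  let c12 ← exec (.cast 12)
  let η ← exec (.div ε c12)
  let sz ← computeSizes η
  let mass ← presentMass
  let b ← exec (.le mass η)
  let R ← if b then collect sampleLocation sz.total sz.total
    else collect sampleRealization sz.trials sz.total
  setMedian η sz R

/-- The joint law of the output `c̃ ∈ ℝ^d` of the algorithm and of its running time
(the number of executed instructions) on input `D`, `ε`. -/
noncomputable def pSEBLaw (D : ProbPoints n z d) (ε : ℝ) :
    PMF (EuclideanSpace ℝ (Fin d) × ℕ) :=
  ((pSEB : Prog ℝ n z d (Vec ℝ d)).law D ε).map fun r => (WithLp.toLp 2 r.1, r.2)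

end PSEB

/-! Let μ be the sum of all presence probabilities. If μ ≤ η, two points are rarely present
together: the expected maximum lies between 1 - μ times and once the expected sum of distances
(`ProbPoints.sumCost_le_expCost`, `ProbPoints.expCost_le_sumCost`), so the problem is nearly a
weighted geometric median of single locations. If μ > η, empty realizations cost nothing, so the
objective is a constant multiple of the cost under the law conditioned on a nonempty realization
(`ProbPoints.expCost_eq`). Such a realization has probability at least η/2, and with probability at
least 7/8 enough of them appear (`le_hitProb`). Either way, an average of functions m(·, P) has to
be minimized from independent samples P.

Moving towards a farthest point is a unit subgradient step for m(·, P). On average it decreases the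
squared distance to the optimum c' as long as the center is expensive, so a long run cannot meet
expensive centers only (`val_subgradientStep`, `MedianCost.listAvg_centers_le`). The step size must
be about R/√ℓ, where R is the unknown initial distance to c'. Unless the initial center is already
good, the sampled cost estimate rarely misses R by more than factors polynomial in 1/η, so doubling
reaches a suitable size (`MedianCost.exists_step_size`). The final comparison uses a Chernoff and a
union bound: ‖c - c'‖ bounds the difference of two costs on any sample and is at most their sum, so
a relative gap in expectation is visible without any bound on the diameter (`listAvg_ind_sum_le`).

There are five bad events of probability at most 1/8 each: far start, estimate too small, estimate
too large, no good candidate, wrong selection. The success probability is thus at least 7/8 · 3/8 ≥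
1/8.

For the time, there are O(k/η) passes over the n·z locations, and O(k) candidates are evaluated on
O(k) sets of at most n points. Expectations (`Prog.ev`), results of coin-free parts (`Prog.val`) and
step counts (`Prog.Runs`) are computed by recursion on programs; `law_toOuterMeasure` and
`Prog.Runs.of_mem_support` carry them over to the actual law. -/

namespace PSEB

/-! ### Semantics of programs -/

section Semantics

variable {n z d : ℕ} {α γ : Type}

/-- The result of an instruction, where every coin shows `true`. -/
noncomputable def Instr.value (D : ProbPoints n z d) (ε : ℝ) {β : Type} : Instr ℝ n z d β → β
  | .cast m => (m : ℝ)
  | .add x y => x + y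
  | .sub x y => x - y
  | .mul x y => x * y
  | .div x y => x / y
  | .sqrt x => Real.sqrt x
  | .log x => Real.log x
  | .ceil x => ⌈x⌉₊
  | .natAdd a b => a + b
  | .natMul a b => a * b
  | .le x y => @decide (x ≤ y) (Classical.propDecidable _)
  | .coin _ => true
  | .readEps => ε
  | .readProb i j => D.prob i j
  | .isBot i j => (D.loc i j).isNone
  | .readCoord i j a => (D.loc i j).elim 0 fun q => q a

/-- The instructions other than the coin toss. -/
def Instr.IsDet {V β : Type} : Instr V n z d β → Prop
  | .coin _ => False
  | _ => True

/-- The expectation of `φ` of the result of an instruction. -/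
noncomputable def Instr.ev (D : ProbPoints n z d) (ε : ℝ) {β : Type} :
    Instr ℝ n z d β → (β → ℝ) → ℝ
  | .coin q, φ => max (min q 1) 0 * φ true + (1 - max (min q 1) 0) * φ false
  | i, φ => φ (i.value D ε)

/-- The expectation of `φ` of the result of a program. -/
noncomputable def Prog.ev (D : ProbPoints n z d) (ε : ℝ) : Prog ℝ n z d α → (α → ℝ) → ℝ
  | .ret a, φ => φ a
  | .step i k, φ => i.ev D ε fun b => (k b).ev D ε φ

/-- The result of a program when every coin shows `true`. -/
noncomputable def Prog.val (D : ProbPoints n z d) (ε : ℝ) : Prog ℝ n z d α → α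
  | .ret a => a
  | .step i k => (k (i.value D ε)).val D ε

/-- Programs that toss no coins. -/
def Prog.IsDet {V : Type} : Prog V n z d α → Prop
  | .ret _ => True
  | .step i k => i.IsDet ∧ ∀ b, (k b).IsDet

/-- Every run of the program executes at most `N` instructions and its result satisfies `Q`. -/
def Prog.Runs (D : ProbPoints n z d) (ε : ℝ) : Prog ℝ n z d α → ℕ → (α → Prop) → Prop
  | .ret a, _, Q => Q a
  | .step i k, N, Q => ∃ M, M + 1 ≤ N ∧ ∀ b, (i.IsDet → b = i.value D ε) → (k b).Runs D ε M Q

variable {D : ProbPoints n z d} {ε : ℝ}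

lemma Instr.ev_of_isDet {β : Type} {i : Instr ℝ n z d β} (h : i.IsDet) (φ : β → ℝ) :
    i.ev D ε φ = φ (i.value D ε) := by
  cases i <;> first | rfl | exact h.elim

lemma Instr.law_of_isDet {β : Type} {i : Instr ℝ n z d β} (h : i.IsDet) :
    i.law D ε = PMF.pure (i.value D ε) := by
  cases i <;> first | rfl | exact h.elim

lemma Instr.ev_mono {β : Type} (i : Instr ℝ n z d β) {φ ψ : β → ℝ} (h : ∀ b, φ b ≤ ψ b) :
    i.ev D ε φ ≤ i.ev D ε ψ := by
  cases i with
  | coin q =>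
    have h0 : 0 ≤ max (min q 1) 0 := le_max_right _ _
    have h1 : 0 ≤ 1 - max (min q 1) 0 := by simp
    exact add_le_add (mul_le_mul_of_nonneg_left (h _) h0) (mul_le_mul_of_nonneg_left (h _) h1)
  | _ => exact h _

lemma Prog.ev_mono (p : Prog ℝ n z d α) {φ ψ : α → ℝ} (h : ∀ a, φ a ≤ ψ a) :
    p.ev D ε φ ≤ p.ev D ε ψ := by
  induction p with
  | ret a => exact h a
  | step i k ih => exact i.ev_mono fun b => ih b

lemma Prog.ev_const (p : Prog ℝ n z d α) (a : ℝ) : p.ev D ε (fun _ => a) = a := by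
  induction p with
  | ret a => rfl
  | step i k ih =>
    simp only [Prog.ev, ih]
    cases i <;> simp [Instr.ev]
    ring

lemma Prog.ev_nonneg (p : Prog ℝ n z d α) {φ : α → ℝ} (h : ∀ a, 0 ≤ φ a) : 0 ≤ p.ev D ε φ :=
  (p.ev_const 0).symm.le.trans (p.ev_mono h)

@[simp] lemma ev_pure (a : α) (φ : α → ℝ) : (pure a : Prog ℝ n z d α).ev D ε φ = φ a := rfl

@[simp] lemma ev_exec {β : Type} (i : Instr ℝ n z d β) (φ : β → ℝ) :
    (exec i).ev D ε φ = i.ev D ε φ := rfl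

@[simp] lemma ev_bind (p : Prog ℝ n z d α) (f : α → Prog ℝ n z d γ) (φ : γ → ℝ) :
    (p >>= f).ev D ε φ = p.ev D ε fun a => (f a).ev D ε φ := by
  change (p.bind f).ev D ε φ = _
  induction p with
  | ret a => rfl
  | step i k ih => simp only [Prog.bind, Prog.ev, ih]

@[simp] lemma val_pure (a : α) : (pure a : Prog ℝ n z d α).val D ε = a := rfl

@[simp] lemma val_exec {β : Type} (i : Instr ℝ n z d β) : (exec i).val D ε = i.value D ε := rfl

@[simp] lemma val_bind (p : Prog ℝ n z d α) (f : α → Prog ℝ n z d γ) :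
    (p >>= f).val D ε = (f (p.val D ε)).val D ε := by
  change (p.bind f).val D ε = _
  induction p with
  | ret a => rfl
  | step i k ih => simp only [Prog.bind, Prog.val, ih]

@[simp] lemma val_ite (c : Prop) [Decidable c] (p q : Prog ℝ n z d α) :
    (if c then p else q).val D ε = if c then p.val D ε else q.val D ε := by
  split_ifs <;> rfl

lemma val_foldlM {ι : Type} (f : γ → ι → Prog ℝ n z d γ) (l : List ι) (a : γ) :
    (l.foldlM f a).val D ε = l.foldl (fun a x => (f a x).val D ε) a := by
  induction l generalizing a with
  | nil => rfl
  | cons x l ih => simp [ih]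

/-! ### Programs without coin tosses. -/

lemma isDet_pure (a : α) : (pure a : Prog ℝ n z d α).IsDet := trivial

lemma isDet_exec {β : Type} {i : Instr ℝ n z d β} (h : i.IsDet) : (exec i).IsDet :=
  ⟨h, fun _ => trivial⟩

lemma isDet_bind {p : Prog ℝ n z d α} {f : α → Prog ℝ n z d γ} (hp : p.IsDet)
    (hf : ∀ a, (f a).IsDet) : (p >>= f).IsDet := by
  change (p.bind f).IsDet
  induction p with
  | ret a => exact hf a
  | step i k ih => exact ⟨hp.1, fun b => ih b (hp.2 b)⟩

lemma isDet_ite {c : Prop} [Decidable c] {p q : Prog ℝ n z d α} (hp : p.IsDet) (hq : q.IsDet) :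
    (if c then p else q).IsDet := by
  split_ifs <;> assumption

lemma isDet_foldlM {ι : Type} {f : γ → ι → Prog ℝ n z d γ} (h : ∀ a x, (f a x).IsDet)
    (l : List ι) (a : γ) : (l.foldlM f a).IsDet := by
  induction l generalizing a with
  | nil => trivial
  | cons x l ih =>
    rw [List.foldlM_cons]
    exact isDet_bind (h a x) fun b => ih b

lemma Prog.IsDet.ev_eq {p : Prog ℝ n z d α} (h : p.IsDet) (φ : α → ℝ) :
    p.ev D ε φ = φ (p.val D ε) := by
  induction p with
  | ret a => rfl
  | step i k ih => exact (Instr.ev_of_isDet h.1 _).trans (ih _ (h.2 _))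

/-! ### Step bounds with postconditions. -/

lemma Prog.Runs.mono {p : Prog ℝ n z d α} {N M : ℕ} {Q R : α → Prop} (h : p.Runs D ε N Q)
    (hN : N ≤ M) (hQ : ∀ a, Q a → R a) : p.Runs D ε M R := by
  induction p generalizing N M with
  | ret a => exact hQ a h
  | step i k ih =>
    obtain ⟨L, hL, hb⟩ := h
    exact ⟨L, hL.trans hN, fun b hb' => ih b (hb b hb') le_rfl⟩

lemma Prog.Runs.le {p : Prog ℝ n z d α} {N M : ℕ} {Q : α → Prop} (h : p.Runs D ε N Q)
    (hN : N ≤ M) : p.Runs D ε M Q := h.mono hN fun _ => id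

lemma runs_pure {a : α} {N : ℕ} {Q : α → Prop} (h : Q a) :
    (pure a : Prog ℝ n z d α).Runs D ε N Q := h

lemma runs_bind {p : Prog ℝ n z d α} {f : α → Prog ℝ n z d γ} {N M : ℕ} {Q : α → Prop}
    {R : γ → Prop} (hp : p.Runs D ε N Q) (hf : ∀ a, Q a → (f a).Runs D ε M R) :
    (p >>= f).Runs D ε (N + M) R := by
  change (p.bind f).Runs D ε (N + M) R
  induction p generalizing N with
  | ret a => exact (hf a hp).le (Nat.le_add_left _ _)
  | step i k ih =>
    obtain ⟨L, hL, hb⟩ := hp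
    exact ⟨L + M, by omega, fun b hb' => ih b (hb b hb')⟩

lemma runs_exec {β : Type} (i : Instr ℝ n z d β) :
    (exec i).Runs D ε 1 fun b => i.IsDet → b = i.value D ε :=
  ⟨0, le_rfl, fun _ h => h⟩

lemma runs_exec_bind {β : Type} {i : Instr ℝ n z d β} {f : β → Prog ℝ n z d γ} {M : ℕ}
    {R : γ → Prop} (hf : ∀ b, (f b).Runs D ε M R) :
    (exec i >>= f).Runs D ε (M + 1) R :=
  (runs_bind (runs_exec i) fun b _ => hf b).le (by omega)

lemma runs_ite {c : Prop} [Decidable c] {p q : Prog ℝ n z d α} {N : ℕ} {Q : α → Prop}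
    (hp : p.Runs D ε N Q) (hq : q.Runs D ε N Q) : (if c then p else q).Runs D ε N Q := by
  split_ifs <;> assumption

lemma runs_foldlM {ι : Type} {f : γ → ι → Prog ℝ n z d γ} {l : List ι} {N : ℕ} {I : γ → Prop}
    (h : ∀ a, ∀ x ∈ l, I a → (f a x).Runs D ε N I) {a : γ} (ha : I a) :
    (l.foldlM f a).Runs D ε (l.length * N) I := by
  induction l generalizing a with
  | nil => exact ha
  | cons x l ih =>
    rw [List.foldlM_cons]
    refine (runs_bind (h a x List.mem_cons_self ha) fun b hb =>
      ih (fun a' y hy => h a' y (List.mem_cons_of_mem _ hy)) hb).le ?_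
    rw [List.length_cons]
    exact le_of_eq (by ring)

/-- Without coins only one branch can be taken. Hence a step bound can be proved first with a
trivial postcondition and then sharpened to the exact result. -/
lemma Prog.Runs.eq_val {p : Prog ℝ n z d α} {N : ℕ} {Q : α → Prop} (h : p.Runs D ε N Q)
    (hp : p.IsDet) : p.Runs D ε N fun a => a = p.val D ε := by
  induction p generalizing N with
  | ret a => rfl
  | step i k ih =>
    obtain ⟨L, hL, hb⟩ := h
    refine ⟨L, hL, fun b hb' => ?_⟩
    have e := hb' hp.1
    subst e
    exact ih _ (hb _ hb') (hp.2 _)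

/-- `Runs` allows both outcomes of every coin, even those of probability zero, so it covers the
whole support. -/
lemma Prog.Runs.of_mem_support {p : Prog ℝ n z d α} {N : ℕ} {Q : α → Prop} (h : p.Runs D ε N Q)
    {r : α × ℕ} (hr : r ∈ (p.law D ε).support) : r.2 ≤ N ∧ Q r.1 := by
  induction p generalizing N r with
  | ret a =>
    simp only [Prog.law, PMF.support_pure, Set.mem_singleton_iff] at hr
    subst hr
    exact ⟨Nat.zero_le _, h⟩
  | step i k ih =>
    obtain ⟨L, hL, hb⟩ := h
    simp only [Prog.law, PMF.mem_support_bind_iff, PMF.mem_support_map_iff] at hr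
    obtain ⟨b, hbs, r', hr', rfl⟩ := hr
    obtain ⟨h1, h2⟩ := ih b (hb b fun hi => by
      rwa [Instr.law_of_isDet hi, PMF.support_pure, Set.mem_singleton_iff] at hbs) hr'
    exact ⟨by dsimp only; omega, h2⟩

/-- The outer `max` makes explicit the clamping at 0 that `ENNReal.ofReal` performs silently; this
is the bias used in `Instr.ev`. -/
lemma coinLaw_true (q : ℝ) : coinLaw q true = ENNReal.ofReal (max (min q 1) 0) := by
  simp [coinLaw]

lemma coinLaw_false (q : ℝ) : coinLaw q false = ENNReal.ofReal (1 - max (min q 1) 0) := by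
  rw [ENNReal.ofReal_sub _ (le_max_right _ _), ← coinLaw_true]
  simp [coinLaw]

open Classical in
/-- The probability of an event is the expectation of its indicator. -/
lemma law_toOuterMeasure (p : Prog ℝ n z d α) (A : Set α) :
    (p.law D ε).toOuterMeasure {r | r.1 ∈ A} =
      ENNReal.ofReal (p.ev D ε fun a => if a ∈ A then 1 else 0) := by
  induction p with
  | ret a =>
    by_cases h : a ∈ A <;> simp [Prog.law, Prog.ev, h, PMF.toOuterMeasure_pure_apply]
  | step i k ih =>
    have hk : ∀ b, (((k b).law D ε).map fun r => (r.1, r.2 + 1)).toOuterMeasure {r | r.1 ∈ A} =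
        ENNReal.ofReal ((k b).ev D ε fun a => if a ∈ A then 1 else 0) := fun b => by
      rw [PMF.toOuterMeasure_map_apply, ← ih b]
      rfl
    have h0 : ∀ b, 0 ≤ (k b).ev D ε fun a => if a ∈ A then 1 else 0 := fun b =>
      Prog.ev_nonneg _ fun a => by split_ifs <;> norm_num
    simp only [Prog.law, PMF.toOuterMeasure_bind_apply, hk]
    by_cases hi : i.IsDet
    · rw [Instr.law_of_isDet hi, Prog.ev, Instr.ev_of_isDet hi]
      rw [tsum_eq_single (i.value D ε)]
      · simp
      · intro b hb
        simp [PMF.pure_apply, hb]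
    · cases i with
      | coin q =>
        have h1 : 0 ≤ 1 - max (min q 1) 0 := by simp
        rw [tsum_bool]
        simp only [Instr.law, Prog.ev, Instr.ev, coinLaw_true, coinLaw_false]
        rw [ENNReal.ofReal_add (mul_nonneg (le_max_right _ _) (h0 _)) (mul_nonneg h1 (h0 _)),
          ENNReal.ofReal_mul (le_max_right _ _), ENNReal.ofReal_mul h1, add_comm]
      | _ => exact (hi trivial).elim

end Semantics

end PSEB

namespace PSEB

/-! ### Expectations over lists of independent samples -/

section Sampling

/-- The indicator of a proposition. -/
noncomputable def ind (p : Prop) : ℝ := open Classical in if p then 1 else 0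

lemma ind_of {p : Prop} (h : p) : ind p = 1 := if_pos h

lemma ind_not {p : Prop} (h : ¬p) : ind p = 0 := if_neg h

lemma ind_nonneg (p : Prop) : 0 ≤ ind p := by
  unfold ind; split_ifs <;> norm_num

lemma ind_le_one (p : Prop) : ind p ≤ 1 := by
  unfold ind; split_ifs <;> norm_num

lemma ind_mono {p q : Prop} (h : p → q) : ind p ≤ ind q := by
  by_cases hp : p
  · rw [ind_of hp, ind_of (h hp)]
  · rw [ind_not hp]; exact ind_nonneg q

lemma ind_le {p : Prop} {a : ℝ} (h0 : 0 ≤ a) (h1 : p → 1 ≤ a) : ind p ≤ a := by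
  by_cases hp : p
  · rw [ind_of hp]; exact h1 hp
  · rwa [ind_not hp]

variable {Ω X C : Type*} [Fintype Ω]

/-- The expectation of `φ (T ω)` where `ω` has probability `v ω`. -/
noncomputable def avg (v : Ω → ℝ) (T : Ω → X) (φ : X → ℝ) : ℝ := ∑ ω, v ω * φ (T ω)

/-- The expectation of `φ [T ω₁, …, T ωₖ]` where the `ωᵢ` are independent with law `v`. -/
noncomputable def listAvg (v : Ω → ℝ) (T : Ω → X) : ℕ → (List X → ℝ) → ℝ
  | 0, φ => φ []
  | k + 1, φ => avg v T fun x => listAvg v T k fun l => φ (x :: l)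

variable {v : Ω → ℝ} {T : Ω → X}

lemma avg_mono (hv : ∀ ω, 0 ≤ v ω) {φ ψ : X → ℝ} (h : ∀ x, φ x ≤ ψ x) :
    avg v T φ ≤ avg v T ψ :=
  Finset.sum_le_sum fun ω _ => mul_le_mul_of_nonneg_left (h _) (hv ω)

lemma avg_const (h1 : ∑ ω, v ω = 1) (a : ℝ) : avg v T (fun _ => a) = a := by
  rw [avg, ← Finset.sum_mul, h1, one_mul]

lemma avg_add (φ ψ : X → ℝ) : avg v T (fun x => φ x + ψ x) = avg v T φ + avg v T ψ := by
  simp only [avg, mul_add, Finset.sum_add_distrib]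

lemma avg_sub (φ ψ : X → ℝ) : avg v T (fun x => φ x - ψ x) = avg v T φ - avg v T ψ := by
  simp only [avg, mul_sub, Finset.sum_sub_distrib]

lemma avg_mul (a : ℝ) (φ : X → ℝ) : avg v T (fun x => a * φ x) = a * avg v T φ := by
  simp only [avg, Finset.mul_sum]
  exact Finset.sum_congr rfl fun ω _ => by ring

lemma avg_nonneg (hv : ∀ ω, 0 ≤ v ω) {φ : X → ℝ} (h : ∀ x, 0 ≤ φ x) : 0 ≤ avg v T φ :=
  Finset.sum_nonneg fun ω _ => mul_nonneg (hv ω) (h _)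

lemma listAvg_mono (hv : ∀ ω, 0 ≤ v ω) {k : ℕ} {φ ψ : List X → ℝ}
    (h : ∀ l, l.length = k → φ l ≤ ψ l) : listAvg v T k φ ≤ listAvg v T k ψ := by
  induction k generalizing φ ψ with
  | zero => exact h [] rfl
  | succ k ih => exact avg_mono hv fun x => ih fun l hl => h _ (by simp [hl])

lemma listAvg_const (h1 : ∑ ω, v ω = 1) (k : ℕ) (a : ℝ) : listAvg v T k (fun _ => a) = a := by
  induction k with
  | zero => rfl
  | succ k ih => simp only [listAvg, ih, avg_const h1]

lemma listAvg_le (hv : ∀ ω, 0 ≤ v ω) (h1 : ∑ ω, v ω = 1) {k : ℕ} {φ : List X → ℝ} {a : ℝ}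
    (h : ∀ l, l.length = k → φ l ≤ a) : listAvg v T k φ ≤ a :=
  (listAvg_mono hv h).trans_eq (listAvg_const h1 k a)

lemma listAvg_nonneg (hv : ∀ ω, 0 ≤ v ω) {k : ℕ} {φ : List X → ℝ} (h : ∀ l, 0 ≤ φ l) :
    0 ≤ listAvg v T k φ := by
  induction k generalizing φ with
  | zero => exact h []
  | succ k ih => exact avg_nonneg hv fun x => ih fun l => h _

lemma listAvg_add (k : ℕ) (φ ψ : List X → ℝ) :
    listAvg v T k (fun l => φ l + ψ l) = listAvg v T k φ + listAvg v T k ψ := by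
  induction k generalizing φ ψ with
  | zero => rfl
  | succ k ih => simp only [listAvg, ih, avg_add]

lemma listAvg_mul (k : ℕ) (a : ℝ) (φ : List X → ℝ) :
    listAvg v T k (fun l => a * φ l) = a * listAvg v T k φ := by
  induction k generalizing φ with
  | zero => rfl
  | succ k ih => simp only [listAvg, ih, avg_mul]

lemma listAvg_list_sum {ι : Type*} (h1 : ∑ ω, v ω = 1) (k : ℕ) (L : List ι)
    (φ : ι → List X → ℝ) :
    listAvg v T k (fun l => (L.map fun i => φ i l).sum) =
      (L.map fun i => listAvg v T k (φ i)).sum := by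
  induction L with
  | nil => simp [listAvg_const h1]
  | cons i L ih => simp only [List.map_cons, List.sum_cons, listAvg_add, ih]

/-- This is how one conditions on the samples already used: the inner average treats them as fixed.
-/
lemma listAvg_append (a b : ℕ) (φ : List X → ℝ) :
    listAvg v T (a + b) φ = listAvg v T a fun l => listAvg v T b fun l' => φ (l ++ l') := by
  induction a generalizing φ with
  | zero => simp [listAvg]
  | succ a ih =>
    rw [Nat.add_right_comm]
    simp only [listAvg, ih, List.cons_append]

lemma listAvg_sum (h1 : ∑ ω, v ω = 1) (k : ℕ) (h : X → ℝ) :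
    listAvg v T k (fun l => (l.map h).sum) = k * avg v T h := by
  induction k with
  | zero => simp [listAvg]
  | succ k ih =>
    simp only [listAvg, List.map_cons, List.sum_cons, listAvg_add, listAvg_const h1, ih, avg_add,
      avg_const h1]
    push_cast; ring

lemma listAvg_prod (k : ℕ) (h : X → ℝ) :
    listAvg v T k (fun l => (l.map h).prod) = avg v T h ^ k := by
  induction k with
  | zero => simp [listAvg]
  | succ k ih =>
    simp only [listAvg, List.map_cons, List.prod_cons, listAvg_mul, ih]
    rw [pow_succ, mul_comm (_ ^ k)]
    simp only [mul_comm _ (avg v T h ^ k), avg_mul]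

/-! ### The comparison of two centers on a sample -/

lemma prod_map_exp (a : ℝ) (f h : X → ℝ) (l : List X) :
    (l.map fun x => Real.exp (-(a * (f x - h x)))).prod =
      Real.exp (-(a * ((l.map f).sum - (l.map h).sum))) := by
  induction l with
  | nil => simp
  | cons x l ih =>
    simp only [List.map_cons, List.prod_cons, List.sum_cons, ih, ← Real.exp_add]
    congr 1; ring

/-- A sum of `k` samples rarely prefers `f` to `h` if `f` has the larger expectation. -/
lemma listAvg_ind_sum_le (hv : ∀ ω, 0 ≤ v ω) (h1 : ∑ ω, v ω = 1) {f h : X → ℝ} {r η : ℝ}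
    (hη : 0 < η) (hη1 : η ≤ 1) (hr : 0 ≤ r) (habs : ∀ x, |f x - h x| ≤ r)
    (hadd : ∀ x, r ≤ f x + h x) (hh : ∀ x, 0 ≤ h x)
    (hlt : (1 + η) * avg v T h < avg v T f) (k : ℕ) :
    listAvg v T k (fun l => ind ((l.map f).sum ≤ (l.map h).sum)) ≤
      Real.exp (-(k * (η ^ 2 / 64))) := by
  have hh0 : 0 ≤ avg v T h := avg_nonneg hv hh
  -- For r = 0 the functions coincide, which contradicts `hlt`; afterwards division by r is safe.
  have hr0 : 0 < r := by
    rcases hr.lt_or_eq with h0 | h0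
    · exact h0
    · have : avg v T f ≤ avg v T h := avg_mono hv fun x => by
        have := (abs_le.1 (habs x)).2
        linarith
      nlinarith
  have hsum : r ≤ avg v T f + avg v T h := by
    rw [← avg_add, ← avg_const (T := T) h1 r]
    exact avg_mono hv hadd
  -- Since r is at most the sum of both expectations, the relative gap becomes a gap proportional to
  -- the range r.
  have hgap : η / 3 * r ≤ avg v T f - avg v T h := by
    have h2 := mul_le_mul_of_nonneg_left hsum (show 0 ≤ η / 3 by positivity)
    have h3 := mul_le_mul_of_nonneg_left hlt.le (show 0 ≤ 1 - η / 3 by linarith)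
    have h4 : 0 ≤ η / 3 * (1 - η) * avg v T h :=
      mul_nonneg (mul_nonneg (by positivity) (by linarith)) hh0
    nlinarith
  -- The tilt η/(6r) keeps the exponent y in [-η/6, η/6], where exp(-y) ≤ 1 - y + y². The
  -- expectation is then at most 1 - η²/18 + η²/36 = 1 - η²/36.
  have hexp : avg v T (fun x => Real.exp (-(η / (6 * r) * (f x - h x)))) ≤
      Real.exp (-(η ^ 2 / 64)) := by
    have key : ∀ x, Real.exp (-(η / (6 * r) * (f x - h x))) ≤
        (1 + η ^ 2 / 36) - η / (6 * r) * (f x - h x) := by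
      intro x
      have hx : |η / (6 * r) * (f x - h x)| ≤ η / 6 := by
        rw [abs_mul, abs_of_nonneg (by positivity)]
        calc η / (6 * r) * |f x - h x| ≤ η / (6 * r) * r :=
              mul_le_mul_of_nonneg_left (habs x) (by positivity)
          _ = η / 6 := by field_simp
      have hb := Real.abs_exp_sub_one_sub_id_le (x := -(η / (6 * r) * (f x - h x)))
        (by rw [abs_neg]; linarith)
      have hsq : (-(η / (6 * r) * (f x - h x))) ^ 2 ≤ (η / 6) ^ 2 := by
        rw [neg_sq]
        exact sq_le_sq.2 (hx.trans (le_abs_self _))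
      have := (abs_le.1 hb).2
      nlinarith
    refine (avg_mono hv key).trans ?_
    rw [avg_sub, avg_const h1, avg_mul, avg_sub]
    have h3 : η / (6 * r) * (η / 3 * r) = η ^ 2 / 18 := by field_simp; norm_num
    have h4 := mul_le_mul_of_nonneg_left hgap (show 0 ≤ η / (6 * r) by positivity)
    have h5 := Real.add_one_le_exp (-(η ^ 2 / 64))
    nlinarith [sq_nonneg η]
  calc listAvg v T k (fun l => ind ((l.map f).sum ≤ (l.map h).sum))
      ≤ listAvg v T k fun l => (l.map fun x => Real.exp (-(η / (6 * r) * (f x - h x)))).prod := by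
        refine listAvg_mono hv fun l _ => ?_
        rw [prod_map_exp]
        refine ind_le (Real.exp_pos _).le fun hl => Real.one_le_exp ?_
        have : 0 ≤ η / (6 * r) := by positivity
        nlinarith
    _ = avg v T (fun x => Real.exp (-(η / (6 * r) * (f x - h x)))) ^ k := listAvg_prod k _
    _ ≤ Real.exp (-(η ^ 2 / 64)) ^ k :=
        pow_le_pow_left₀ (avg_nonneg hv fun x => (Real.exp_pos _).le) hexp k
    _ = Real.exp (-(k * (η ^ 2 / 64))) := by rw [← Real.exp_nat_mul]; congr 1; ring

/-! ### The set median problem -/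

/-- What the analysis needs of the costs `m c x` of centers `c` for samples `x`, of the distance of
centers, and of the subgradient step `step s c x`. -/
structure MedianCost (C X : Type*) where
  m : C → X → ℝ
  ds : C → C → ℝ
  step : ℝ → C → X → C
  m_nonneg : ∀ c x, 0 ≤ m c x
  ds_nonneg : ∀ c c', 0 ≤ ds c c'
  abs_sub_le : ∀ c c' x, |m c x - m c' x| ≤ ds c c'
  ds_le : ∀ c c' x, ds c c' ≤ m c x + m c' x
  step_le : ∀ s c x c', 0 ≤ s →
    ds (step s c x) c' ^ 2 ≤ ds c c' ^ 2 - 2 * s * (m c x - m c' x) + s ^ 2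

namespace MedianCost

variable (M : MedianCost C X)

/-- The centers reached from `c` by steps of size `s`. -/
def centers (s : ℝ) : C → List X → List C
  | _, [] => []
  | c, x :: l => M.step s c x :: centers s (M.step s c x) l

/-- The centers reached in runs of `ℓ` steps each, with doubling step sizes. -/
noncomputable def runs (ℓ : ℕ) (c : C) : ℕ → ℝ → List X → List C
  | 0, _, _ => []
  | j + 1, s, l => M.centers s c (l.take ℓ) ++ runs ℓ c j (s + s) (l.drop ℓ)

/-- Run number i consumes its own block of ℓ samples and uses the step size doubled i times, so it
can be analysed alone. -/
lemma centers_subset_runs (ℓ : ℕ) (c : C) {i j : ℕ} (hij : i < j) (s : ℝ) (l : List X) :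
    M.centers (2 ^ i * s) c ((l.drop (i * ℓ)).take ℓ) ⊆ M.runs ℓ c j s l := by
  induction i generalizing j s l with
  | zero =>
    obtain ⟨j, rfl⟩ := Nat.exists_eq_succ_of_ne_zero hij.ne'
    simp [runs]
  | succ i ih =>
    obtain ⟨j, rfl⟩ := Nat.exists_eq_succ_of_ne_zero (Nat.ne_zero_of_lt hij)
    have := ih (Nat.lt_of_succ_lt_succ hij) (s + s) (l.drop ℓ)
    rw [List.drop_drop] at this
    rw [show 2 ^ (i + 1) * s = 2 ^ i * (s + s) by ring, show (i + 1) * ℓ = ℓ + i * ℓ by ring]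
    exact fun x hx => List.mem_append_right _ (this hx)

lemma length_centers (s : ℝ) (c : C) (l : List X) : (M.centers s c l).length = l.length := by
  induction l generalizing c with
  | nil => rfl
  | cons x l ih => simp [centers, ih]

lemma length_runs (ℓ : ℕ) (c : C) (j : ℕ) (s : ℝ) (l : List X) :
    (M.runs ℓ c j s l).length ≤ j * ℓ := by
  induction j generalizing s l with
  | zero => simp [runs]
  | succ j ih =>
    simp only [runs, List.length_append, length_centers, List.length_take]
    have := ih (s + s) (l.drop ℓ)
    rw [Nat.succ_mul]
    omega

lemma runs_append (ℓ : ℕ) (c : C) (j : ℕ) (s : ℝ) (l l' : List X) (hl : l.length = j * ℓ) :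
    M.runs ℓ c j s (l ++ l') = M.runs ℓ c j s l := by
  induction j generalizing s l with
  | zero => rfl
  | succ j ih =>
    have h1 : ℓ ≤ l.length := by rw [hl, Nat.succ_mul]; exact Nat.le_add_left _ _
    rw [runs, runs, List.take_append_of_le_length h1, List.drop_append_of_le_length h1,
      ih _ _ (by rw [List.length_drop, hl, Nat.succ_mul, Nat.add_sub_cancel])]

variable (v T) in
/-- The expected cost of a center. -/
noncomputable def cost (c : C) : ℝ := avg v T (M.m c)

lemma cost_nonneg (hv : ∀ ω, 0 ≤ v ω) (c : C) : 0 ≤ M.cost v T c :=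
  avg_nonneg hv (M.m_nonneg c)

lemma cost_le (hv : ∀ ω, 0 ≤ v ω) (h1 : ∑ ω, v ω = 1) (c c' : C) :
    M.cost v T c ≤ M.cost v T c' + M.ds c c' := by
  rw [← avg_const (T := T) h1 (M.ds c c'), cost, cost, ← avg_add]
  refine avg_mono hv fun x => ?_
  have := (abs_le.1 (M.abs_sub_le c c' x)).2
  linarith

/-- If all centers of a run were more expensive than `c'` by at least `b`, the distance to `c'`
would become negative on average. -/
lemma listAvg_centers_le (hv : ∀ ω, 0 ≤ v ω) (h1 : ∑ ω, v ω = 1) {s b : ℝ} (hs : 0 ≤ s)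
    (hb : 0 ≤ b) (c c' : C) (k : ℕ) :
    2 * s * k * b * listAvg v T k
      (fun l => ind (∀ x ∈ c :: M.centers s c l, M.cost v T c' + b < M.cost v T x)) ≤
      M.ds c c' ^ 2 + k * s ^ 2 := by
  induction k generalizing c with
  | zero => simp; positivity
  | succ k ih =>
    -- If c itself is cheap, the event is impossible. Otherwise the first step lowers the expected
    -- squared distance by at least 2sb - s², and the induction hypothesis applies from the new
    -- center.
    by_cases hc : M.cost v T c' + b < M.cost v T c
    · set F := listAvg v T (k + 1)
        (fun l => ind (∀ x ∈ c :: M.centers s c l, M.cost v T c' + b < M.cost v T x)) with hF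
      -- The decrease 2sb of the first step only has to pay for one summand 2sbF.
      have hF1 : F ≤ 1 := listAvg_le hv h1 fun l _ => ind_le_one _
      have hF2 : 2 * s * k * b * F ≤ avg v T fun x => M.ds c c' ^ 2
          - 2 * s * (M.m c x - M.m c' x) + s ^ 2 + k * s ^ 2 := by
        rw [hF, listAvg, ← avg_mul]
        refine avg_mono hv fun x => ?_
        refine le_trans ?_ ((ih (M.step s c x)).trans
          (add_le_add_left (M.step_le s c x c' hs) _))
        refine mul_le_mul_of_nonneg_left ?_ (by positivity)
        refine listAvg_mono hv fun l _ => ind_mono fun h y hy => h y ?_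
        exact List.mem_cons_of_mem _ hy
      have hF3 : (avg v T fun x => M.ds c c' ^ 2
          - 2 * s * (M.m c x - M.m c' x) + s ^ 2 + k * s ^ 2) = M.ds c c' ^ 2
          - 2 * s * (M.cost v T c - M.cost v T c') + s ^ 2 + k * s ^ 2 := by
        rw [avg_add, avg_add, avg_sub, avg_mul, avg_sub]
        simp only [avg_const h1]
        rfl
      have h4 : 2 * s * b ≤ 2 * s * (M.cost v T c - M.cost v T c') :=
        mul_le_mul_of_nonneg_left (by linarith) (by positivity)
      have h5 : 2 * s * b * F ≤ 2 * s * b * 1 :=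
        mul_le_mul_of_nonneg_left hF1 (by positivity)
      push_cast
      nlinarith
    · have : (fun l => ind (∀ x ∈ c :: M.centers s c l, M.cost v T c' + b < M.cost v T x)) =
          fun _ => 0 := by
        funext l
        exact ind_not fun h => hc (h c List.mem_cons_self)
      rw [this, listAvg_const h1, mul_zero]
      positivity

/-- Among the centers of a long enough run with a suitable step size there is a good one. -/
lemma listAvg_centers_le_eighth (hv : ∀ ω, 0 ≤ v ω) (h1 : ∑ ω, v ω = 1) {s η : ℝ} (hη : 0 < η)
    (hη1 : η ≤ 1) (c c' : C) {ℓ : ℕ} (hℓ : (68 / η) ^ 2 ≤ ℓ) (hR : 0 < M.ds c c')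
    (hR8 : M.ds c c' ≤ 8 * M.cost v T c')
    (hs1 : M.ds c c' ≤ s * Real.sqrt (ℓ + 1)) (hs2 : s * Real.sqrt (ℓ + 1) ≤ 2 * M.ds c c') :
    listAvg v T ℓ (fun l => ind (∀ x ∈ c :: M.centers s c l,
      (1 + 9 * η) * M.cost v T c' < M.cost v T x)) ≤ 1 / 8 := by
  set R := M.ds c c' with hRdef
  set G := M.cost v T c' with hG
  have hG0 : 0 < G := by linarith
  set q := Real.sqrt (ℓ + 1) with hq
  have hq2 : q ^ 2 = ℓ + 1 := Real.sq_sqrt (by positivity)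
  have h68 : 0 < 68 / η := by positivity
  have hq68 : 68 / η ≤ q := Real.le_sqrt_of_sq_le (by linarith)
  have hq0 : 0 < q := h68.trans_le hq68
  have hs0 : 0 < s := by
    by_contra h
    have := mul_nonpos_of_nonpos_of_nonneg (not_lt.1 h) hq0.le
    linarith
  -- The slack b = 9ηG turns the threshold G + b into (1 + 9η)G.
  have hmain := M.listAvg_centers_le (T := T) hv h1 hs0.le
    (show 0 ≤ 9 * η * G by positivity) c c' ℓ
  rw [← hRdef, ← hG] at hmain
  have hrw : G + 9 * η * G = (1 + 9 * η) * G := by ring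
  rw [hrw] at hmain
  set F := listAvg v T ℓ (fun l => ind (∀ x ∈ c :: M.centers s c l,
      (1 + 9 * η) * G < M.cost v T x)) with hF
  have hF0 : 0 ≤ F := listAvg_nonneg hv fun l => ind_nonneg _
  have hℓ1 : (1 : ℝ) ≤ ℓ := by
    have h1 : (1 : ℝ) ≤ 68 / η := by rw [le_div_iff₀ hη]; linarith
    nlinarith
  -- multiply by `q²`
  set u := s * q with hu
  have e1 : 2 * u * ℓ * (9 * η * G) * q * F ≤ R ^ 2 * q ^ 2 + ℓ * u ^ 2 := by
    have := mul_le_mul_of_nonneg_right hmain (sq_nonneg q)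
    calc 2 * u * ℓ * (9 * η * G) * q * F = 2 * s * ℓ * (9 * η * G) * F * q ^ 2 := by
          rw [hu]; ring
      _ ≤ (R ^ 2 + ℓ * s ^ 2) * q ^ 2 := this
      _ = _ := by rw [hu]; ring
  -- R²(ℓ + 1) + 4ℓR² ≤ 6ℓR² because u ≤ 2R and ℓ ≥ 1; then one factor R is replaced by 8G.
  have e2 : R ^ 2 * q ^ 2 + ℓ * u ^ 2 ≤ ℓ * (6 * R ^ 2) := by
    have : u ^ 2 ≤ 4 * R ^ 2 := by nlinarith
    rw [hq2]
    nlinarith [sq_nonneg R, mul_le_mul_of_nonneg_left this (show (0:ℝ) ≤ ℓ by positivity)]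
  have e3 : ℓ * (6 * R ^ 2) ≤ ℓ * (48 * R * G) := by
    apply mul_le_mul_of_nonneg_left _ (by positivity)
    nlinarith
  -- 1224 = 18 · 68, using u ≥ R and ηq ≥ 68. Together with the upper bound this gives F ≤ 48/1224 <
  -- 1/8.
  have e4 : ℓ * (R * G * (1224 * F)) ≤ 2 * u * ℓ * (9 * η * G) * q * F := by
    have hqη : 68 ≤ η * q := by
      have := (div_le_iff₀ hη).1 hq68
      linarith
    calc ℓ * (R * G * (1224 * F)) = 18 * ℓ * G * F * (R * 68) := by ring
      _ ≤ 18 * ℓ * G * F * (u * (η * q)) := by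
          apply mul_le_mul_of_nonneg_left _ (by positivity)
          exact mul_le_mul hs1 hqη (by norm_num) (hR.le.trans hs1)
      _ = _ := by ring
  have e5 : ℓ * (R * G) * (1224 * F) ≤ ℓ * (R * G) * 48 := by nlinarith
  have := le_of_mul_le_mul_left e5 (by positivity)
  linarith

/-- A center that minimizes the cost on a sample is nearly as good as every candidate. -/
lemma listAvg_select_le (hv : ∀ ω, 0 ≤ v ω) (h1 : ∑ ω, v ω = 1) {η : ℝ} (hη : 0 < η)
    (hη1 : η ≤ 1) {L : List C} {N k : ℕ} (hN : L.length ≤ N) (hN0 : 0 < N)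
    (hk : 64 / η ^ 2 * Real.log (8 * N) ≤ k) {sel : List X → C}
    (hsel : ∀ l : List X, l.length = k → sel l ∈ L)
    (hmin : ∀ l : List X, l.length = k → ∀ c ∈ L, (l.map (M.m (sel l))).sum ≤ (l.map (M.m c)).sum)
    {c : C} (hc : c ∈ L) {G : ℝ} (hG : M.cost v T c ≤ G) :
    listAvg v T k (fun l => ind ((1 + η) * G < M.cost v T (sel l))) ≤ 1 / 8 := by
  set Bad : C → Prop := fun c' => (1 + η) * M.cost v T c < M.cost v T c' with hBad
  have hNr : (0 : ℝ) < 8 * N := by positivity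
  have hexp : Real.exp (-(k * (η ^ 2 / 64))) ≤ 1 / (8 * N) := by
    rw [one_div, ← Real.exp_log (inv_pos.2 hNr), Real.log_inv]
    refine Real.exp_le_exp.2 (neg_le_neg ?_)
    have := mul_le_mul_of_nonneg_right hk (show 0 ≤ η ^ 2 / 64 by positivity)
    refine le_trans (le_of_eq ?_) this
    field_simp
  -- Union bound over the candidates, which do not depend on l: a bad selected center has to beat
  -- the fixed good candidate c on the sample, which for each bad candidate has probability at most
  -- 1/(8N).
  calc listAvg v T k (fun l => ind ((1 + η) * G < M.cost v T (sel l)))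
      ≤ listAvg v T k fun l => (L.map fun c' => ind (Bad c') *
          ind ((l.map (M.m c')).sum ≤ (l.map (M.m c)).sum)).sum := by
        refine listAvg_mono hv fun l hl => ind_le ?_ fun hb => ?_
        · refine List.sum_nonneg fun a ha => ?_
          obtain ⟨c', -, rfl⟩ := List.mem_map.1 ha
          exact mul_nonneg (ind_nonneg _) (ind_nonneg _)
        · have hb' : Bad (sel l) := lt_of_le_of_lt
            (mul_le_mul_of_nonneg_left hG (by positivity)) hb
          refine le_trans (le_of_eq ?_) (List.single_le_sum ?_ _
            (List.mem_map.2 ⟨sel l, hsel l hl, rfl⟩))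
          · rw [ind_of hb', ind_of (hmin l hl c hc), one_mul]
          · intro a ha
            obtain ⟨c', -, rfl⟩ := List.mem_map.1 ha
            exact mul_nonneg (ind_nonneg _) (ind_nonneg _)
    _ = (L.map fun c' => listAvg v T k fun l : List X => ind (Bad c') *
          ind ((l.map (M.m c')).sum ≤ (l.map (M.m c)).sum)).sum := listAvg_list_sum h1 _ _ _
    _ ≤ (L.map fun c' => listAvg v T k fun l : List X => ind (Bad c') *
          ind ((l.map (M.m c')).sum ≤ (l.map (M.m c)).sum)).length • (1 / (8 * N : ℝ)) := by
        refine List.sum_le_card_nsmul _ _ fun a ha => ?_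
        obtain ⟨c', -, rfl⟩ := List.mem_map.1 ha
        rw [listAvg_mul]
        by_cases hb : Bad c'
        · rw [ind_of hb, one_mul]
          exact (listAvg_ind_sum_le hv h1 hη hη1 (M.ds_nonneg c' c) (M.abs_sub_le c' c)
            (M.ds_le c' c) (M.m_nonneg c) hb k).trans hexp
        · rw [ind_not hb, zero_mul]
          positivity
    _ ≤ N * (1 / (8 * N : ℝ)) := by
        rw [List.length_map, nsmul_eq_mul]
        exact mul_le_mul_of_nonneg_right (by exact_mod_cast hN) (by positivity)
    _ = 1 / 8 := by
        have : (N : ℝ) ≠ 0 := by positivity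
        field_simp

/-- The estimate of the average cost is rarely small compared to the distance to the optimum. -/
lemma listAvg_estimate_lt (hv : ∀ ω, 0 ≤ v ω) (h1 : ∑ ω, v ω = 1) {η : ℝ}
    (hη1 : η ≤ 1 / 6) {c c' : C} (hopt : M.cost v T c' ≤ M.cost v T c) (hR : 0 < M.ds c c')
    {k : ℕ} (hk : 5 ≤ k) :
    listAvg v T k (fun l => ind ((l.map (M.m c)).sum < η * M.ds c c')) ≤ 1 / 8 := by
  set R := M.ds c c' with hRdef
  have hq : avg v T (fun x => ind (M.m c x < η * R)) ≤ 3 / 5 := by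
    -- A sample within ηR of c costs c' at least (1 - 2η)R more than c, and no sample costs it more
    -- than R less. As c' is not worse on average, such samples have probability at most 1/(2 - 2η)
    -- ≤ 3/5.
    have key : avg v T (fun x => (2 - 2 * η) * R * ind (M.m c x < η * R) - R) ≤
        avg v T fun x => M.m c' x - M.m c x := by
      refine avg_mono hv fun x => ?_
      by_cases hx : M.m c x < η * R
      · rw [ind_of hx]
        have := M.ds_le c c' x
        nlinarith
      · rw [ind_not hx]
        have := (abs_le.1 (M.abs_sub_le c c' x)).2
        linarith
    rw [avg_sub, avg_mul, avg_const h1, avg_sub] at key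
    have hopt' : avg v T (M.m c') ≤ avg v T (M.m c) := hopt
    have h2 : R * ((2 - 2 * η) * avg v T (fun x => ind (M.m c x < η * R))) ≤ R * 1 := by nlinarith
    have h3 := le_of_mul_le_mul_left h2 hR
    have h4 : 0 ≤ avg v T (fun x => ind (M.m c x < η * R)) := avg_nonneg hv fun _ => ind_nonneg _
    nlinarith
  -- Costs are nonnegative, so a small total forces every single sample to be small.
  have hl : ∀ l : List X, (l.map (M.m c)).sum < η * R →
      (l.map fun x => ind (M.m c x < η * R)).prod = 1 := by
    intro l hl
    refine List.prod_eq_one fun a ha => ?_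
    obtain ⟨x, hx, rfl⟩ := List.mem_map.1 ha
    refine ind_of (lt_of_le_of_lt (List.single_le_sum ?_ _ (List.mem_map_of_mem hx)) hl)
    intro a ha
    obtain ⟨y, -, rfl⟩ := List.mem_map.1 ha
    exact M.m_nonneg c y
  calc _ ≤ listAvg v T k fun l => (l.map fun x => ind (M.m c x < η * R)).prod := by
        refine listAvg_mono hv fun l _ => ind_le ?_ fun h => (hl l h).ge
        refine List.prod_nonneg fun a ha => ?_
        obtain ⟨x, -, rfl⟩ := List.mem_map.1 ha
        exact ind_nonneg _
    _ = avg v T (fun x => ind (M.m c x < η * R)) ^ k := listAvg_prod _ _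
    _ ≤ (3 / 5) ^ k := pow_le_pow_left₀ (avg_nonneg hv fun _ => ind_nonneg _) hq k
    _ ≤ (3 / 5) ^ 5 := pow_le_pow_of_le_one (by norm_num) (by norm_num) hk
    _ ≤ 1 / 8 := by norm_num

end MedianCost

end Sampling

end PSEB

namespace PSEB

/-! ### Failure probability of the set median algorithm. -/

namespace MedianCost

variable {Ω X C : Type*} [Fintype Ω] {v : Ω → ℝ} {T : Ω → X} (M : MedianCost C X)

/-- The failure probability after the first sample and the estimate of the cost are drawn, if some
run uses a suitable step size or the initial center is good. -/
lemma listAvg_runs_le (hv : ∀ ω, 0 ≤ v ω) (h1 : ∑ ω, v ω = 1) {η s : ℝ} (hη : 0 < η)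
    (hη1 : η ≤ 1) {c c' : C} {ℓ J k : ℕ} (hℓ : (68 / η) ^ 2 ≤ ℓ)
    (hk : 64 / η ^ 2 * Real.log (8 * (J * ℓ + 1 : ℕ)) ≤ k) {sel : List X → List X → C}
    (hsel : ∀ l l' : List X, l.length = J * ℓ → l'.length = k → sel l l' ∈ c :: M.runs ℓ c J s l)
    (hmin : ∀ l l' : List X, l.length = J * ℓ → l'.length = k → ∀ x ∈ c :: M.runs ℓ c J s l,
      (l'.map (M.m (sel l l'))).sum ≤ (l'.map (M.m x)).sum)
    (hgood : M.cost v T c ≤ (1 + 9 * η) * M.cost v T c' ∨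
      ∃ i < J, 0 < M.ds c c' ∧ M.ds c c' ≤ 8 * M.cost v T c' ∧
        M.ds c c' ≤ 2 ^ i * s * Real.sqrt (ℓ + 1) ∧
        2 ^ i * s * Real.sqrt (ℓ + 1) ≤ 2 * M.ds c c') :
    listAvg v T (J * ℓ) (fun l => listAvg v T k fun l' =>
      ind ((1 + η) * ((1 + 9 * η) * M.cost v T c') < M.cost v T (sel l l'))) ≤ 2 / 8 := by
  set G := (1 + 9 * η) * M.cost v T c' with hG
  -- For fixed descent samples, failure means that no candidate is good or that the comparison on
  -- fresh samples goes wrong.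
  have step : ∀ l : List X, l.length = J * ℓ → listAvg v T k (fun l' =>
      ind ((1 + η) * G < M.cost v T (sel l l'))) ≤
      1 / 8 + ind (∀ x ∈ c :: M.runs ℓ c J s l, G < M.cost v T x) := by
    intro l hl
    by_cases hall : ∀ x ∈ c :: M.runs ℓ c J s l, G < M.cost v T x
    · rw [ind_of hall]
      have : listAvg v T k (fun l' => ind ((1 + η) * G < M.cost v T (sel l l'))) ≤ 1 :=
        listAvg_le hv h1 fun l' _ => ind_le_one _
      linarith
    · rw [ind_not hall, add_zero]
      push Not at hall
      obtain ⟨x, hx, hxG⟩ := hall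
      refine M.listAvg_select_le hv h1 hη hη1 (L := c :: M.runs ℓ c J s l) (N := J * ℓ + 1) ?_
        (Nat.succ_pos _) hk (fun l' hl' => hsel l l' hl hl')
        (fun l' hl' => hmin l l' hl hl') hx hxG
      simpa using M.length_runs ℓ c J s l
  refine (listAvg_mono hv step).trans ?_
  rw [listAvg_add, listAvg_const h1]
  suffices h : listAvg v T (J * ℓ)
      (fun l => ind (∀ x ∈ c :: M.runs ℓ c J s l, G < M.cost v T x)) ≤ 1 / 8 by linarith
  rcases hgood with hc | ⟨i, hi, hR, hR8, hs1, hs2⟩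
  · refine listAvg_le hv h1 fun l _ => ?_
    rw [ind_not fun h => (h c List.mem_cons_self).not_ge hc]
    norm_num
  · obtain ⟨e, rfl⟩ := Nat.exists_eq_add_of_lt hi
    -- Only the block of run i matters; the samples before and after it are fixed arbitrarily.
    rw [show (i + e + 1) * ℓ = i * ℓ + (ℓ + e * ℓ) by ring, listAvg_append]
    refine listAvg_le hv h1 fun l₁ hl₁ => ?_
    rw [listAvg_append]
    refine le_trans (listAvg_mono hv fun l₂ hl₂ => listAvg_le hv h1 fun l₃ _ => ?_)
      (M.listAvg_centers_le_eighth hv h1 hη hη1 c c' hℓ hR hR8 hs1 hs2)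
    refine ind_mono fun h x hx => h x ?_
    rcases List.mem_cons.1 hx with rfl | hx
    · exact List.mem_cons_self
    · refine List.mem_cons_of_mem _ (M.centers_subset_runs ℓ c hi s _ ?_)
      rw [← hl₁, List.drop_left, ← hl₂, List.take_left]
      exact hx

/-- There is a suitable step size if the estimate of the cost is neither too small nor too large. -/
lemma exists_step_size {η R r q : ℝ} {J : ℕ} (hη : 0 < η) (hR : 0 < R)
    (hJ : 2 / η ^ 4 ≤ 2 ^ J) (hq : 0 < q) (hlow : η * R ≤ r) (hup : η ^ 3 * r ≤ 4 * R) :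
    ∃ i < J + 1, R ≤ 2 ^ i * (η ^ 3 * r / (q + q)) * q ∧
      2 ^ i * (η ^ 3 * r / (q + q)) * q ≤ 2 * R := by
  have e : ∀ i : ℕ, 2 ^ i * (η ^ 3 * r / (q + q)) * q = 2 ^ i * (η ^ 3 * r / 2) := by
    intro i; field_simp; norm_num
  simp only [e]
  -- The lower bound r ≥ ηR reduces this to 2^J ≥ 2/η⁴, which is where the number of runs comes
  -- from.
  have hJR : R ≤ 2 ^ J * (η ^ 3 * r / 2) := by
    have h1 : η ^ 3 * (η * R) ≤ η ^ 3 * r := mul_le_mul_of_nonneg_left hlow (by positivity)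
    calc R = 2 / η ^ 4 * (η ^ 3 * (η * R) / 2) := by field_simp
      _ ≤ 2 / η ^ 4 * (η ^ 3 * r / 2) := by gcongr
      _ ≤ _ := by
        apply mul_le_mul_of_nonneg_right hJ
        have : 0 ≤ η ^ 3 * (η * R) := by positivity
        linarith
  classical
  -- The least such i works: its predecessor stays below R, so doubling stays below 2R. For i = 0
  -- the upper bound is `hup`.
  have hex : ∃ i : ℕ, R ≤ 2 ^ i * (η ^ 3 * r / 2) := ⟨J, hJR⟩
  refine ⟨Nat.find hex, Nat.lt_succ_of_le (Nat.find_min' hex hJR), Nat.find_spec hex, ?_⟩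
  rcases h : Nat.find hex with _ | i
  · rw [pow_zero]; linarith
  · have := Nat.find_min hex (m := i) (by omega)
    rw [pow_succ]
    linarith

/-- The failure probability after the first sample is drawn. -/
lemma listAvg_estimate_le (hv : ∀ ω, 0 ≤ v ω) (h1 : ∑ ω, v ω = 1) {η : ℝ} (hη : 0 < η)
    (hη1 : η ≤ 1 / 100) {c c' : C} (hopt : M.cost v T c' ≤ M.cost v T c) {e : ℕ}
    (he : 1 / η ≤ e) (he' : (e : ℝ) ≤ 1 / η + 1) {q : ℝ} (hq : 0 < q)
    {J : ℕ} (hJ : 2 / η ^ 4 ≤ 2 ^ J) (hR8 : M.ds c c' ≤ 8 * M.cost v T c')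
    {F : List X → ℝ} (hF1 : ∀ l, F l ≤ 1)
    (hF : ∀ l : List X, l.length = e → (M.cost v T c ≤ (1 + 9 * η) * M.cost v T c' ∨
      ∃ i < J + 1, 0 < M.ds c c' ∧ M.ds c c' ≤ 8 * M.cost v T c' ∧
        M.ds c c' ≤ 2 ^ i * (η ^ 3 * (l.map (M.m c)).sum / (q + q)) * q ∧
        2 ^ i * (η ^ 3 * (l.map (M.m c)).sum / (q + q)) * q ≤ 2 * M.ds c c') → F l ≤ 2 / 8) :
    listAvg v T e F ≤ 4 / 8 := by
  by_cases hc : M.cost v T c ≤ (1 + 9 * η) * M.cost v T c'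
  · refine listAvg_le hv h1 fun l hl => (hF l hl (Or.inl hc)).trans (by norm_num)
  have hG0 : 0 ≤ M.cost v T c' := M.cost_nonneg hv c'
  have hle := M.cost_le (T := T) hv h1 c c'
  set R := M.ds c c' with hRdef
  set G := M.cost v T c' with hGdef
  have hRG : 9 * η * G < R := by linarith
  have hR : 0 < R := lt_of_le_of_lt (by positivity) hRG
  -- The linear last term dominates the indicator of a too large estimate, so its expectation is
  -- Markov's bound.
  have hpt : ∀ l : List X, l.length = e → F l ≤ 2 / 8 + (ind ((l.map (M.m c)).sum < η * R) +
      η ^ 3 / (4 * R) * (l.map (M.m c)).sum) := by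
    intro l hl
    have hs0 : 0 ≤ (l.map (M.m c)).sum := List.sum_nonneg fun a ha => by
      obtain ⟨x, -, rfl⟩ := List.mem_map.1 ha
      exact M.m_nonneg c x
    have hs1 : 0 ≤ η ^ 3 / (4 * R) * (l.map (M.m c)).sum := by positivity
    by_cases hlow : (l.map (M.m c)).sum < η * R
    · rw [ind_of hlow]
      linarith [hF1 l]
    · rw [ind_not hlow]
      by_cases hup : η ^ 3 * (l.map (M.m c)).sum ≤ 4 * R
      · obtain ⟨i, hi, h3, h4⟩ := exists_step_size hη hR hJ hq (not_lt.1 hlow) hup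
        have := hF l hl (Or.inr ⟨i, hi, hR, hR8, h3, h4⟩)
        linarith
      · have : 1 ≤ η ^ 3 / (4 * R) * (l.map (M.m c)).sum := by
          rw [div_mul_eq_mul_div, le_div_iff₀ (by positivity)]
          linarith
        linarith [hF1 l]
  refine (listAvg_mono hv hpt).trans ?_
  rw [listAvg_add, listAvg_const h1, listAvg_add, listAvg_mul, listAvg_sum h1]
  have he5 : 5 ≤ e := by
    have : (100 : ℝ) ≤ 1 / η := by rw [le_div_iff₀ hη]; linarith
    have : (5 : ℝ) ≤ e := by linarith
    exact_mod_cast this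
  have hA := M.listAvg_estimate_lt (T := T) hv h1 (show η ≤ 1 / 6 by linarith) hopt hR he5
  -- The cost of c is at most G + R, and G < R/(9η) since c is not good. Hence η times this cost is
  -- at most R, while ηe ≤ 1 + η.
  have hB : η ^ 3 / (4 * R) * (e * avg v T (M.m c)) ≤ 1 / 8 := by
    have hcost : avg v T (M.m c) ≤ G + R := hle
    have hcost0 : 0 ≤ avg v T (M.m c) := avg_nonneg hv (M.m_nonneg c)
    have heη : η * e ≤ 1 + η := by
      have := mul_le_mul_of_nonneg_left he' hη.le
      rwa [mul_add, mul_one_div_cancel hη.ne', mul_one] at this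
    have h5 : η * avg v T (M.m c) ≤ R := by nlinarith
    have h6 : (η * e) * (η * avg v T (M.m c)) ≤ (1 + η) * R :=
      mul_le_mul heη h5 (by positivity) (by positivity)
    rw [div_mul_eq_mul_div, div_le_iff₀ (by positivity)]
    calc η ^ 3 * (e * avg v T (M.m c)) = η * ((η * e) * (η * avg v T (M.m c))) := by ring
      _ ≤ η * ((1 + η) * R) := mul_le_mul_of_nonneg_left h6 hη.le
      _ = η * (1 + η) * R := by ring
      _ ≤ 1 / 2 * R := mul_le_mul_of_nonneg_right (by nlinarith) hR.le
      _ = 1 / 8 * (4 * R) := by ring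
  linarith

/-- A random initial center is rarely far from the optimum. -/
lemma avg_ind_far_le (hv : ∀ ω, 0 ≤ v ω) {c₀ : X → C} {c' : C}
    (hc₀ : ∀ x, M.ds (c₀ x) c' ≤ M.m c' x) :
    avg v T (fun x => ind (8 * M.cost v T c' < M.ds (c₀ x) c')) ≤ 1 / 8 := by
  have hle : avg v T (fun x => M.ds (c₀ x) c') ≤ M.cost v T c' := avg_mono hv hc₀
  -- Markov's inequality needs a positive optimum. For optimum 0, every sample of positive weight
  -- starts at distance 0.
  rcases (M.cost_nonneg (T := T) hv c').lt_or_eq with hG | hG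
  · refine le_trans (avg_mono hv (ψ := fun x => 1 / (8 * M.cost v T c') * M.ds (c₀ x) c')
      fun x => ind_le (mul_nonneg (by positivity) (M.ds_nonneg _ _)) fun h => ?_) ?_
    · rw [one_div_mul_eq_div, le_div_iff₀ (by positivity)]
      linarith
    · rw [avg_mul, one_div_mul_eq_div, div_le_iff₀ (by positivity)]
      linarith
  · have h0 : ∀ ω, v ω * M.ds (c₀ (T ω)) c' = 0 := by
      have hs : ∑ ω, v ω * M.ds (c₀ (T ω)) c' = 0 :=
        le_antisymm (by rw [hG]; exact hle)
          (Finset.sum_nonneg fun ω _ => mul_nonneg (hv ω) (M.ds_nonneg _ _))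
      intro ω
      exact (Finset.sum_eq_zero_iff_of_nonneg
        fun ω _ => mul_nonneg (hv ω) (M.ds_nonneg _ _)).1 hs ω (Finset.mem_univ ω)
    have : avg v T (fun x => ind (8 * M.cost v T c' < M.ds (c₀ x) c')) = 0 := by
      refine Finset.sum_eq_zero fun ω _ => ?_
      rcases mul_eq_zero.1 (h0 ω) with h | h
      · rw [h, zero_mul]
      · have h' : ¬8 * M.cost v T c' < M.ds (c₀ (T ω)) c' := by rw [h, ← hG]; simp
        simp only [ind_not h', mul_zero]
    rw [this]; norm_num

/-- The failure probability of the set median algorithm. -/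
lemma listAvg_setMedian_le (hv : ∀ ω, 0 ≤ v ω) (h1 : ∑ ω, v ω = 1) {η : ℝ} (hη : 0 < η)
    (hη1 : η ≤ 1 / 100) {c' : C} (hopt : ∀ c, M.cost v T c' ≤ M.cost v T c) {c₀ : X → C}
    (hc₀ : ∀ x, M.ds (c₀ x) c' ≤ M.m c' x) {e ℓ J k : ℕ}
    (he : 1 / η ≤ e) (he' : (e : ℝ) ≤ 1 / η + 1) (hℓ : (68 / η) ^ 2 ≤ ℓ)
    (hJ : 2 / η ^ 4 ≤ 2 ^ J)
    (hk : 64 / η ^ 2 * Real.log (8 * ((J + 1) * ℓ + 1 : ℕ)) ≤ k) {out : List X → C}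
    (hout : ∀ (x : X) (l₁ l₂ l₃ : List X), l₁.length = e → l₂.length = (J + 1) * ℓ →
      l₃.length = k → out (x :: (l₁ ++ (l₂ ++ l₃))) ∈ c₀ x :: M.runs ℓ (c₀ x) (J + 1)
        (η ^ 3 * (l₁.map (M.m (c₀ x))).sum / (Real.sqrt (ℓ + 1) + Real.sqrt (ℓ + 1))) l₂)
    (hmin : ∀ (x : X) (l₁ l₂ l₃ : List X), l₁.length = e → l₂.length = (J + 1) * ℓ →
      l₃.length = k → ∀ y ∈ c₀ x :: M.runs ℓ (c₀ x) (J + 1)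
        (η ^ 3 * (l₁.map (M.m (c₀ x))).sum / (Real.sqrt (ℓ + 1) + Real.sqrt (ℓ + 1))) l₂,
      (l₃.map (M.m (out (x :: (l₁ ++ (l₂ ++ l₃)))))).sum ≤ (l₃.map (M.m y)).sum) :
    listAvg v T (e + ((J + 1) * ℓ + k) + 1) (fun l =>
      ind ((1 + η) * ((1 + 9 * η) * M.cost v T c') < M.cost v T (out l))) ≤ 5 / 8 := by
  rw [listAvg]
  -- A far initial center is charged fully; a near one fails with probability at most 4/8.
  refine le_trans (avg_mono hv (ψ := fun x => 4 / 8 +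
    ind (8 * M.cost v T c' < M.ds (c₀ x) c')) fun x => ?_) ?_
  · by_cases hR8 : M.ds (c₀ x) c' ≤ 8 * M.cost v T c'
    · rw [ind_not (not_lt.2 hR8), add_zero, listAvg_append]
      refine M.listAvg_estimate_le hv h1 hη hη1 (hopt (c₀ x)) he he'
        (show 0 < Real.sqrt (ℓ + 1) by positivity) hJ hR8
        (fun l => listAvg_le hv h1 fun _ _ => ind_le_one _) fun l₁ hl₁ hgood => ?_
      rw [listAvg_append]
      exact M.listAvg_runs_le hv h1 hη (by linarith) hℓ hk
        (sel := fun l₂ l₃ => out (x :: (l₁ ++ (l₂ ++ l₃))))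
        (fun l₂ l₃ hl₂ hl₃ => hout x l₁ l₂ l₃ hl₁ hl₂ hl₃)
        (fun l₂ l₃ hl₂ hl₃ => hmin x l₁ l₂ l₃ hl₁ hl₂ hl₃) hgood
    · rw [ind_of (not_le.1 hR8)]
      have := listAvg_le (T := T) hv h1 (k := e + ((J + 1) * ℓ + k)) (a := 1) (φ := fun l =>
        ind ((1 + η) * ((1 + 9 * η) * M.cost v T c') < M.cost v T (out (x :: l))))
        fun l _ => ind_le_one _
      linarith
  · rw [avg_add, avg_const h1]
    have := M.avg_ind_far_le (T := T) hv hc₀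
    linarith

end MedianCost

end PSEB

namespace PSEB

/-! ### The values computed by the deterministic parts -/

section Geometry

variable {n z d : ℕ} {D : ProbPoints n z d} {ε : ℝ}

/-- The distance of two stored vectors. -/
noncomputable def vecDist (x y : Vec ℝ d) : ℝ := ‖WithLp.toLp 2 x - WithLp.toLp 2 y‖

open Classical in
/-- The finite set of points that is stored in a `PointSet`. -/
noncomputable def PointSet.toFinset (P : PointSet ℝ d) : Finset (EuclideanSpace ℝ (Fin d)) :=
  ((P.1 :: P.2).map (WithLp.toLp 2)).toFinset

/-- The maximal distance of a stored center from the points of a stored set. -/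
noncomputable def setDist (c : Vec ℝ d) (P : PointSet ℝ d) : ℝ :=
  maxDist (WithLp.toLp 2 c) (PointSet.toFinset P)

lemma PointSet.mem_toFinset {P : PointSet ℝ d} {p : Vec ℝ d} :
    WithLp.toLp 2 p ∈ PointSet.toFinset P ↔ p ∈ P.1 :: P.2 := by
  classical
  simp only [PointSet.toFinset, List.mem_toFinset, List.mem_map]
  exact ⟨fun ⟨q, hq, h⟩ => WithLp.toLp_injective 2 h ▸ hq, fun h => ⟨p, h, rfl⟩⟩

/-! ### Elementary properties of the maximal distance. -/

lemma maxDist_eq {c : EuclideanSpace ℝ (Fin d)} {P : Finset (EuclideanSpace ℝ (Fin d))} {r : ℝ}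
    {p : EuclideanSpace ℝ (Fin d)} (hp : p ∈ P) (hr : r = ‖c - p‖) (h : ∀ q ∈ P, ‖c - q‖ ≤ r) :
    maxDist c P = r := by
  rw [maxDist, dif_pos ⟨p, hp⟩]
  exact le_antisymm (Finset.sup'_le _ _ h) (hr ▸ Finset.le_sup' (fun q => ‖c - q‖) hp)

lemma norm_le_maxDist {c : EuclideanSpace ℝ (Fin d)} {P : Finset (EuclideanSpace ℝ (Fin d))}
    {p : EuclideanSpace ℝ (Fin d)} (hp : p ∈ P) : ‖c - p‖ ≤ maxDist c P := by
  rw [maxDist, dif_pos ⟨p, hp⟩]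
  exact Finset.le_sup' (fun q => ‖c - q‖) hp

lemma maxDist_le {c : EuclideanSpace ℝ (Fin d)} {P : Finset (EuclideanSpace ℝ (Fin d))} {r : ℝ}
    (hr : 0 ≤ r) (h : ∀ q ∈ P, ‖c - q‖ ≤ r) : maxDist c P ≤ r := by
  unfold maxDist
  split_ifs with hP
  · exact Finset.sup'_le _ _ h
  · exact hr

lemma maxDist_nonneg (c : EuclideanSpace ℝ (Fin d)) (P : Finset (EuclideanSpace ℝ (Fin d))) :
    0 ≤ maxDist c P := by
  rcases P.eq_empty_or_nonempty with rfl | ⟨p, hp⟩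
  · simp [maxDist]
  · exact (norm_nonneg _).trans (norm_le_maxDist hp)

lemma maxDist_le_add (c c' : EuclideanSpace ℝ (Fin d)) (P : Finset (EuclideanSpace ℝ (Fin d))) :
    maxDist c P ≤ maxDist c' P + ‖c - c'‖ := by
  refine maxDist_le (add_nonneg (maxDist_nonneg _ _) (norm_nonneg _)) fun q hq => ?_
  have := norm_le_maxDist (c := c') hq
  have := norm_sub_le_norm_sub_add_norm_sub c c' q
  linarith

lemma vecDist_le_setDist {c p : Vec ℝ d} {P : PointSet ℝ d} (hp : p ∈ P.1 :: P.2) :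
    vecDist c p ≤ setDist c P :=
  norm_le_maxDist (PointSet.mem_toFinset.2 hp)

/-! ### Results of the geometric subroutines. -/

lemma isDet_tabulate {m : ℕ} {f : Fin m → Prog ℝ n z d ℝ} (h : ∀ a, (f a).IsDet) :
    (tabulate f).IsDet := by
  induction m with
  | zero => exact isDet_pure _
  | succ m ih => exact isDet_bind (h 0) fun _ => isDet_bind (ih fun a => h _) fun _ => isDet_pure _

lemma val_tabulate {m : ℕ} (f : Fin m → Prog ℝ n z d ℝ) :
    (tabulate f).val D ε = fun a => (f a).val D ε := by
  induction m with
  | zero => exact Subsingleton.elim _ _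
  | succ m ih =>
    simp only [tabulate, val_bind, val_pure, ih]
    funext a
    refine Fin.cases ?_ (fun a => ?_) a <;> simp

lemma isDet_distance (x y : Vec ℝ d) : (distance x y : Prog ℝ n z d ℝ).IsDet :=
  isDet_bind (isDet_exec (by trivial)) fun _ => isDet_bind
    (isDet_foldlM (fun _ _ => isDet_bind (isDet_exec (by trivial)) fun _ =>
      isDet_bind (isDet_exec (by trivial)) fun _ => isDet_exec (by trivial)) _ _)
    fun _ => isDet_exec (by trivial)

lemma foldl_add_eq_sum {ι : Type*} (f : ι → ℝ) (l : List ι) (a : ℝ) :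
    l.foldl (fun acc x => acc + f x) a = a + (l.map f).sum := by
  induction l generalizing a with
  | nil => simp
  | cons x l ih => simp [ih, add_assoc]

lemma val_distance (x y : Vec ℝ d) : (distance x y).val D ε = vecDist x y := by
  simp only [distance, val_bind, val_exec, val_foldlM, Instr.value]
  rw [foldl_add_eq_sum (fun a => (x a - y a) * (x a - y a)), vecDist, EuclideanSpace.norm_eq]
  congr 1
  rw [Nat.cast_zero, zero_add, ← List.ofFn_eq_map, List.sum_ofFn]
  exact Finset.sum_congr rfl fun a _ => by
    rw [Real.norm_eq_abs, sq_abs]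
    exact (sq _).symm

lemma isDet_farthest (c : Vec ℝ d) (P : PointSet ℝ d) :
    (farthest c P : Prog ℝ n z d _).IsDet :=
  isDet_bind (isDet_distance _ _) fun _ => isDet_foldlM (fun _ _ =>
    isDet_bind (isDet_distance _ _) fun _ => isDet_bind (isDet_exec (by trivial)) fun _ =>
      isDet_pure _) _ _

/-- A farthest point and its distance. -/
lemma val_farthest (c : Vec ℝ d) (P : PointSet ℝ d) :
    ((farthest c P).val D ε).1 ∈ P.1 :: P.2 ∧
      ((farthest c P).val D ε).2 = vecDist c ((farthest c P).val D ε).1 ∧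
      ∀ q ∈ P.1 :: P.2, vecDist c q ≤ ((farthest c P).val D ε).2 := by
  obtain ⟨p, l⟩ := P
  simp only [farthest, val_bind, val_foldlM, val_exec, val_pure, val_distance, Instr.value]
  -- Loop invariant: L holds the points already scanned and b is a farthest one among them.
  have key : ∀ (l : List (Vec ℝ d)) (L : List (Vec ℝ d)) (b : Vec ℝ d × ℝ),
      (b.1 ∈ L ∧ b.2 = vecDist c b.1 ∧ ∀ q ∈ L, vecDist c q ≤ b.2) →
      let r := l.foldl (fun (b : Vec ℝ d × ℝ) x =>
        if @decide (vecDist c x ≤ b.2) (Classical.propDecidable _) = true then b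
        else (x, vecDist c x)) b
      r.1 ∈ L ++ l ∧ r.2 = vecDist c r.1 ∧ ∀ q ∈ L ++ l, vecDist c q ≤ r.2 := by
    intro l
    induction l with
    | nil => intro L b hb; simpa using hb
    | cons x l ih =>
      intro L b hb
      have := ih (L ++ [x]) (if @decide (vecDist c x ≤ b.2) (Classical.propDecidable _) = true
        then b else (x, vecDist c x)) ?_
      · simpa using this
      · obtain ⟨h1, h2, h3⟩ := hb
        by_cases h : vecDist c x ≤ b.2
        · simp only [h, decide_true, if_true]
          refine ⟨List.mem_append_left _ h1, h2, fun q hq => ?_⟩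
          rcases List.mem_append.1 hq with hq | hq
          · exact h3 q hq
          · rwa [List.mem_singleton.1 hq]
        · simp only [h, decide_false, Bool.false_eq_true, if_false]
          refine ⟨by simp, by simp, fun q hq => ?_⟩
          rcases List.mem_append.1 hq with hq | hq
          · exact (h3 q hq).trans (not_le.1 h).le
          · rw [List.mem_singleton.1 hq]
  exact key l [p] (p, vecDist c p) ⟨by simp, rfl, by simp⟩

lemma val_farthest_snd (c : Vec ℝ d) (P : PointSet ℝ d) :
    ((farthest c P).val D ε).2 = setDist c P := by
  classical
  obtain ⟨h1, h2, h3⟩ := val_farthest (D := D) (ε := ε) c P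
  refine (maxDist_eq (PointSet.mem_toFinset.2 h1) h2 fun q hq => ?_).symm
  obtain ⟨q, hq', rfl⟩ := List.mem_map.1 (List.mem_toFinset.1 hq)
  exact h3 q hq'

lemma isDet_totalCost (c : Vec ℝ d) (Ps : List (PointSet ℝ d)) :
    (totalCost c Ps : Prog ℝ n z d ℝ).IsDet :=
  isDet_bind (isDet_exec (by trivial)) fun _ => isDet_foldlM (fun _ _ =>
    isDet_bind (isDet_farthest _ _) fun _ => isDet_exec (by trivial)) _ _

lemma val_totalCost (c : Vec ℝ d) (Ps : List (PointSet ℝ d)) :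
    (totalCost c Ps).val D ε = (Ps.map (setDist c)).sum := by
  simp only [totalCost, val_bind, val_exec, val_foldlM, Instr.value, val_farthest_snd]
  rw [foldl_add_eq_sum, Nat.cast_zero, zero_add]

lemma isDet_subgradientStep (s : ℝ) (c : Vec ℝ d) (P : PointSet ℝ d) :
    (subgradientStep s c P : Prog ℝ n z d _).IsDet :=
  isDet_bind (isDet_farthest _ _) fun _ => isDet_bind (isDet_exec (by trivial)) fun _ =>
    isDet_bind (isDet_exec (by trivial)) fun _ => isDet_ite (isDet_pure _)
      (isDet_bind (isDet_exec (by trivial)) fun _ => isDet_tabulate fun _ =>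
        isDet_bind (isDet_exec (by trivial)) fun _ => isDet_bind (isDet_exec (by trivial)) fun _ =>
          isDet_exec (by trivial))

/-- The decrease of the squared distance to `c'` in a step of the subgradient method. -/
lemma val_subgradientStep (s : ℝ) (c c' : Vec ℝ d) (P : PointSet ℝ d) (hs : 0 ≤ s) :
    vecDist ((subgradientStep s c P).val D ε) c' ^ 2 ≤
      vecDist c c' ^ 2 - 2 * s * (setDist c P - setDist c' P) + s ^ 2 := by
  obtain ⟨h1, h2, h3⟩ := val_farthest (D := D) (ε := ε) c P
  rw [val_farthest_snd] at h2
  set p := ((farthest c P).val D ε).1 with hp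
  have hc' : vecDist c' p ≤ setDist c' P := vecDist_le_setDist h1
  have hc'0 : 0 ≤ setDist c' P := (norm_nonneg _).trans hc'
  simp only [subgradientStep, val_bind, val_exec, val_ite, val_pure, val_tabulate, Instr.value,
    val_farthest_snd, ← hp, decide_eq_true_eq, Nat.cast_zero]
  split_ifs with h0
  -- The center stays only if its maximal distance is 0, and then no decrease is needed.
  · nlinarith [mul_nonneg hs hc'0, sq_nonneg s, mul_nonneg hs (neg_nonneg.2 h0)]
  · set r := setDist c P with hr
    have hr0 : 0 < r := not_le.1 h0
    set x : EuclideanSpace ℝ (Fin d) := WithLp.toLp 2 c with hx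
    set y : EuclideanSpace ℝ (Fin d) := WithLp.toLp 2 c' with hy
    set w : EuclideanSpace ℝ (Fin d) := WithLp.toLp 2 p with hw
    have hrn : r = ‖x - w‖ := h2
    have hyn : ‖y - w‖ ≤ setDist c' P := hc'
    have e : WithLp.toLp 2 (fun a => c a - s / r * (c a - p a)) - y =
        (x - y) - (s / r) • (x - w) := by
      ext a
      simp [hx, hy, hw]
      ring
    change ‖WithLp.toLp 2 (fun a => c a - s / r * (c a - p a)) - y‖ ^ 2 ≤ ‖x - y‖ ^ 2 - _ + _
    rw [e, norm_sub_sq_real, norm_smul, real_inner_smul_right, ← hrn, Real.norm_eq_abs,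
      abs_of_nonneg (by positivity), div_mul_cancel₀ _ hr0.ne']
    -- The subgradient inequality: split x - y at the farthest point w and apply Cauchy–Schwarz to
    -- ⟨y - w, x - w⟩.
    have hin : r * (r - setDist c' P) ≤ inner ℝ (x - y) (x - w) := by
      have e2 : x - y = (x - w) - (y - w) := by abel
      rw [e2, inner_sub_left, real_inner_self_eq_norm_sq, ← hrn]
      have h5 := real_inner_le_norm (y - w) (x - w)
      rw [← hrn] at h5
      nlinarith
    have h6 := mul_le_mul_of_nonneg_left hin (show 0 ≤ s / r by positivity)
    have h7 : s / r * (r * (r - setDist c' P)) = s * (r - setDist c' P) := by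
      field_simp
    nlinarith

variable (D ε) in
/-- The costs and steps of the set median algorithm. -/
noncomputable def medianCost : MedianCost (Vec ℝ d) (PointSet ℝ d) where
  m := setDist
  ds := vecDist
  step s c P := (subgradientStep s c P).val D ε
  m_nonneg _ _ := maxDist_nonneg _ _
  ds_nonneg _ _ := norm_nonneg _
  abs_sub_le c c' P := by
    have h1 := maxDist_le_add (WithLp.toLp 2 c) (WithLp.toLp 2 c') (PointSet.toFinset P)
    have h2 := maxDist_le_add (WithLp.toLp 2 c') (WithLp.toLp 2 c) (PointSet.toFinset P)
    rw [norm_sub_rev] at h2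
    simp only [setDist, vecDist]
    rw [abs_le]
    constructor <;> linarith
  ds_le c c' P := by
    have h1 : vecDist c P.1 ≤ setDist c P := vecDist_le_setDist List.mem_cons_self
    have h2 : vecDist c' P.1 ≤ setDist c' P := vecDist_le_setDist List.mem_cons_self
    have h3 := norm_sub_le_norm_sub_add_norm_sub (WithLp.toLp 2 c : EuclideanSpace ℝ (Fin d))
      (WithLp.toLp 2 P.1) (WithLp.toLp 2 c')
    rw [norm_sub_rev (WithLp.toLp 2 P.1)] at h3
    simp only [vecDist] at *
    linarith
  step_le s c P c' hs := val_subgradientStep s c c' P hs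

lemma isDet_descent (s : ℝ) (c : Vec ℝ d) (Ps : List (PointSet ℝ d)) :
    (descent s c Ps : Prog ℝ n z d _).IsDet :=
  isDet_bind (isDet_foldlM (fun _ _ => isDet_bind (isDet_subgradientStep _ _ _) fun _ =>
    isDet_pure _) _ _) fun _ => isDet_pure _

lemma val_descent (s : ℝ) (c : Vec ℝ d) (Ps : List (PointSet ℝ d)) :
    (descent s c Ps).val D ε = ((medianCost D ε).centers s c Ps).reverse := by
  simp only [descent, val_bind, val_foldlM, val_pure]
  have key : ∀ (Ps : List (PointSet ℝ d)) (c : Vec ℝ d) (L : List (Vec ℝ d)),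
      (Ps.foldl (fun (r : Vec ℝ d × List (Vec ℝ d)) P => ((subgradientStep s r.1 P).val D ε,
        (subgradientStep s r.1 P).val D ε :: r.2)) (c, L)).2 =
      ((medianCost D ε).centers s c Ps).reverse ++ L := by
    intro Ps
    induction Ps with
    | nil => intro c L; rfl
    | cons P Ps ih =>
      intro c L
      rw [List.foldl_cons, ih]
      simp [MedianCost.centers, medianCost]
  rw [key, List.append_nil]

lemma isDet_descents (l : ℕ) (c : Vec ℝ d) (m : ℕ) (s : ℝ) (R : List (PointSet ℝ d)) :
    (descents l c m s R : Prog ℝ n z d _).IsDet := by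
  induction m generalizing s R with
  | zero => exact isDet_pure _
  | succ m ih =>
    exact isDet_bind (isDet_descent _ _ _) fun _ => isDet_bind (isDet_exec (by trivial)) fun _ =>
      isDet_bind (ih _ _) fun _ => isDet_pure _

/-- Membership suffices: the program stores each run in reverse order, but the selection only needs
the set of candidates. -/
lemma mem_val_descents (l : ℕ) (c : Vec ℝ d) (m : ℕ) (s : ℝ) (R : List (PointSet ℝ d))
    (x : Vec ℝ d) :
    x ∈ ((descents l c m s R).val D ε).1 ↔ x ∈ (medianCost D ε).runs l c m s R := by
  induction m generalizing s R with
  | zero => rfl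
  | succ m ih =>
    simp only [descents, val_bind, val_exec, val_pure, Instr.value, val_descent, List.mem_append,
      List.mem_reverse, ih, MedianCost.runs]

lemma length_val_descents (l : ℕ) (c : Vec ℝ d) (m : ℕ) (s : ℝ) (R : List (PointSet ℝ d)) :
    ((descents l c m s R).val D ε).1.length ≤ m * l := by
  induction m generalizing s R with
  | zero => simp [descents]
  | succ m ih =>
    simp only [descents, val_bind, val_exec, val_pure, Instr.value, val_descent,
      List.length_append, List.length_reverse, MedianCost.length_centers, List.length_take]
    have := ih (s + s) (R.drop l)
    rw [Nat.succ_mul]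
    omega

lemma val_descents_snd (l : ℕ) (c : Vec ℝ d) (m : ℕ) (s : ℝ) (R : List (PointSet ℝ d)) :
    ((descents l c m s R).val D ε).2 = R.drop (m * l) := by
  induction m generalizing s R with
  | zero => simp [descents]
  | succ m ih =>
    simp only [descents, val_bind, val_exec, val_pure, Instr.value, ih, List.drop_drop]
    rw [Nat.succ_mul, add_comm]

lemma isDet_selectBest (E : List (PointSet ℝ d)) (c : Vec ℝ d) (cs : List (Vec ℝ d)) :
    (selectBest E c cs : Prog ℝ n z d _).IsDet :=
  isDet_bind (isDet_totalCost _ _) fun _ => isDet_bind (isDet_foldlM (fun _ _ =>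
    isDet_bind (isDet_totalCost _ _) fun _ => isDet_bind (isDet_exec (by trivial)) fun _ =>
      isDet_pure _) _ _) fun _ => isDet_pure _

/-- The selected center is a candidate of minimal cost. -/
lemma val_selectBest (E : List (PointSet ℝ d)) (c : Vec ℝ d) (cs : List (Vec ℝ d)) :
    (selectBest E c cs).val D ε ∈ c :: cs ∧
      ∀ x ∈ c :: cs, (E.map (setDist ((selectBest E c cs).val D ε))).sum ≤
        (E.map (setDist x)).sum := by
  simp only [selectBest, val_bind, val_foldlM, val_exec, val_pure, val_totalCost, Instr.value,
    decide_eq_true_eq]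
  set F : Vec ℝ d → ℝ := fun x => (E.map (setDist x)).sum with hF
  have key : ∀ (l L : List (Vec ℝ d)) (b : Vec ℝ d × ℝ),
      (b.1 ∈ L ∧ b.2 = F b.1 ∧ ∀ q ∈ L, b.2 ≤ F q) →
      let r := l.foldl (fun (b : Vec ℝ d × ℝ) x =>
        if @decide (b.2 ≤ F x) (Classical.propDecidable _) = true then b else (x, F x)) b
      r.1 ∈ L ++ l ∧ r.2 = F r.1 ∧ ∀ q ∈ L ++ l, r.2 ≤ F q := by
    intro l
    induction l with
    | nil => intro L b hb; simpa using hb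
    | cons x l ih =>
      intro L b hb
      have := ih (L ++ [x]) (if @decide (b.2 ≤ F x) (Classical.propDecidable _) = true
        then b else (x, F x)) ?_
      · simpa using this
      · obtain ⟨h1, h2, h3⟩ := hb
        by_cases h : b.2 ≤ F x
        · simp only [h, decide_true, if_true]
          refine ⟨List.mem_append_left _ h1, h2, fun q hq => ?_⟩
          rcases List.mem_append.1 hq with hq | hq
          · exact h3 q hq
          · rwa [List.mem_singleton.1 hq]
        · simp only [h, decide_false, Bool.false_eq_true, if_false]
          refine ⟨by simp, by simp, fun q hq => ?_⟩
          rcases List.mem_append.1 hq with hq | hq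
          · exact (not_le.1 h).le.trans (h3 q hq)
          · rw [List.mem_singleton.1 hq]
  obtain ⟨h1, h2, h3⟩ := key cs [c] (c, F c) ⟨by simp, rfl, by simp⟩
  simp only [decide_eq_true_eq] at h1 h2 h3
  exact ⟨h1, fun x hx => h2.symm.le.trans (h3 x hx)⟩

lemma isDet_setMedian (η : ℝ) (sz : Sizes) (l : List (PointSet ℝ d)) :
    (setMedian η sz l : Prog ℝ n z d _).IsDet := by
  cases l with
  | nil => exact isDet_tabulate fun _ => isDet_exec (by trivial)
  | cons P R =>
    refine isDet_bind (isDet_totalCost _ _) fun _ => ?_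
    repeat refine isDet_bind (isDet_exec (by trivial)) fun _ => ?_
    exact isDet_bind (isDet_descents _ _ _ _ _) fun _ => isDet_selectBest _ _ _

/-- The output of the set median algorithm is a candidate of minimal cost. -/
lemma val_setMedian (η : ℝ) (sz : Sizes) (P : PointSet ℝ d) (l₁ l₂ l₃ : List (PointSet ℝ d))
    (h₁ : l₁.length = sz.est) (h₂ : l₂.length = sz.runs * sz.steps) :
    let out := (setMedian η sz (P :: (l₁ ++ (l₂ ++ l₃)))).val D ε
    let L := P.1 :: (medianCost D ε).runs sz.steps P.1 sz.runs
        (η ^ 3 * (l₁.map (setDist P.1)).sum /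
          (Real.sqrt (sz.steps + 1) + Real.sqrt (sz.steps + 1))) l₂
    out ∈ L ∧ ∀ x ∈ L, (l₃.map (setDist out)).sum ≤ (l₃.map (setDist x)).sum := by
  intro out L
  have hout : out = (selectBest l₃ P.1 ((descents sz.steps P.1 sz.runs
      (η ^ 3 * (l₁.map (setDist P.1)).sum /
          (Real.sqrt (sz.steps + 1) + Real.sqrt (sz.steps + 1))) (l₂ ++ l₃)).val D ε).1).val
        D ε := by
    simp only [out, setMedian, val_bind, val_exec, Instr.value, val_totalCost, val_descents_snd]
    rw [← h₁, List.drop_left, List.take_left, ← h₂, List.drop_left]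
    have e : η * η * η = η ^ 3 := by ring
    simp only [e, Nat.cast_add, Nat.cast_one]
  have hL : ∀ x, x ∈ L ↔ x ∈ P.1 :: ((descents sz.steps P.1 sz.runs
      (η ^ 3 * (l₁.map (setDist P.1)).sum /
          (Real.sqrt (sz.steps + 1) + Real.sqrt (sz.steps + 1))) (l₂ ++ l₃)).val D ε).1 := by
    intro x
    rw [List.mem_cons, List.mem_cons, mem_val_descents, MedianCost.runs_append _ _ _ _ _ _ _ h₂]
  simp only [hL, hout]
  exact val_selectBest _ _ _

end Geometry

end PSEB

namespace PSEB

/-! ### The laws of the samplers -/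

section Samplers

variable {n z d : ℕ} {D : ProbPoints n z d} {ε : ℝ}

/-- The law of weighted reservoir sampling. -/
lemma ev_reservoir {ι : Type} {weight : ι → Prog ℝ n z d ℝ} (hdet : ∀ x, (weight x).IsDet)
    (hw : ∀ x, 0 ≤ (weight x).val D ε) (items : List ι) (φ : Option ι → ℝ) :
    (items.map fun x => (weight x).val D ε).sum * (reservoir weight items).ev D ε φ =
      (items.map fun x => (weight x).val D ε * φ (some x)).sum := by
  simp only [reservoir, ev_bind, ev_exec, ev_pure, Instr.ev, Instr.value, Nat.cast_zero]
  -- The kept item o stands for the total weight W seen so far. Multiplying by the total weight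
  -- avoids a division that fails when all weights vanish.
  have key : ∀ (l : List ι) (W : ℝ) (o : Option ι), 0 ≤ W →
      (W + (l.map fun x => (weight x).val D ε).sum) *
      (l.foldlM (fun (st : ℝ × Option ι) x => do
        let w ← weight x
        let b ← exec (.le w 0)
        if b then pure st
        else do
          let W ← exec (.add st.1 w)
          let q ← exec (.div w W)
          let h ← exec (.coin q)
          pure (W, if h then some x else st.2)) (W, o)).ev D ε (fun r => φ r.2) =
      W * φ o + (l.map fun x => (weight x).val D ε * φ (some x)).sum := by
    intro l
    induction l with
    | nil => intro W o _; simp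
    | cons x l ih =>
      intro W o hW
      simp only [List.foldlM_cons, ev_bind, (hdet x).ev_eq, List.map_cons, List.sum_cons]
      set w := (weight x).val D ε with hwdef
      have hw0 : 0 ≤ w := hw x
      by_cases h : w ≤ 0
      · have h0 : w = 0 := le_antisymm h hw0
        simp only [ev_exec, Instr.ev, Instr.value, h0, le_refl, decide_true, if_true, ev_pure,
          zero_add, zero_mul]
        exact ih W o hW
      · have hw1 : 0 < w := not_le.1 h
        simp only [ev_exec, Instr.ev, Instr.value, h, decide_false, Bool.false_eq_true, if_false,
          ev_bind, ev_pure, if_true]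
        have hq0 : 0 ≤ w / (W + w) := by positivity
        have hq1 : w / (W + w) ≤ 1 := div_le_one_of_le₀ (by linarith) (by positivity)
        rw [min_eq_left hq1, max_eq_left hq0]
        have e1 := ih (W + w) (some x) (by positivity)
        have e2 := ih (W + w) o (by positivity)
        have h3 : w / (W + w) * (W + w) = w := div_mul_cancel₀ _ (by positivity)
        rw [← add_assoc, mul_add, mul_left_comm, e1, mul_left_comm, e2]
        linear_combination (φ (some x) - φ o) * h3
  simpa using key items 0 none le_rfl

lemma ev_reservoir_of_sum_ne_zero {ι : Type} {weight : ι → Prog ℝ n z d ℝ}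
    (hdet : ∀ x, (weight x).IsDet) (hw : ∀ x, 0 ≤ (weight x).val D ε) {items : List ι}
    (hne : (items.map fun x => (weight x).val D ε).sum ≠ 0) (φ : Option ι → ℝ) :
    (reservoir weight items).ev D ε φ = (items.map fun x => (weight x).val D ε * φ (some x)).sum /
      (items.map fun x => (weight x).val D ε).sum := by
  rw [← ev_reservoir hdet hw, mul_div_cancel_left₀ _ hne]

lemma sum_allPairs (f : Fin n × Fin z → ℝ) : ((allPairs n z).map f).sum = ∑ x, f x := by
  have hnd : (allPairs n z).Nodup := (List.nodup_finRange n).product (List.nodup_finRange z)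
  rw [← List.sum_toFinset _ hnd]
  refine Finset.sum_congr ?_ fun _ _ => rfl
  ext x
  have hx : x ∈ allPairs n z := List.mem_product.2 ⟨List.mem_finRange x.1, List.mem_finRange x.2⟩
  simpa using hx

/-- The probability of a location if it is not `⊥`, and `0` if it is. -/
noncomputable def ProbPoints.presentProb (D : ProbPoints n z d) (x : Fin n × Fin z) : ℝ :=
  if (D.loc x.1 x.2).isNone then 0 else D.prob x.1 x.2

lemma ProbPoints.presentProb_nonneg (D : ProbPoints n z d) (x : Fin n × Fin z) :
    0 ≤ D.presentProb x := by
  unfold ProbPoints.presentProb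
  split_ifs
  · exact le_rfl
  · exact D.prob_nonneg _ _

/-- The coordinates of a location. -/
noncomputable def ProbPoints.coords (D : ProbPoints n z d) (i : Fin n) (j : Fin z) : Vec ℝ d :=
  fun a => (D.loc i j).elim 0 fun q => q a

lemma isDet_presentProb (x : Fin n × Fin z) : (presentProb x : Prog ℝ n z d ℝ).IsDet :=
  isDet_bind (isDet_exec (by trivial)) fun _ =>
    isDet_ite (isDet_exec (by trivial)) (isDet_exec (by trivial))

lemma val_presentProb (x : Fin n × Fin z) :
    (presentProb x).val D ε = D.presentProb x := by
  simp [presentProb, ProbPoints.presentProb, Instr.value]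

lemma isDet_presentMass : (presentMass : Prog ℝ n z d ℝ).IsDet :=
  isDet_bind (isDet_exec (by trivial)) fun _ => isDet_foldlM (fun _ _ =>
    isDet_bind (isDet_presentProb _) fun _ => isDet_exec (by trivial)) _ _

lemma val_presentMass : presentMass.val D ε = ∑ x, D.presentProb x := by
  simp only [presentMass, val_bind, val_exec, val_foldlM, Instr.value, val_presentProb]
  rw [foldl_add_eq_sum, sum_allPairs, Nat.cast_zero, zero_add]

lemma isDet_readPoint (i : Fin n) (j : Fin z) : (readPoint i j : Prog ℝ n z d _).IsDet :=
  isDet_tabulate fun _ => isDet_exec (by trivial)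

lemma val_readPoint (i : Fin n) (j : Fin z) : (readPoint i j).val D ε = D.coords i j := by
  simp only [readPoint, val_tabulate, val_exec, Instr.value]
  rfl

/-- The law of a sampled location. -/
lemma ev_sampleLocation (hne : ∑ x, D.presentProb x ≠ 0) (φ : Option (PointSet ℝ d) → ℝ) :
    (sampleLocation : Prog ℝ n z d _).ev D ε φ =
      avg (fun x => D.presentProb x / ∑ y, D.presentProb y)
        (fun x : Fin n × Fin z => ((D.coords x.1 x.2, []) : PointSet ℝ d))
        (fun P => φ (some P)) := by
  have e : ((allPairs n z).map fun x => (presentProb x).val D ε).sum = ∑ x, D.presentProb x := by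
    simp only [val_presentProb, sum_allPairs]
  rw [sampleLocation, ev_bind, ev_reservoir_of_sum_ne_zero isDet_presentProb
    (fun x => by rw [val_presentProb]; exact D.presentProb_nonneg x) (by rwa [e]), e, sum_allPairs,
    avg, Finset.sum_div]
  refine Finset.sum_congr rfl fun x _ => ?_
  simp only [ev_bind, (isDet_readPoint _ _).ev_eq, val_readPoint, ev_pure, val_presentProb]
  ring

/-- Independent choices made one after the other. -/
lemma ev_foldlM_finRange {β : Type} {m : ℕ} {f : β → Fin m → Prog ℝ n z d β}
    {p : Fin m → Fin z → ℝ} {g : β → Fin m → Fin z → β}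
    (h : ∀ b i φ, (f b i).ev D ε φ = ∑ j, p i j * φ (g b i j)) (b : β) (φ : β → ℝ) :
    ((List.finRange m).foldlM f b).ev D ε φ = ∑ j : Fin m → Fin z,
      (∏ i, p i (j i)) * φ ((List.finRange m).foldl (fun b i => g b i (j i)) b) := by
  induction m generalizing b with
  | zero => simp
  | succ m ih =>
    -- An index choice is its first entry together with the remaining ones, so the product law
    -- factors step by step.
    rw [List.finRange_succ, List.foldlM_cons, ev_bind, h,
      ← (Fin.consEquiv fun _ : Fin (m + 1) => Fin z).sum_comp, Fintype.sum_prod_type]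
    refine Finset.sum_congr rfl fun a _ => ?_
    rw [List.foldlM_map, ih (f := fun b i => f b i.succ) (p := fun i => p i.succ)
      (g := fun b i => g b i.succ) (fun b i => h b i.succ), Finset.mul_sum]
    refine Finset.sum_congr rfl fun j _ => ?_
    simp [Fin.consEquiv, Fin.prod_univ_succ, List.foldl_map, mul_assoc]

/-- The points that are present when the `i`-th distribution takes its `j i`-th location, in the
order in which they are stored. -/
noncomputable def ProbPoints.pts (D : ProbPoints n z d) (j : Fin n → Fin z) : List (Vec ℝ d) :=
  (List.finRange n).foldl
    (fun acc i => if (D.loc i (j i)).isNone then acc else D.coords i (j i) :: acc) []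

/-- A list of points as a stored set. -/
def toPointSet : List (Vec ℝ d) → Option (PointSet ℝ d)
  | [] => none
  | p :: ps => some (p, ps)

/-- The law of a sampled realization. -/
lemma ev_sampleRealization (φ : Option (PointSet ℝ d) → ℝ) :
    (sampleRealization : Prog ℝ n z d _).ev D ε φ =
      ∑ j : Fin n → Fin z, (∏ i, D.prob i (j i)) * φ (toPointSet (D.pts j)) := by
  rw [sampleRealization, ev_bind, ev_foldlM_finRange (p := D.prob)
    (g := fun acc i j => if (D.loc i j).isNone then acc else D.coords i j :: acc)]
  · refine Finset.sum_congr rfl fun j _ => ?_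
    rw [← ProbPoints.pts]
    rcases D.pts j with _ | ⟨p, ps⟩ <;> rfl
  · intro acc i φ
    have e : ((List.finRange z).map fun j => (exec (.readProb i j) : Prog ℝ n z d ℝ).val D ε).sum
        = 1 := by
      simp only [val_exec, Instr.value]
      rw [← List.ofFn_eq_map, List.sum_ofFn, D.sum_prob]
    rw [ev_bind, ev_reservoir_of_sum_ne_zero (D := D) (ε := ε)
      (weight := fun j => exec (.readProb i j)) (fun _ => isDet_exec (by trivial)) (fun j => D.prob_nonneg i j) (by rw [e]; norm_num), e, div_one, ← List.ofFn_eq_map,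
      List.sum_ofFn]
    refine Finset.sum_congr rfl fun j _ => ?_
    simp only [val_exec, Instr.value]
    congr 1
    rw [ev_bind, ev_exec, Instr.ev_of_isDet (by trivial), Instr.value]
    cases h : (D.loc i j).isNone
    · simp only [Bool.false_eq_true, if_false, ev_bind, (isDet_readPoint _ _).ev_eq,
        val_readPoint, ev_pure]
    · simp only [if_true, ev_pure]

lemma mem_pts {j : Fin n → Fin z} {p : Vec ℝ d} :
    p ∈ D.pts j ↔ ∃ i, D.loc i (j i) = some (WithLp.toLp 2 p) := by
  have key : ∀ (l : List (Fin n)) (acc : List (Vec ℝ d)),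
      p ∈ l.foldl (fun acc i => if (D.loc i (j i)).isNone then acc
        else D.coords i (j i) :: acc) acc ↔
      p ∈ acc ∨ ∃ i ∈ l, D.loc i (j i) = some (WithLp.toLp 2 p) := by
    intro l
    induction l with
    | nil => simp
    | cons i l ih =>
      intro acc
      rw [List.foldl_cons, ih]
      rcases h : D.loc i (j i) with _ | q
      · simp [h]
      · have e : D.coords i (j i) = q.ofLp := by
          funext a
          simp [ProbPoints.coords, h]
        have e2 : p = q.ofLp ↔ q = WithLp.toLp 2 p :=
          ⟨fun h => by rw [h], fun h => by rw [h]⟩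
        simp [h, e, e2, or_assoc, or_comm]
  rw [ProbPoints.pts, key]
  simp

lemma mem_realization {j : Fin n → Fin z} {p : EuclideanSpace ℝ (Fin d)} :
    p ∈ D.realization j ↔ ∃ i, D.loc i (j i) = some p := by
  simp [ProbPoints.realization]

lemma realization_eq_empty {j : Fin n → Fin z} (h : toPointSet (D.pts j) = none) :
    D.realization j = ∅ := by
  have h' : D.pts j = [] := by
    rcases hp : D.pts j with _ | ⟨p, ps⟩
    · rfl
    · rw [hp] at h; cases h
  refine Finset.eq_empty_of_forall_notMem fun p hp => ?_
  have : p.ofLp ∈ D.pts j := mem_pts.2 (mem_realization.1 hp)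
  rw [h'] at this
  cases this

lemma realization_eq_toFinset {j : Fin n → Fin z} {P : PointSet ℝ d}
    (h : toPointSet (D.pts j) = some P) : D.realization j = PointSet.toFinset P := by
  have h' : D.pts j = P.1 :: P.2 := by
    rcases hp : D.pts j with _ | ⟨p, ps⟩
    · rw [hp] at h; cases h
    · rw [hp] at h; cases h; rfl
  ext p
  have : p ∈ PointSet.toFinset P ↔ p.ofLp ∈ P.1 :: P.2 := PointSet.mem_toFinset (p := p.ofLp)
  rw [this, ← h', mem_realization, mem_pts]

/-- The probability that `k` out of at most `t` independent trials succeed, where each succeeds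
with probability `p`. -/
noncomputable def hitProb (p : ℝ) : ℕ → ℕ → ℝ
  | _, 0 => 1
  | 0, _ + 1 => 0
  | t + 1, k + 1 => (1 - p) * hitProb p t (k + 1) + p * hitProb p t k

lemma hitProb_one (k : ℕ) : hitProb 1 k k = 1 := by
  induction k with
  | zero => rfl
  | succ k ih => simp [hitProb, ih]

/-- Markov's inequality for 2^(-S), where S counts the successes: its expectation is (1 - p/2)^t,
and S < k makes it at least 2^(-k). The right-hand side satisfies the recursion of `hitProb`
exactly, which gives the induction. -/
lemma one_sub_hitProb_le {p : ℝ} (h0 : 0 ≤ p) (h1 : p ≤ 1) (t k : ℕ) :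
    1 - hitProb p t k ≤ 2 ^ k * (1 - p / 2) ^ t := by
  have hp : 0 ≤ 1 - p / 2 := by linarith
  induction t generalizing k with
  | zero =>
    rcases k with _ | k
    · simp [hitProb]
    · simpa [hitProb] using one_le_pow₀ (by norm_num : (1 : ℝ) ≤ 2)
  | succ t ih =>
    rcases k with _ | k
    · simp only [hitProb]; rw [sub_self]; positivity
    · have e1 := mul_le_mul_of_nonneg_left (ih (k + 1)) (sub_nonneg.2 h1)
      have e2 := mul_le_mul_of_nonneg_left (ih k) h0
      simp only [hitProb]
      calc _ = (1 - p) * (1 - hitProb p t (k + 1)) + p * (1 - hitProb p t k) := by ring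
        _ ≤ _ := add_le_add e1 e2
        _ = _ := by ring

/-- With enough trials, enough samples are found. -/
lemma le_hitProb {p η : ℝ} (h0 : η / 2 ≤ p) (h1 : p ≤ 1) (hη : 0 < η) {t k : ℕ} (hk : 3 ≤ k)
    (ht : 8 * k / η ≤ t) : 7 / 8 ≤ hitProb p t k := by
  have hp0 : 0 < p := by linarith
  have h2 := one_sub_hitProb_le hp0.le h1 t k
  have h3 : (1 - p / 2) ^ t ≤ Real.exp (-(p / 2) * t) := by
    rw [mul_comm, Real.exp_nat_mul]
    refine pow_le_pow_left₀ (by linarith) ?_ t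
    have := Real.add_one_le_exp (-(p / 2))
    linarith
  have h4 : (2 : ℝ) ^ k ≤ Real.exp k := by
    rw [← mul_one (k : ℝ), Real.exp_nat_mul]
    refine pow_le_pow_left₀ (by norm_num) ?_ k
    have := Real.add_one_le_exp (1 : ℝ)
    linarith
  -- The failure probability becomes at most exp(k - 2k) = exp(-k) ≤ exp(-3) ≤ 1/8.
  have h5 : 2 * (k : ℝ) ≤ p / 2 * t := by
    have h6 : 8 * (k : ℝ) ≤ t * η := (div_le_iff₀ hη).1 ht
    have h7 : (t : ℝ) * (η / 2) ≤ t * p := mul_le_mul_of_nonneg_left h0 (by positivity)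
    linarith
  have h6 : (2 : ℝ) ^ k * (1 - p / 2) ^ t ≤ Real.exp (-3) := by
    calc (2 : ℝ) ^ k * (1 - p / 2) ^ t ≤ Real.exp k * Real.exp (-(p / 2) * t) :=
          mul_le_mul h4 h3 (pow_nonneg (by linarith) _) (Real.exp_pos _).le
      _ = Real.exp (k + -(p / 2) * t) := (Real.exp_add _ _).symm
      _ ≤ _ := by
        apply Real.exp_le_exp.2
        have : (3 : ℝ) ≤ k := by exact_mod_cast hk
        linarith
  have h7 : Real.exp (-3) ≤ 1 / 8 := by
    rw [Real.exp_neg, one_div]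
    refine inv_anti₀ (by norm_num) ?_
    have := Real.exp_one_gt_d9
    calc (8 : ℝ) ≤ Real.exp 1 ^ 3 := by
          have : (2 : ℝ) ^ 3 ≤ Real.exp 1 ^ 3 := pow_le_pow_left₀ (by norm_num) (by linarith) 3
          linarith
      _ = Real.exp 3 := by rw [← Real.exp_nat_mul]; norm_num
  linarith

/-- The sampled sets are independent, if enough of them are found. -/
lemma le_ev_collect {Ω : Type*} [Fintype Ω] {v : Ω → ℝ} (hv : ∀ ω, 0 ≤ v ω)
    {T : Ω → PointSet ℝ d} {p : ℝ} (h0 : 0 ≤ p) (h1 : p ≤ 1)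
    {sampler : Prog ℝ n z d (Option (PointSet ℝ d))}
    (hS : ∀ φ, sampler.ev D ε φ = (1 - p) * φ none + p * avg v T fun x => φ (some x))
    (t k : ℕ) {φ : List (PointSet ℝ d) → ℝ} (hφ : ∀ l, 0 ≤ φ l) :
    hitProb p t k * listAvg v T k φ ≤ (collect sampler t k).ev D ε φ := by
  induction t generalizing k φ with
  | zero =>
    rcases k with _ | k
    · simp [hitProb, listAvg, collect]
    · simpa [hitProb, collect] using hφ []
  | succ t ih =>
    rcases k with _ | k
    · simp [hitProb, listAvg, collect]
    · rw [collect, ev_bind, hS]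
      simp only [ev_bind, ev_pure, hitProb]
      have e1 := mul_le_mul_of_nonneg_left (ih (k + 1) hφ) (sub_nonneg.2 h1)
      have e2 : p * (hitProb p t k * listAvg v T (k + 1) φ) ≤
          p * avg v T fun x => (collect sampler t k).ev D ε fun l => φ (x :: l) := by
        refine mul_le_mul_of_nonneg_left ?_ h0
        rw [listAvg, ← avg_mul]
        exact avg_mono hv fun x => ih k fun l => hφ _
      calc _ = (1 - p) * (hitProb p t (k + 1) * listAvg v T (k + 1) φ) +
            p * (hitProb p t k * listAvg v T (k + 1) φ) := by ring
        _ ≤ _ := add_le_add e1 e2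

end Samplers

end PSEB

namespace PSEB

/-! ### The expected cost and the laws of the samplers -/

section ExpectedCost

variable {n z d : ℕ} {D : ProbPoints n z d} {ε : ℝ}

lemma continuous_maxDist (P : Finset (EuclideanSpace ℝ (Fin d))) :
    Continuous fun c => maxDist c P :=
  (LipschitzWith.of_le_add fun c c' => by
    rw [dist_eq_norm]; exact maxDist_le_add c c' P).continuous

/-- A weighted sum of distances to finite sets has a minimizer. -/
lemma exists_minimizer {Ω : Type*} [Fintype Ω] {w : Ω → ℝ} (hw : ∀ ω, 0 ≤ w ω)
    (A : Ω → Finset (EuclideanSpace ℝ (Fin d))) :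
    ∃ c', ∀ c, ∑ ω, w ω * maxDist c' (A ω) ≤ ∑ ω, w ω * maxDist c (A ω) := by
  -- One nonempty set of positive weight makes the continuous sum tend to infinity; otherwise it is
  -- identically 0.
  by_cases h : ∃ ω, 0 < w ω ∧ (A ω).Nonempty
  · obtain ⟨ω, hω, p, hp⟩ := h
    refine Continuous.exists_forall_le
      (continuous_finsetSum _ fun ω _ => continuous_const.mul (continuous_maxDist (A ω))) ?_
    have hlim : Filter.Tendsto (fun c : EuclideanSpace ℝ (Fin d) => w ω * (‖c‖ + -‖p‖))
        (Filter.cocompact _) Filter.atTop :=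
      (Filter.tendsto_atTop_add_const_right _ _
        (tendsto_norm_cocompact_atTop (E := EuclideanSpace ℝ (Fin d)))).const_mul_atTop hω
    refine Filter.tendsto_atTop_mono (fun c => ?_) hlim
    refine le_trans ?_ (Finset.single_le_sum
      (fun ω _ => mul_nonneg (hw ω) (maxDist_nonneg c (A ω))) (Finset.mem_univ ω))
    refine mul_le_mul_of_nonneg_left ?_ hω.le
    have h1 := norm_le_maxDist (c := c) hp
    have h2 := norm_sub_norm_le c p
    linarith
  · push Not at h
    have h0 : ∀ c, ∑ ω, w ω * maxDist c (A ω) = 0 := fun c => by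
      refine Finset.sum_eq_zero fun ω _ => ?_
      rcases (hw ω).lt_or_eq with h1 | h1
      · rw [h ω h1]
        simp [maxDist]
      · rw [← h1, zero_mul]
    exact ⟨0, fun c => by rw [h0, h0]⟩

/-! ### The product law and the presence of points. -/

lemma ProbPoints.prod_prob_nonneg (D : ProbPoints n z d) (j : Fin n → Fin z) :
    0 ≤ ∏ i, D.prob i (j i) :=
  Finset.prod_nonneg fun i _ => D.prob_nonneg i (j i)

lemma sum_prod_eq_prod_sum (u : Fin n → Fin z → ℝ) :
    ∑ j : Fin n → Fin z, ∏ i, u i (j i) = ∏ i, ∑ a, u i a := by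
  rw [Finset.prod_univ_sum, Fintype.piFinset_univ]

lemma ProbPoints.sum_prod_prob (D : ProbPoints n z d) :
    ∑ j : Fin n → Fin z, ∏ i, D.prob i (j i) = 1 := by
  rw [sum_prod_eq_prod_sum]
  exact Finset.prod_eq_one fun i _ => D.sum_prob i

/-- The expectation of a product of independent factors. -/
lemma ProbPoints.sum_prod_mul (D : ProbPoints n z d) (i : Fin n) (h : Fin z → ℝ)
    (r : Fin n → Fin z → ℝ) :
    ∑ j : Fin n → Fin z, (∏ k, D.prob k (j k)) * (h (j i) *
      ∏ k ∈ Finset.univ.erase i, r k (j k)) =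
      (∑ a, D.prob i a * h a) * ∏ k ∈ Finset.univ.erase i, ∑ a, D.prob k a * r k a := by
  have e := sum_prod_eq_prod_sum fun k a => D.prob k a * if k = i then h a else r k a
  have hi := Finset.mem_univ i
  have hne : ∀ k ∈ Finset.univ.erase i, k ≠ i := fun k hk => (Finset.mem_erase.1 hk).1
  convert e using 1
  · refine Finset.sum_congr rfl fun j _ => ?_
    rw [Finset.prod_mul_distrib, ← Finset.mul_prod_erase _ (fun k => ite _ _ _) hi, if_pos rfl]
    congr 2
    exact Finset.prod_congr rfl fun k hk => (if_neg (hne k hk)).symm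
  · rw [← Finset.mul_prod_erase _ (fun k => ∑ a, _) hi]
    simp only [if_true]
    congr 1
    exact Finset.prod_congr rfl fun k hk => by simp only [if_neg (hne k hk)]

/-- The probability that the `i`-th point is present. -/
noncomputable def ProbPoints.presence (D : ProbPoints n z d) (i : Fin n) : ℝ :=
  ∑ a, D.presentProb (i, a)

lemma ProbPoints.presence_nonneg (D : ProbPoints n z d) (i : Fin n) : 0 ≤ D.presence i :=
  Finset.sum_nonneg fun _ _ => D.presentProb_nonneg _

lemma ProbPoints.sum_presence (D : ProbPoints n z d) :
    ∑ i, D.presence i = ∑ x, D.presentProb x :=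
  (Fintype.sum_prod_type _).symm

/-- The indicator of an absent point. -/
noncomputable def ProbPoints.absent (D : ProbPoints n z d) (i : Fin n) (a : Fin z) : ℝ :=
  if (D.loc i a).isNone then 1 else 0

lemma ProbPoints.sum_prob_absent (D : ProbPoints n z d) (i : Fin n) :
    ∑ a, D.prob i a * D.absent i a = 1 - D.presence i := by
  rw [← D.sum_prob i, ProbPoints.presence, ← Finset.sum_sub_distrib]
  refine Finset.sum_congr rfl fun a _ => ?_
  unfold ProbPoints.absent ProbPoints.presentProb
  split_ifs <;> ring

lemma ProbPoints.absent_nonneg (D : ProbPoints n z d) (i : Fin n) (a : Fin z) :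
    0 ≤ D.absent i a := by
  unfold ProbPoints.absent; split_ifs <;> norm_num

lemma ProbPoints.absent_le_one (D : ProbPoints n z d) (i : Fin n) (a : Fin z) :
    D.absent i a ≤ 1 := by
  unfold ProbPoints.absent; split_ifs <;> norm_num

lemma ProbPoints.presence_le_one (D : ProbPoints n z d) (i : Fin n) : D.presence i ≤ 1 := by
  have : 0 ≤ ∑ a, D.prob i a * D.absent i a :=
    Finset.sum_nonneg fun a _ => mul_nonneg (D.prob_nonneg _ _) (D.absent_nonneg _ _)
  rw [D.sum_prob_absent] at this
  linarith

/-- The distance of a location, and `0` for an absent point. -/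
noncomputable def ProbPoints.locDist (D : ProbPoints n z d) (c : EuclideanSpace ℝ (Fin d))
    (i : Fin n) (a : Fin z) : ℝ := (D.loc i a).elim 0 fun q => ‖c - q‖

lemma ProbPoints.locDist_nonneg (D : ProbPoints n z d) (c : EuclideanSpace ℝ (Fin d))
    (i : Fin n) (a : Fin z) : 0 ≤ D.locDist c i a := by
  unfold ProbPoints.locDist
  rcases D.loc i a with _ | q
  · exact le_rfl
  · exact norm_nonneg _

/-- The expected sum of the distances of the present points. -/
noncomputable def ProbPoints.sumCost (D : ProbPoints n z d) (c : EuclideanSpace ℝ (Fin d)) : ℝ :=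
  ∑ i, ∑ a, D.prob i a * D.locDist c i a

lemma ProbPoints.expCost_le_sumCost (D : ProbPoints n z d) (c : EuclideanSpace ℝ (Fin d)) :
    D.expCost c ≤ D.sumCost c := by
  calc D.expCost c ≤ ∑ j : Fin n → Fin z, (∏ k, D.prob k (j k)) * ∑ i, D.locDist c i (j i) := by
        refine Finset.sum_le_sum fun j _ =>
          mul_le_mul_of_nonneg_left ?_ (D.prod_prob_nonneg j)
        refine maxDist_le (Finset.sum_nonneg fun i _ => D.locDist_nonneg c i _) fun q hq => ?_
        obtain ⟨i, hi⟩ := mem_realization.1 hq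
        refine le_trans (le_of_eq ?_) (Finset.single_le_sum
          (fun i _ => D.locDist_nonneg c i (j i)) (Finset.mem_univ i))
        simp [ProbPoints.locDist, hi]
    _ = D.sumCost c := by
        simp only [Finset.mul_sum]
        rw [Finset.sum_comm, ProbPoints.sumCost]
        refine Finset.sum_congr rfl fun i _ => ?_
        have := D.sum_prod_mul i (D.locDist c i) fun _ _ => 1
        simpa [D.sum_prob] using this

lemma one_sub_sum_le_prod_one_sub {ι : Type*} (s : Finset ι) (x : ι → ℝ) (h0 : ∀ i, 0 ≤ x i)
    (h1 : ∀ i, x i ≤ 1) : 1 - ∑ i ∈ s, x i ≤ ∏ i ∈ s, (1 - x i) := by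
  classical
  induction s using Finset.induction_on with
  | empty => simp
  | insert i s hi ih =>
    rw [Finset.sum_insert hi, Finset.prod_insert hi]
    have h2 := mul_le_mul_of_nonneg_left ih (sub_nonneg.2 (h1 i))
    have h3 : 0 ≤ x i * ∑ i ∈ s, x i := mul_nonneg (h0 i) (Finset.sum_nonneg fun i _ => h0 i)
    linarith

/-- Only realizations with a single present index are counted: given the choice at i, all other
points are absent with probability at least 1 - μ by independence and Bernoulli's inequality. -/
lemma ProbPoints.sumCost_le_expCost (D : ProbPoints n z d) (c : EuclideanSpace ℝ (Fin d)) :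
    (1 - ∑ x, D.presentProb x) * D.sumCost c ≤ D.expCost c := by
  calc (1 - ∑ x, D.presentProb x) * D.sumCost c
      ≤ ∑ i, (∑ a, D.prob i a * D.locDist c i a) *
          ∏ k ∈ Finset.univ.erase i, ∑ a, D.prob k a * D.absent k a := by
        rw [ProbPoints.sumCost, Finset.mul_sum]
        refine Finset.sum_le_sum fun i _ => ?_
        rw [mul_comm]
        refine mul_le_mul_of_nonneg_left ?_ (Finset.sum_nonneg fun a _ =>
          mul_nonneg (D.prob_nonneg _ _) (D.locDist_nonneg _ _ _))
        simp only [D.sum_prob_absent]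
        refine le_trans ?_ (one_sub_sum_le_prod_one_sub _ _ D.presence_nonneg D.presence_le_one)
        rw [← D.sum_presence]
        refine sub_le_sub_left (Finset.sum_le_sum_of_subset_of_nonneg (Finset.erase_subset _ _)
          fun i _ _ => D.presence_nonneg i) _
    _ = ∑ j : Fin n → Fin z, (∏ k, D.prob k (j k)) * ∑ i, D.locDist c i (j i) *
          ∏ k ∈ Finset.univ.erase i, D.absent k (j k) := by
        simp only [Finset.mul_sum]
        rw [Finset.sum_comm]
        exact Finset.sum_congr rfl fun i _ => (D.sum_prod_mul i _ _).symm
    _ ≤ D.expCost c := by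
        refine Finset.sum_le_sum fun j _ =>
          mul_le_mul_of_nonneg_left ?_ (D.prod_prob_nonneg j)
        -- If i is present, every summand with index k ≠ i contains the factor `absent i`, which is
        -- 0, so at most one summand survives.
        by_cases h : ∃ i q, D.loc i (j i) = some q
        · obtain ⟨i, q, hq⟩ := h
          rw [Finset.sum_eq_single i]
          · have h1 : ∏ k ∈ Finset.univ.erase i, D.absent k (j k) ≤ 1 :=
              Finset.prod_le_one (fun k _ => D.absent_nonneg _ _) fun k _ => D.absent_le_one _ _
            have h2 : D.locDist c i (j i) = ‖c - q‖ := by simp [ProbPoints.locDist, hq]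
            rw [h2]
            exact (mul_le_of_le_one_right (norm_nonneg _) h1).trans
              (norm_le_maxDist (mem_realization.2 ⟨i, hq⟩))
          · intro k _ hk
            rw [Finset.prod_eq_zero (Finset.mem_erase.2 ⟨hk.symm, Finset.mem_univ i⟩), mul_zero]
            simp [ProbPoints.absent, hq]
          · exact fun h => (h (Finset.mem_univ i)).elim
        · push Not at h
          refine le_trans (le_of_eq ?_) (maxDist_nonneg _ _)
          refine Finset.sum_eq_zero fun i _ => ?_
          have : D.loc i (j i) = none := Option.eq_none_iff_forall_ne_some.2 (h i)
          simp [ProbPoints.locDist, this]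

lemma toLp_coords {i : Fin n} {a : Fin z} {q : EuclideanSpace ℝ (Fin d)}
    (h : D.loc i a = some q) : WithLp.toLp 2 (D.coords i a) = q := by
  ext b
  simp [ProbPoints.coords, h]

lemma setDist_singleton (c p : Vec ℝ d) : setDist c (p, []) = vecDist c p := by
  classical
  exact maxDist_eq (PointSet.mem_toFinset.2 List.mem_cons_self) rfl fun q hq => by
    obtain ⟨q, hq', rfl⟩ := List.mem_map.1 (List.mem_toFinset.1 hq)
    rw [List.mem_singleton.1 hq']
    exact le_rfl

/-- The cost of a center for the law of a sampled location. -/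
lemma ProbPoints.sumCost_eq (hne : ∑ x, D.presentProb x ≠ 0) (c : Vec ℝ d) :
    D.sumCost (WithLp.toLp 2 c) = (∑ x, D.presentProb x) *
      (medianCost D ε).cost (fun x => D.presentProb x / ∑ y, D.presentProb y)
        (fun x : Fin n × Fin z => ((D.coords x.1 x.2, []) : PointSet ℝ d)) c := by
  rw [MedianCost.cost, avg, Finset.mul_sum, Fintype.sum_prod_type, ProbPoints.sumCost]
  refine Finset.sum_congr rfl fun i _ => Finset.sum_congr rfl fun a _ => ?_
  rw [← mul_assoc, mul_div_cancel₀ _ hne]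
  rw [show (medianCost D ε).m c = setDist c from rfl, setDist_singleton]
  rcases h : D.loc i a with _ | q
  · simp [ProbPoints.locDist, ProbPoints.presentProb, h]
  · simp [ProbPoints.locDist, ProbPoints.presentProb, h, vecDist, toLp_coords h]

/-- The probability that some point is present. -/
noncomputable def ProbPoints.nonemptyProb (D : ProbPoints n z d) : ℝ :=
  ∑ j : Fin n → Fin z, if (toPointSet (D.pts j)).isSome then ∏ i, D.prob i (j i) else 0

/-- A realization is empty exactly if all points are absent, and these events are independent. -/
lemma ProbPoints.one_sub_nonemptyProb (D : ProbPoints n z d) :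
    1 - D.nonemptyProb = ∏ i, (1 - D.presence i) := by
  simp only [← D.sum_prob_absent]
  rw [← sum_prod_eq_prod_sum fun i a => D.prob i a * D.absent i a, ← D.sum_prod_prob,
    ProbPoints.nonemptyProb, ← Finset.sum_sub_distrib]
  refine Finset.sum_congr rfl fun j _ => ?_
  rw [Finset.prod_mul_distrib]
  rcases h : toPointSet (D.pts j) with _ | P
  · have h1 : ∏ i, D.absent i (j i) = 1 := Finset.prod_eq_one fun i _ => by
      rcases h2 : D.loc i (j i) with _ | q
      · simp [ProbPoints.absent, h2]
      · have : q ∈ D.realization j := mem_realization.2 ⟨i, h2⟩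
        rw [realization_eq_empty h] at this
        simp at this
    simp [h1]
  · have h1 : WithLp.toLp 2 P.1 ∈ D.realization j := by
      rw [realization_eq_toFinset h]
      exact PointSet.mem_toFinset.2 List.mem_cons_self
    obtain ⟨i, hi⟩ := mem_realization.1 h1
    have h2 : ∏ i, D.absent i (j i) = 0 :=
      Finset.prod_eq_zero (Finset.mem_univ i) (by simp [ProbPoints.absent, hi])
    simp [h2]

/-- The empty realization has probability at most exp(-μ) ≤ exp(-η) ≤ 1/(1 + η) ≤ 1 - η/2. -/
lemma ProbPoints.le_nonemptyProb (D : ProbPoints n z d) {η : ℝ} (hη : 0 < η) (hη1 : η ≤ 1)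
    (h : η ≤ ∑ x, D.presentProb x) : η / 2 ≤ D.nonemptyProb := by
  have h1 : ∏ i, (1 - D.presence i) ≤ Real.exp (-η) := by
    calc ∏ i, (1 - D.presence i) ≤ ∏ i, Real.exp (-D.presence i) :=
          Finset.prod_le_prod (fun i _ => sub_nonneg.2 (D.presence_le_one i)) fun i _ => by
            have := Real.add_one_le_exp (-D.presence i)
            linarith
      _ = Real.exp (-∑ i, D.presence i) := by rw [← Real.exp_sum, Finset.sum_neg_distrib]
      _ ≤ _ := Real.exp_le_exp.2 (by rw [D.sum_presence]; linarith)
  have h2 : Real.exp (-η) ≤ 1 - η / 2 := by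
    rw [Real.exp_neg]
    have h3 := Real.add_one_le_exp η
    refine (inv_anti₀ (by positivity) h3).trans ?_
    rw [inv_le_iff_one_le_mul₀ (by positivity)]
    nlinarith
  have := D.one_sub_nonemptyProb
  linarith

lemma ProbPoints.nonemptyProb_le_one (D : ProbPoints n z d) : D.nonemptyProb ≤ 1 := by
  have : 0 ≤ ∏ i, (1 - D.presence i) :=
    Finset.prod_nonneg fun i _ => sub_nonneg.2 (D.presence_le_one i)
  rw [← D.one_sub_nonemptyProb] at this
  linarith

/-- The law of a realization under the condition that it is not empty. -/
noncomputable def ProbPoints.condProb (D : ProbPoints n z d) (j : Fin n → Fin z) : ℝ :=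
  (if (toPointSet (D.pts j)).isSome then ∏ i, D.prob i (j i) else 0) / D.nonemptyProb

/-- The stored set of a realization. -/
noncomputable def ProbPoints.stored (D : ProbPoints n z d) (j : Fin n → Fin z) : PointSet ℝ d :=
  -- The default value is harmless: `condProb` vanishes on empty realizations.
  (toPointSet (D.pts j)).getD (0, [])

lemma ProbPoints.condProb_nonneg (D : ProbPoints n z d) (h : 0 ≤ D.nonemptyProb)
    (j : Fin n → Fin z) : 0 ≤ D.condProb j := by
  refine div_nonneg ?_ h
  split_ifs
  · exact D.prod_prob_nonneg j
  · exact le_rfl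

lemma ev_sampleRealization' (h : D.nonemptyProb ≠ 0) (φ : Option (PointSet ℝ d) → ℝ) :
    (sampleRealization : Prog ℝ n z d _).ev D ε φ = (1 - D.nonemptyProb) * φ none +
      D.nonemptyProb * avg D.condProb D.stored fun P => φ (some P) := by
  rw [ev_sampleRealization, avg, Finset.mul_sum, ← D.sum_prod_prob, ProbPoints.nonemptyProb,
    ← Finset.sum_sub_distrib, Finset.sum_mul, ← ProbPoints.nonemptyProb, ← Finset.sum_add_distrib]
  refine Finset.sum_congr rfl fun j _ => ?_
  rw [← mul_assoc, ProbPoints.condProb, mul_div_cancel₀ _ h, ProbPoints.stored]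
  rcases toPointSet (D.pts j) with _ | P <;> simp

/-- The cost of a center for the law of a sampled realization. -/
lemma ProbPoints.expCost_eq (h : D.nonemptyProb ≠ 0) (c : Vec ℝ d) :
    D.expCost (WithLp.toLp 2 c) =
      D.nonemptyProb * (medianCost D ε).cost D.condProb D.stored c := by
  rw [MedianCost.cost, avg, Finset.mul_sum, ProbPoints.expCost]
  refine Finset.sum_congr rfl fun j _ => ?_
  rw [← mul_assoc, ProbPoints.condProb, mul_div_cancel₀ _ h, ProbPoints.stored]
  change _ = _ * setDist _ _
  rcases hp : toPointSet (D.pts j) with _ | P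
  · simp [realization_eq_empty hp, maxDist]
  · simp [realization_eq_toFinset hp, setDist]

end ExpectedCost

end PSEB

namespace PSEB

/-! ### The success probability -/

section Success

variable {n z d : ℕ} {D : ProbPoints n z d} {ε : ℝ}

/-- The number of sampled sets for the comparison of the centers. -/
noncomputable def comparisonSize (η : ℝ) (candidates : ℕ) : ℕ :=
  ⌈64 / (η * η) * Real.log (8 * candidates : ℕ)⌉₊

/-- The iteration and sample numbers for accuracy `η`. -/
noncomputable def sizes (η : ℝ) : Sizes :=
  let est := ⌈1 / η⌉₊
  let steps := ⌈68 / η * (68 / η)⌉₊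
  let runs := ⌈Real.log (2 / (η * η * (η * η))) / Real.log 2⌉₊ + 1
  let total := 1 + est + runs * steps + comparisonSize η (runs * steps + 1)
  ⟨est, steps, runs, total, ⌈(8 * total : ℕ) / η⌉₊⟩

lemma trials_sizes (η : ℝ) : (sizes η).trials = ⌈(8 * (sizes η).total : ℕ) / η⌉₊ := rfl

lemma val_computeSizes (η : ℝ) :
    (computeSizes η : Prog ℝ n z d Sizes).val D ε = sizes η := by
  simp [computeSizes, sizes, comparisonSize, Instr.value]

lemma isDet_computeSizes (η : ℝ) : (computeSizes η : Prog ℝ n z d Sizes).IsDet := by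
  unfold computeSizes
  repeat refine isDet_bind (isDet_exec (by trivial)) fun _ => ?_
  exact isDet_pure _

lemma le_two_pow_ceil {x : ℝ} (hx : 0 < x) : x ≤ 2 ^ ⌈Real.log x / Real.log 2⌉₊ := by
  have h2 : 0 < Real.log 2 := Real.log_pos (by norm_num)
  rw [← Real.log_le_log_iff hx (by positivity), Real.log_pow]
  exact (div_le_iff₀ h2).1 (Nat.le_ceil _)

open Classical in
/-- The algorithm samples sets and then works deterministically. -/
lemma ev_pSEB (φ : Vec ℝ d → ℝ) :
    (pSEB : Prog ℝ n z d (Vec ℝ d)).ev D ε φ =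
      (if ∑ x, D.presentProb x ≤ ε / 12 then
          collect sampleLocation (sizes (ε / 12)).total (sizes (ε / 12)).total
        else collect sampleRealization (sizes (ε / 12)).trials (sizes (ε / 12)).total).ev D ε
        fun l => φ ((setMedian (ε / 12) (sizes (ε / 12)) l : Prog ℝ n z d _).val D ε) := by
  simp only [pSEB, ev_bind, ev_exec, Instr.ev, Instr.value, Nat.cast_ofNat,
    (isDet_computeSizes _).ev_eq, val_computeSizes, isDet_presentMass.ev_eq, val_presentMass]
  have hdet : ∀ l : List (PointSet ℝ d), (setMedian (ε / 12) (sizes (ε / 12)) l :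
      Prog ℝ n z d _).ev D ε φ = φ ((setMedian (ε / 12) (sizes (ε / 12)) l :
      Prog ℝ n z d _).val D ε) :=
    fun l => (isDet_setMedian _ _ l).ev_eq φ
  by_cases h : ∑ x, D.presentProb x ≤ ε / 12 <;> simp [h, hdet]

variable (D ε) in
/-- The set median algorithm finds a good center for the law of the sampled sets. -/
lemma eighth_le_ev_collect {Ω : Type*} [Fintype Ω] {v : Ω → ℝ} (hv : ∀ ω, 0 ≤ v ω)
    (h1 : ∑ ω, v ω = 1) {T : Ω → PointSet ℝ d} {p : ℝ} (hp0 : 0 ≤ p) (hp1 : p ≤ 1)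
    {sampler : Prog ℝ n z d (Option (PointSet ℝ d))}
    (hS : ∀ φ, sampler.ev D ε φ = (1 - p) * φ none + p * avg v T fun x => φ (some x))
    {η : ℝ} (hη : 0 < η) (hη1 : η ≤ 1 / 100) {t : ℕ}
    (hit : 7 / 8 ≤ hitProb p t (sizes η).total) {c' : Vec ℝ d}
    (hopt : ∀ c, (medianCost D ε).cost v T c' ≤ (medianCost D ε).cost v T c) :
    1 / 8 ≤ (collect sampler t (sizes η).total).ev D ε fun l =>
      ind ((medianCost D ε).cost v T ((setMedian η (sizes η) l : Prog ℝ n z d _).val D ε) ≤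
        (1 + η) * ((1 + 9 * η) * (medianCost D ε).cost v T c')) := by
  refine le_trans ?_ (le_ev_collect hv hp0 hp1 hS t _ fun l => ind_nonneg _)
  set M := medianCost D ε with hM
  set out : List (PointSet ℝ d) → Vec ℝ d :=
    fun l => (setMedian η (sizes η) l : Prog ℝ n z d _).val D ε with hout
  set J := ⌈Real.log (2 / (η * η * (η * η))) / Real.log 2⌉₊ with hJ
  have htot : (sizes η).total = (sizes η).est + ((J + 1) * (sizes η).steps +
      comparisonSize η ((J + 1) * (sizes η).steps + 1)) + 1 := by
    simp only [sizes, hJ]; ring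
  have hfail := M.listAvg_setMedian_le hv h1 hη hη1 hopt (c₀ := fun P => P.1)
    (T := T) (e := (sizes η).est) (ℓ := (sizes η).steps) (J := J)
    (k := comparisonSize η ((J + 1) * (sizes η).steps + 1)) (out := out)
    (fun P => by
      have : vecDist c' P.1 ≤ setDist c' P := vecDist_le_setDist List.mem_cons_self
      rw [vecDist, norm_sub_rev] at this
      exact this)
    (Nat.le_ceil _) (Nat.ceil_lt_add_one (by positivity)).le
    (by rw [sq]; exact Nat.le_ceil _)
    (by
      have h4 : η ^ 4 = η * η * (η * η) := by ring
      rw [h4]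
      exact le_two_pow_ceil (by positivity))
    (by
      rw [sq]
      refine le_trans (le_of_eq ?_) (Nat.le_ceil _)
      push_cast
      ring_nf)
    (fun P l₁ l₂ l₃ h₁ h₂ _ => (val_setMedian η (sizes η) P l₁ l₂ l₃ h₁ h₂).1)
    (fun P l₁ l₂ l₃ h₁ h₂ _ => (val_setMedian η (sizes η) P l₁ l₂ l₃ h₁ h₂).2)
  rw [← htot] at hfail
  set k := (sizes η).total with hk
  set B := (1 + η) * ((1 + 9 * η) * M.cost v T c') with hB
  -- Success and failure are complementary, so failure at most 5/8 leaves success at least 3/8.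
  have hsum : listAvg v T k (fun l => ind (M.cost v T (out l) ≤ B)) +
      listAvg v T k (fun l => ind (B < M.cost v T (out l))) = 1 := by
    rw [← listAvg_add, ← listAvg_const (T := T) h1 k 1]
    congr 1
    funext l
    rcases le_or_gt (M.cost v T (out l)) B with h | h
    · rw [ind_of h, ind_not (not_lt.2 h), add_zero]
    · rw [ind_of h, ind_not (not_le.2 h), zero_add]
  have h38 : 3 / 8 ≤ listAvg v T k (fun l => ind (M.cost v T (out l) ≤ B)) := by linarith
  calc (1 / 8 : ℝ) ≤ 7 / 8 * (3 / 8) := by norm_num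
    _ ≤ _ := mul_le_mul hit h38 (by norm_num) (by linarith)

/-- The analysis compares with an optimum c' of the sampling law; it need not be optimal for the
expected cost. -/
lemma exists_cost_minimizer {Ω : Type*} [Fintype Ω] {v : Ω → ℝ} (hv : ∀ ω, 0 ≤ v ω)
    (T : Ω → PointSet ℝ d) :
    ∃ c', ∀ c, (medianCost D ε).cost v T c' ≤ (medianCost D ε).cost v T c := by
  obtain ⟨c', hc'⟩ := exists_minimizer hv fun ω => PointSet.toFinset (T ω)
  exact ⟨c'.ofLp, fun c => hc' (WithLp.toLp 2 c)⟩

lemma three_le_total (η : ℝ) (hη : 0 < η) (hη1 : η ≤ 1 / 100) : 3 ≤ (sizes η).total := by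
  have h : 2 ≤ ⌈1 / η⌉₊ := by
    have h1 : (100 : ℝ) ≤ 1 / η := by rw [le_div_iff₀ hη]; linarith
    have h2 : ((2 : ℕ) : ℝ) ≤ ⌈1 / η⌉₊ := by
      push_cast
      linarith [Nat.le_ceil (1 / η)]
    exact_mod_cast h2
  simp only [sizes]
  omega

/-- The success probability of the algorithm. -/
lemma eighth_le_ev_pSEB (D : ProbPoints n z d) (hε : 0 < ε) (hε1 : ε < 1 / 9)
    {cOpt : EuclideanSpace ℝ (Fin d)} :
    1 / 8 ≤ (pSEB : Prog ℝ n z d (Vec ℝ d)).ev D ε fun c =>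
      ind (D.expCost (WithLp.toLp 2 c) ≤ (1 + ε) * D.expCost cOpt) := by
  classical
  rw [ev_pSEB]
  set η := ε / 12 with hηdef
  have hη : 0 < η := by positivity
  have hε12 : ε = 12 * η := by rw [hηdef]; ring
  have hη1 : η ≤ 1 / 108 := by linarith
  have hη2 : η ≤ 1 / 100 := by linarith
  set μ := ∑ x, D.presentProb x with hμ
  have hμ0 : 0 ≤ μ := Finset.sum_nonneg fun x _ => D.presentProb_nonneg x
  have hf0 : ∀ c, 0 ≤ D.expCost c := fun c => Finset.sum_nonneg fun j _ =>
    mul_nonneg (D.prod_prob_nonneg j) (maxDist_nonneg _ _)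
  split_ifs with hcase
  · rcases hμ0.lt_or_eq with hpos | hzero
    · have hv : ∀ x, 0 ≤ D.presentProb x / μ :=
        fun x => div_nonneg (D.presentProb_nonneg x) hμ0
      have h1 : ∑ x, D.presentProb x / μ = 1 := by
        rw [← Finset.sum_div, ← hμ, div_self hpos.ne']
      set T : Fin n × Fin z → PointSet ℝ d := fun x => (D.coords x.1 x.2, []) with hT
      obtain ⟨c', hopt⟩ := exists_cost_minimizer (D := D) (ε := ε) hv T
      -- Every call returns a location when the total mass is positive, so p = 1 and k trials
      -- suffice.
      have key := eighth_le_ev_collect D ε hv h1 zero_le_one le_rfl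
        (sampler := sampleLocation)
        (fun φ => by rw [ev_sampleLocation hpos.ne', sub_self, zero_mul, one_mul, zero_add])
        hη hη2 (t := (sizes η).total) (by rw [hitProb_one]; norm_num) hopt
      refine key.trans (Prog.ev_mono _ fun l => ind_mono fun h => ?_)
      set out := (setMedian η (sizes η) l : Prog ℝ n z d _).val D ε
      set g := (medianCost D ε).cost (fun x => D.presentProb x / μ) T with hg
      have e1 : D.expCost (WithLp.toLp 2 out) ≤ μ * g out :=
        (D.expCost_le_sumCost _).trans_eq (ProbPoints.sumCost_eq hpos.ne' _)
      have e2 : (1 - μ) * (μ * g cOpt.ofLp) ≤ D.expCost cOpt :=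
        (D.sumCost_le_expCost cOpt).trans_eq' (by
          rw [hg, hT, ← ProbPoints.sumCost_eq hpos.ne' cOpt.ofLp])
      have hg0 : ∀ c, 0 ≤ g c := MedianCost.cost_nonneg _ hv
      have e3 : μ * g out ≤ (1 + η) * (1 + 9 * η) * (μ * g cOpt.ofLp) := by
        have h2 : (1 + η) * ((1 + 9 * η) * g c') ≤ (1 + η) * ((1 + 9 * η) * g cOpt.ofLp) := by
          have := hopt cOpt.ofLp
          gcongr
        calc μ * g out ≤ μ * ((1 + η) * ((1 + 9 * η) * g cOpt.ofLp)) :=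
              mul_le_mul_of_nonneg_left (h.trans h2) hμ0
          _ = _ := by ring
      have hx0 : 0 ≤ μ * g cOpt.ofLp := mul_nonneg hμ0 (hg0 _)
      -- The choice ε = 12η leaves room for the factor 1 - μ ≥ 1 - η: what remains is 21η² ≤ η.
      have e4 : (1 + η) * (1 + 9 * η) ≤ (1 + ε) * (1 - μ) := by rw [hε12]; nlinarith
      calc _ ≤ (1 + η) * (1 + 9 * η) * (μ * g cOpt.ofLp) := e1.trans e3
        _ ≤ (1 + ε) * (1 - μ) * (μ * g cOpt.ofLp) := mul_le_mul_of_nonneg_right e4 hx0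
        _ = (1 + ε) * ((1 - μ) * (μ * g cOpt.ofLp)) := by ring
        _ ≤ _ := mul_le_mul_of_nonneg_left e2 (by positivity)
    -- With no presence mass every center costs 0, so any output is optimal.
    · have hz : ∀ c, D.expCost c = 0 := fun c => by
        refine le_antisymm ((D.expCost_le_sumCost c).trans (le_of_eq ?_)) (hf0 c)
        refine Finset.sum_eq_zero fun i _ => Finset.sum_eq_zero fun a _ => ?_
        have h0 : D.presentProb (i, a) = 0 := (Finset.sum_eq_zero_iff_of_nonneg
          fun x _ => D.presentProb_nonneg x).1 hzero.symm _ (Finset.mem_univ _)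
        rcases h : D.loc i a with _ | q
        · simp [ProbPoints.locDist, h]
        · have : D.prob i a = 0 := by simpa [ProbPoints.presentProb, h] using h0
          rw [this, zero_mul]
      simp only [hz, mul_zero, le_refl, ind_of]
      rw [Prog.ev_const]
      norm_num
  · have hp := D.le_nonemptyProb hη (by linarith) (not_le.1 hcase).le
    have hp0 : 0 < D.nonemptyProb := by linarith
    have hv := D.condProb_nonneg hp0.le
    have h1 : ∑ j, D.condProb j = 1 := by
      simp only [ProbPoints.condProb]
      rw [← Finset.sum_div, ← ProbPoints.nonemptyProb, div_self hp0.ne']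
    obtain ⟨c', hopt⟩ := exists_cost_minimizer (D := D) (ε := ε) hv D.stored
    have key := eighth_le_ev_collect D ε hv h1 hp0.le D.nonemptyProb_le_one
      (ev_sampleRealization' hp0.ne') hη hη2 (t := (sizes η).trials)
      (le_hitProb hp D.nonemptyProb_le_one hη (three_le_total η hη hη2) (by
        rw [trials_sizes]
        exact_mod_cast Nat.le_ceil _)) hopt
    refine key.trans (Prog.ev_mono _ fun l => ind_mono fun h => ?_)
    set out := (setMedian η (sizes η) l : Prog ℝ n z d _).val D ε
    have e2 : D.expCost cOpt = _ := ProbPoints.expCost_eq (ε := ε) hp0.ne' cOpt.ofLp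
    rw [ProbPoints.expCost_eq (ε := ε) hp0.ne', e2]
    set g := (medianCost D ε).cost D.condProb D.stored with hg
    have hg0 : 0 ≤ g cOpt.ofLp := MedianCost.cost_nonneg _ hv _
    have e3 : g out ≤ (1 + ε) * g cOpt.ofLp := by
      have h2 : (1 + η) * ((1 + 9 * η) * g c') ≤ (1 + η) * ((1 + 9 * η) * g cOpt.ofLp) := by
        have := hopt cOpt.ofLp
        gcongr
      have h3 : (1 + η) * (1 + 9 * η) ≤ 1 + ε := by rw [hε12]; nlinarith
      have h4 := mul_le_mul_of_nonneg_right h3 hg0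
      linarith [h.trans h2]
    calc _ ≤ D.nonemptyProb * ((1 + ε) * g cOpt.ofLp) := mul_le_mul_of_nonneg_left e3 hp0.le
      _ = _ := by ring

lemma eighth_le_pSEBLaw (D : ProbPoints n z d) (hε : 0 < ε) (hε1 : ε < 1 / 9)
    (cOpt : EuclideanSpace ℝ (Fin d)) :
    1 / 8 ≤ (pSEBLaw D ε).toOuterMeasure
      {r | D.expCost r.1 ≤ (1 + ε) * D.expCost cOpt} := by
  have h := eighth_le_ev_pSEB D hε hε1 (cOpt := cOpt)
  rw [pSEBLaw, PMF.toOuterMeasure_map_apply]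
  have e := law_toOuterMeasure (D := D) (ε := ε) (pSEB : Prog ℝ n z d (Vec ℝ d))
    {c | D.expCost (WithLp.toLp 2 c) ≤ (1 + ε) * D.expCost cOpt}
  refine le_trans ?_ e.symm.le
  refine le_trans ?_ (ENNReal.ofReal_le_ofReal h)
  rw [ENNReal.ofReal_div_of_pos (by norm_num)]
  simp

end Success

end PSEB

namespace PSEB

/-! ### The running time -/

section RunningTime

variable {n z d : ℕ} {D : ProbPoints n z d} {ε : ℝ}

lemma runs_exec_det {β γ : Type} {i : Instr ℝ n z d β} {f : β → Prog ℝ n z d γ} {M : ℕ}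
    {R : γ → Prop} (hi : i.IsDet) (hf : (f (i.value D ε)).Runs D ε M R) :
    (exec i >>= f).Runs D ε (M + 1) R :=
  (runs_bind (runs_exec i) fun b hb => by rw [hb hi]; exact hf).le (by omega)

lemma runs_exec_true {β : Type} (i : Instr ℝ n z d β) :
    (exec i).Runs D ε 1 fun _ => True :=
  (runs_exec i).mono le_rfl fun _ _ => trivial

lemma runs_tabulate {m N : ℕ} {f : Fin m → Prog ℝ n z d ℝ}
    (h : ∀ a, (f a).Runs D ε N fun _ => True) : (tabulate f).Runs D ε (m * N) fun _ => True := by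
  induction m with
  | zero => exact runs_pure trivial
  | succ m ih =>
    refine (runs_bind (h 0) fun _ _ => runs_bind (M := 0) (ih fun a => h a.succ)
      fun _ _ => runs_pure trivial).le ?_
    rw [Nat.succ_mul, add_zero, add_comm]

lemma runs_distance (x y : Vec ℝ d) :
    (distance x y).Runs D ε (3 * d + 2) fun _ => True := by
  refine (runs_exec_bind fun o => runs_bind (runs_foldlM (N := 3) (I := fun _ => True)
    (fun _ _ _ _ => ?_) trivial) fun _ _ => runs_exec_true _).le ?_
  · exact runs_exec_bind fun _ => runs_exec_bind fun _ => runs_exec_true _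
  · rw [List.length_finRange]; omega

/-- The first point is stored separately, so the strict inequality means that the set has at most n
stored points. -/
lemma runs_farthest (hd : 0 < d) (c : Vec ℝ d) {P : PointSet ℝ d} (hP : P.2.length < n) :
    (farthest c P).Runs D ε (6 * n * d) fun _ => True := by
  refine (runs_bind (runs_distance _ _) fun _ _ => runs_foldlM (N := 3 * d + 3)
    (I := fun _ => True) (fun _ _ _ _ => ?_) trivial).le ?_
  · exact (runs_bind (runs_distance _ _) fun _ _ => runs_exec_bind (M := 0) fun _ =>
      runs_pure trivial).le (by omega)
  · calc 3 * d + 2 + P.2.length * (3 * d + 3) ≤ (P.2.length + 1) * (3 * d + 3) := by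
          linarith
      _ ≤ n * (6 * d) := Nat.mul_le_mul hP (by omega)
      _ = _ := by ring

lemma runs_totalCost (hd : 0 < d) (c : Vec ℝ d) {Ps : List (PointSet ℝ d)}
    (hP : ∀ P ∈ Ps, P.2.length < n) :
    (totalCost c Ps).Runs D ε (Ps.length * (6 * n * d + 1) + 1) fun _ => True :=
  runs_exec_bind fun _ => runs_foldlM (I := fun _ => True) (fun _ P hPs _ =>
    runs_bind (runs_farthest hd _ (hP P hPs)) fun _ _ => runs_exec_true _) trivial

lemma runs_subgradientStep (hd : 0 < d) (s : ℝ) (c : Vec ℝ d) {P : PointSet ℝ d}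
    (hP : P.2.length < n) :
    (subgradientStep s c P).Runs D ε (12 * n * d) fun _ => True := by
  refine (runs_bind (runs_farthest hd c hP) fun _ _ => runs_exec_bind fun _ =>
    runs_exec_bind fun _ => runs_ite (N := d * 3 + 1) (runs_pure trivial)
      (runs_exec_bind fun _ => runs_tabulate fun _ => ?_)).le ?_
  · exact runs_exec_bind fun _ => runs_exec_bind fun _ => runs_exec_true _
  · have : d ≤ n * d := Nat.le_mul_of_pos_left d (by omega)
    nlinarith

lemma runs_descent (hd : 0 < d) (s : ℝ) (c : Vec ℝ d) {Ps : List (PointSet ℝ d)}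
    (hP : ∀ P ∈ Ps, P.2.length < n) :
    (descent s c Ps).Runs D ε (Ps.length * (12 * n * d)) fun _ => True :=
  runs_bind (M := 0) (runs_foldlM (I := fun _ => True) (fun _ P hPs _ =>
    runs_bind (M := 0) (runs_subgradientStep hd s _ (hP P hPs)) fun _ _ => runs_pure trivial)
      trivial) fun _ _ => runs_pure trivial

lemma runs_descents (hd : 0 < d) (l : ℕ) (c : Vec ℝ d) (m : ℕ) (s : ℝ)
    {Ps : List (PointSet ℝ d)} (hP : ∀ P ∈ Ps, P.2.length < n) :
    (descents l c m s Ps).Runs D ε (m * (l * (12 * n * d) + 1)) fun _ => True := by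
  induction m generalizing s Ps with
  | zero => exact runs_pure trivial
  | succ m ih =>
    refine (runs_bind (runs_descent hd s c fun P h => hP P (List.mem_of_mem_take h)) fun _ _ =>
      runs_exec_bind fun s' => runs_bind (M := 0)
        (ih s' fun P h => hP P (List.mem_of_mem_drop h)) fun _ _ => runs_pure trivial).le ?_
    have : (Ps.take l).length * (12 * n * d) ≤ l * (12 * n * d) :=
      Nat.mul_le_mul_right _ (by rw [List.length_take]; omega)
    linarith

lemma runs_selectBest (hd : 0 < d) {E : List (PointSet ℝ d)} (c : Vec ℝ d) (cs : List (Vec ℝ d))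
    (hP : ∀ P ∈ E, P.2.length < n) :
    (selectBest E c cs).Runs D ε ((cs.length + 1) * (E.length * (6 * n * d + 1) + 2))
      fun _ => True := by
  refine (runs_bind (runs_totalCost hd c hP) fun _ _ => runs_bind (M := 0)
    (runs_foldlM (I := fun _ => True) (fun _ x _ _ => runs_bind (M := 1)
      (runs_totalCost hd x hP) fun _ _ => runs_exec_bind (M := 0) fun _ => runs_pure trivial)
        trivial) fun _ _ => runs_pure trivial).le ?_
  linarith

/-- A bound for the number of steps of the set median algorithm. -/
def medianSteps (n d : ℕ) (sz : Sizes) (cmp : ℕ) : ℕ :=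
  (sz.est * (6 * n * d + 1) + 1) + 8 + sz.runs * (sz.steps * (12 * n * d) + 1) +
    (sz.runs * sz.steps + 1) * (cmp * (6 * n * d + 1) + 2)

lemma runs_setMedian (hd : 0 < d) (η : ℝ) {sz : Sizes} {cmp : ℕ}
    (hsz : sz.total = 1 + sz.est + sz.runs * sz.steps + cmp) {l : List (PointSet ℝ d)}
    (hl : l.length ≤ sz.total) (hP : ∀ P ∈ l, P.2.length < n) :
    (setMedian η sz l).Runs D ε (medianSteps n d sz cmp + d) fun _ => True := by
  cases l with
  | nil =>
    exact (runs_tabulate (N := 1) fun _ => runs_exec_true _).le (by omega)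
  | cons P R =>
    have hR : ∀ Q ∈ R, Q.2.length < n := fun Q h => hP Q (List.mem_cons_of_mem _ h)
    refine (runs_bind (runs_totalCost hd _ fun Q h => hR Q (List.mem_of_mem_take h)) fun _ _ =>
      runs_exec_bind fun _ => runs_exec_bind fun _ => runs_exec_bind fun _ =>
      runs_exec_bind fun _ => runs_exec_bind fun _ => runs_exec_bind fun _ =>
      runs_exec_bind fun _ => runs_exec_bind fun s => runs_bind
        -- The cost of the selection depends on how many candidates and unused sets are returned, so
        -- the exact result of the descents is needed.
        ((runs_descents hd sz.steps P.1 sz.runs s fun Q h => hR Q (List.mem_of_mem_drop h)).eq_val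
          (isDet_descents _ _ _ _ _)) (M := (sz.runs * sz.steps + 1) *
            (cmp * (6 * n * d + 1) + 2)) fun r hr => ?_).le ?_
    · rw [hr]
      refine (runs_selectBest hd _ _ fun Q h => hR Q ?_).le
        (Nat.mul_le_mul (Nat.succ_le_succ (length_val_descents _ _ _ _ _))
          (Nat.add_le_add_right (Nat.mul_le_mul_right _ ?_) _))
      · rw [val_descents_snd] at h
        exact List.mem_of_mem_drop (List.mem_of_mem_drop h)
      · rw [val_descents_snd, List.length_drop, List.length_drop]
        rw [List.length_cons] at hl
        omega
    · have : (R.take sz.est).length * (6 * n * d + 1) ≤ sz.est * (6 * n * d + 1) :=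
        Nat.mul_le_mul_right _ (by rw [List.length_take]; omega)
      unfold medianSteps
      omega

lemma runs_reservoir {ι : Type} {weight : ι → Prog ℝ n z d ℝ} {N : ℕ}
    (h : ∀ x, (weight x).Runs D ε N fun _ => True) (items : List ι) :
    (reservoir weight items).Runs D ε (items.length * (N + 4) + 1) fun _ => True := by
  refine (runs_exec_bind fun _ => runs_bind (M := 0) (runs_foldlM (I := fun _ => True)
    (fun _ x _ _ => runs_bind (h x) fun _ _ => runs_exec_bind fun _ =>
      runs_ite (N := 3) (runs_pure trivial) (runs_exec_bind fun _ => runs_exec_bind fun _ =>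
        runs_exec_bind (M := 0) fun _ => runs_pure trivial)) trivial)
    fun _ _ => runs_pure trivial).le ?_
  linarith

lemma runs_presentProb (x : Fin n × Fin z) :
    (presentProb x).Runs D ε 2 fun _ => True :=
  runs_exec_bind fun _ => runs_ite (runs_exec_true _) (runs_exec_true _)

lemma length_allPairs : (allPairs n z).length = n * z := by
  have := List.length_product (List.finRange n) (List.finRange z)
  rwa [List.length_finRange, List.length_finRange] at this

lemma runs_presentMass : (presentMass : Prog ℝ n z d ℝ).Runs D ε (n * z * 3 + 1)
    fun _ => True := by
  rw [← length_allPairs (n := n) (z := z)]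
  exact runs_exec_bind fun _ => runs_foldlM (I := fun _ => True) (fun _ x _ _ =>
    runs_bind (runs_presentProb x) fun _ _ => runs_exec_true _) trivial

lemma runs_readPoint (i : Fin n) (j : Fin z) :
    (readPoint i j).Runs D ε d fun _ => True :=
  (runs_tabulate (N := 1) fun _ => runs_exec_true _).le (by omega)

lemma runs_sampleLocation (hn : 0 < n) (hz : 0 < z) (hd : 0 < d) :
    (sampleLocation : Prog ℝ n z d _).Runs D ε (8 * (n * z * d))
      fun r => ∀ P ∈ r, P.2.length < n := by
  refine (runs_bind (M := d) (runs_reservoir runs_presentProb _) fun r _ => ?_).le ?_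
  · cases r with
    | none => exact runs_pure (by simp)
    | some x =>
      exact runs_bind (M := 0) (runs_readPoint _ _) fun p _ => runs_pure (by simp [hn])
  · rw [length_allPairs]
    have h1 : n * z ≤ n * z * d := Nat.le_mul_of_pos_right _ hd
    have h2 : d ≤ n * z * d := Nat.le_mul_of_pos_left d (by positivity)
    omega

/-- The invariant may depend on the number of processed items; this bounds the points of a
realization by n. -/
lemma runs_foldlM_counted {ι γ : Type} {f : γ → ι → Prog ℝ n z d γ} {N : ℕ} {I : ℕ → γ → Prop}
    (h : ∀ k a x, I k a → (f a x).Runs D ε N (I (k + 1))) (l : List ι) {k : ℕ} {a : γ}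
    (ha : I k a) : (l.foldlM f a).Runs D ε (l.length * N) (I (k + l.length)) := by
  induction l generalizing a k with
  | nil => exact ha
  | cons x l ih =>
    rw [List.foldlM_cons]
    refine (runs_bind (h k a x ha) fun b hb => ih hb).mono ?_ fun b hb => ?_
    · rw [List.length_cons, Nat.succ_mul, add_comm]
    · rw [List.length_cons]
      convert hb using 1
      omega

lemma runs_sampleRealization (hz : 0 < z) (hd : 0 < d) :
    (sampleRealization : Prog ℝ n z d _).Runs D ε (8 * (n * z * d))
      fun r => ∀ P ∈ r, P.2.length < n := by
  refine (runs_bind (M := 0) (runs_foldlM_counted (N := 8 * (z * d))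
    (I := fun k l => l.length ≤ k) (fun k acc i hacc => ?_) _ (k := 0) le_rfl)
      fun pts hpts => ?_).le ?_
  · refine (runs_bind (M := d + 1) (runs_reservoir (N := 1) (fun _ => runs_exec_true _) _)
      fun r _ => ?_).le ?_
    · cases r with
      | none => exact runs_pure (by omega)
      | some j =>
        refine runs_exec_bind fun _ => runs_ite (runs_pure (by omega)) ?_
        exact runs_bind (M := 0) (runs_readPoint _ _) fun p _ => runs_pure (by simpa using hacc)
    · rw [List.length_finRange]
      have h1 : z ≤ z * d := Nat.le_mul_of_pos_right _ hd
      have h2 : d ≤ z * d := Nat.le_mul_of_pos_left d hz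
      omega
  · rw [List.length_finRange, zero_add] at hpts
    cases pts with
    | nil => exact runs_pure (by simp)
    | cons p ps =>
      refine runs_pure fun P hP => ?_
      cases hP
      simpa [Nat.succ_le_iff] using hpts
  · rw [List.length_finRange]
    exact le_of_eq (by ring)

lemma runs_collect {N : ℕ} {sampler : Prog ℝ n z d (Option (PointSet ℝ d))}
    (h : sampler.Runs D ε N fun r => ∀ P ∈ r, P.2.length < n) (t k : ℕ) :
    (collect sampler t k).Runs D ε (t * N)
      fun l => l.length ≤ k ∧ ∀ P ∈ l, P.2.length < n := by
  induction t generalizing k with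
  | zero => exact runs_pure (by simp)
  | succ t ih =>
    cases k with
    | zero => exact runs_pure (by simp)
    | succ k =>
      rw [collect]
      refine (runs_bind (M := t * N) h fun r hr => ?_).le (by rw [Nat.succ_mul]; omega)
      cases r with
      | none => exact ih (k + 1)
      | some P =>
        refine runs_bind (M := 0) (ih k) fun l hl => runs_pure ⟨?_, fun Q hQ => ?_⟩
        · rw [List.length_cons]; omega
        · rcases List.mem_cons.1 hQ with rfl | hQ
          · exact hr _ rfl
          · exact hl.2 Q hQ

lemma runs_computeSizes (η : ℝ) :
    (computeSizes η : Prog ℝ n z d Sizes).Runs D ε 32 fun sz => sz = sizes η := by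
  have h : (computeSizes η : Prog ℝ n z d Sizes).Runs D ε 32 fun _ => True := by
    unfold computeSizes
    repeat refine runs_exec_bind fun _ => ?_
    exact runs_pure trivial
  exact (h.eq_val (isDet_computeSizes η)).mono le_rfl fun sz hsz => by rw [hsz, val_computeSizes]

/-- The number of steps of the algorithm. -/
lemma runs_pSEB (hn : 0 < n) (hz : 0 < z) (hd : 0 < d) {η : ℝ} (hη : η = ε / 12) :
    (pSEB : Prog ℝ n z d (Vec ℝ d)).Runs D ε
      (39 + n * z * 3 + ((sizes η).trials + (sizes η).total) * (8 * (n * z * d)) +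
        medianSteps n d (sizes η) (comparisonSize η ((sizes η).runs * (sizes η).steps + 1)) + d)
      fun _ => True := by
  set S := ((sizes η).trials + (sizes η).total) * (8 * (n * z * d)) with hS
  set med := medianSteps n d (sizes η)
    (comparisonSize η ((sizes η).runs * (sizes η).steps + 1)) with hmed
  refine Prog.Runs.le (N := (32 + ((n * z * 3 + 1) + ((S + (med + d)) + 1))) + 1 + 1 + 1) ?_
    (by omega)
  rw [pSEB]
  refine runs_exec_det (by trivial) (runs_exec_det (by trivial) (runs_exec_det (by trivial) ?_))
  simp only [Instr.value, Nat.cast_ofNat]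
  rw [← hη]
  refine runs_bind (runs_computeSizes _) fun sz hsz => ?_
  subst hsz
  refine runs_bind runs_presentMass fun m _ => runs_exec_bind fun b => ?_
  have hmedian : ∀ l : List (PointSet ℝ d),
      (l.length ≤ (sizes η).total ∧ ∀ P ∈ l, P.2.length < n) →
      (setMedian η (sizes η) l).Runs D ε (med + d) fun _ => True :=
    fun l hl => runs_setMedian hd _ rfl hl.1 hl.2
  apply runs_ite
  · exact runs_bind ((runs_collect (runs_sampleLocation hn hz hd) _ _).le
      (Nat.mul_le_mul_right _ (Nat.le_add_left _ _))) hmedian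
  · exact runs_bind ((runs_collect (runs_sampleRealization hz hd) _ _).le
      (Nat.mul_le_mul_right _ (Nat.le_add_right _ _))) hmedian

/-- The iteration and sample numbers, apart from the number of trials. -/
lemma exists_sizes_le : ∃ C : ℝ, 1 ≤ C ∧ ∀ ε : ℝ, 0 < ε → ε < 1 / 9 →
    ((sizes (ε / 12)).est : ℝ) ≤ C * (1 / ε ^ 2 * Real.log (1 / ε)) ∧
    ((sizes (ε / 12)).runs : ℝ) ≤ C * (1 / ε ^ 2 * Real.log (1 / ε)) ∧
    ((sizes (ε / 12)).runs * (sizes (ε / 12)).steps : ℝ) ≤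
      C * (1 / ε ^ 2 * Real.log (1 / ε)) ∧
    (comparisonSize (ε / 12) ((sizes (ε / 12)).runs * (sizes (ε / 12)).steps + 1) : ℝ) ≤
      C * (1 / ε ^ 2 * Real.log (1 / ε)) := by
  have hl2 : 0 < Real.log 2 := Real.log_pos (by norm_num)
  obtain ⟨c₁, hc₁, hb₁⟩ : ∃ c₁ : ℝ, 1 ≤ c₁ ∧ (|Real.log 41472| + 4) / Real.log 2 + 2 ≤ c₁ :=
    ⟨_, le_max_left _ _, le_max_right 1 _⟩
  obtain ⟨c₂, hc₂, hb₂⟩ : ∃ c₂ : ℝ, 1 ≤ c₂ ∧ 1000000 ≤ c₂ := ⟨1000000, by norm_num, le_rfl⟩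
  obtain ⟨c₃, hc₃, hb₃⟩ : ∃ c₃ : ℝ, 1 ≤ c₃ ∧ |Real.log (8 * (c₁ * c₂ + 1))| + 3 ≤ c₃ :=
    ⟨_, le_max_left _ _, le_max_right 1 _⟩
  refine ⟨13 + c₁ + c₁ * c₂ + (9216 * c₃ + 1), by nlinarith, fun ε hε hε1 => ?_⟩
  set x := 1 / ε with hx
  set L := Real.log x with hL
  have hx9 : 9 ≤ x := by
    rw [hx, le_div_iff₀ hε]; linarith
  have hx0 : 0 < x := by linarith
  -- ε < 1/9 makes 1/ε exceed e, so additive constants can be absorbed into the logarithm.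
  have hL1 : 1 ≤ L := by
    rw [hL, Real.le_log_iff_exp_le hx0]
    linarith [Real.exp_one_lt_d9]
  have hLx : L ≤ x := by
    have := Real.log_le_sub_one_of_pos hx0
    linarith
  have hεx : ε = 1 / x := by rw [hx, one_div_one_div]
  have e2 : 1 / ε ^ 2 = x ^ 2 := by rw [hx]; field_simp
  rw [e2]
  set A := x ^ 2 * L with hA
  have hx2A : x ^ 2 ≤ A := le_mul_of_one_le_right (by positivity) hL1
  have hLA : L ≤ A := le_mul_of_one_le_left (by linarith) (by nlinarith)
  have hA1 : 1 ≤ A := hL1.trans hLA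
  have hest : ((sizes (ε / 12)).est : ℝ) ≤ 13 * A := by
    have h1 : ((sizes (ε / 12)).est : ℝ) < 1 / (ε / 12) + 1 := Nat.ceil_lt_add_one (by positivity)
    have h2 : 1 / (ε / 12) = 12 * x := by rw [hx]; field_simp
    nlinarith
  have hsteps : ((sizes (ε / 12)).steps : ℝ) ≤ c₂ * x ^ 2 := by
    have h1 : ((sizes (ε / 12)).steps : ℝ) < 68 / (ε / 12) * (68 / (ε / 12)) + 1 :=
      Nat.ceil_lt_add_one (by positivity)
    have h2 : 68 / (ε / 12) = 816 * x := by rw [hx]; field_simp; norm_num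
    rw [h2] at h1
    nlinarith [mul_le_mul_of_nonneg_right hb₂ (sq_nonneg x)]
  have hruns : ((sizes (ε / 12)).runs : ℝ) ≤ c₁ * L := by
    -- 41472 = 2 · 12⁴, so the number of runs is only logarithmic in 1/ε.
    have h2 : 2 / (ε / 12 * (ε / 12) * (ε / 12 * (ε / 12))) = 41472 * x ^ 4 := by
      rw [hx]; field_simp; norm_num
    have h3 : Real.log (41472 * x ^ 4) = Real.log 41472 + 4 * L := by
      rw [Real.log_mul (by norm_num) (by positivity), Real.log_pow, hL]; norm_num
    have h4 : 0 ≤ Real.log (41472 * x ^ 4) / Real.log 2 := by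
      rw [h3]
      have : 0 ≤ Real.log 41472 := Real.log_nonneg (by norm_num)
      positivity
    have h1 : ((sizes (ε / 12)).runs : ℝ) < Real.log (41472 * x ^ 4) / Real.log 2 + 1 + 1 := by
      rw [← h2] at h4 ⊢
      simp only [sizes]
      push_cast
      exact add_lt_add_left (Nat.ceil_lt_add_one h4) 1
    have h5 : Real.log (41472 * x ^ 4) ≤ (|Real.log 41472| + 4) * L := by
      rw [h3]
      nlinarith [le_abs_self (Real.log 41472), abs_nonneg (Real.log 41472)]
    have h6 : Real.log (41472 * x ^ 4) / Real.log 2 ≤ (|Real.log 41472| + 4) / Real.log 2 * L := by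
      rw [div_mul_eq_mul_div]
      exact div_le_div_of_nonneg_right h5 hl2.le
    nlinarith
  have hrs : ((sizes (ε / 12)).runs * (sizes (ε / 12)).steps : ℝ) ≤ c₁ * c₂ * A := by
    calc _ ≤ c₁ * L * (c₂ * x ^ 2) := mul_le_mul hruns hsteps (by positivity) (by positivity)
      _ = _ := by rw [hA]; ring
  have hcmp : (comparisonSize (ε / 12) ((sizes (ε / 12)).runs * (sizes (ε / 12)).steps + 1) : ℝ) ≤
      (9216 * c₃ + 1) * A := by
    set N := (sizes (ε / 12)).runs * (sizes (ε / 12)).steps + 1 with hN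
    have hN1 : (1 : ℝ) ≤ N := by rw [hN]; push_cast; linarith [show (0 : ℝ) ≤
      (sizes (ε / 12)).runs * (sizes (ε / 12)).steps by positivity]
    -- A polynomial bound suffices, as N enters the comparison size only through its logarithm.
    have hNA : (N : ℝ) ≤ (c₁ * c₂ + 1) * x ^ 3 := by
      have h1 : A ≤ x ^ 3 := by
        rw [hA, pow_succ x 2]
        exact mul_le_mul_of_nonneg_left hLx (by positivity)
      have h2 : (N : ℝ) ≤ (c₁ * c₂ + 1) * A := by rw [hN]; push_cast; linarith
      exact h2.trans (mul_le_mul_of_nonneg_left h1 (by positivity))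
    have hlog : Real.log (8 * N : ℕ) ≤ c₃ * L := by
      have h1 : ((8 * N : ℕ) : ℝ) ≤ 8 * (c₁ * c₂ + 1) * x ^ 3 := by push_cast; linarith
      have h2 := Real.log_le_log (by push_cast; linarith) h1
      rw [Real.log_mul (by positivity) (by positivity), Real.log_pow, ← hL] at h2
      push_cast at h2 ⊢
      nlinarith [le_abs_self (Real.log (8 * (c₁ * c₂ + 1))),
        abs_nonneg (Real.log (8 * (c₁ * c₂ + 1)))]
    have hlog0 : 0 ≤ Real.log (8 * N : ℕ) := Real.log_nonneg (by push_cast; linarith)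
    have h64 : 64 / (ε / 12 * (ε / 12)) = 9216 * x ^ 2 := by
      rw [hx]; field_simp; norm_num
    have h3 : (comparisonSize (ε / 12) N : ℝ) < 9216 * x ^ 2 * Real.log (8 * N : ℕ) + 1 := by
      rw [← h64]
      exact Nat.ceil_lt_add_one (by positivity)
    have h4 : 9216 * x ^ 2 * Real.log (8 * N : ℕ) ≤ 9216 * x ^ 2 * (c₃ * L) :=
      mul_le_mul_of_nonneg_left hlog (by positivity)
    have h5 : 9216 * x ^ 2 * (c₃ * L) = 9216 * c₃ * A := by rw [hA]; ring
    linarith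
  have p1 : 0 ≤ c₁ * A := by positivity
  have p2 : 0 ≤ c₁ * c₂ * A := by positivity
  have p3 : 0 ≤ c₃ * A := by positivity
  have p4 : c₁ * L ≤ c₁ * A := mul_le_mul_of_nonneg_left hLA (by linarith)
  refine ⟨?_, ?_, ?_, ?_⟩ <;> linarith

end RunningTime

end PSEB

namespace PSEB

/-! ### The explicit running time bound. -/

section RunningTimeBound

variable {n z d : ℕ}

lemma ProbPoints.pos_of_pos (D : ProbPoints n z d) (hn : 0 < n) : 0 < z := by
  rcases Nat.eq_zero_or_pos z with rfl | hz
  · simpa using D.sum_prob ⟨0, hn⟩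
  · exact hz

/-- The running time of the algorithm. -/
lemma exists_runningTime_le : ∃ K : ℝ, 0 < K ∧ ∀ (n z d : ℕ), 0 < n → 0 < d →
    ∀ (D : ProbPoints n z d) (ε : ℝ), 0 < ε → ε < 1 / 9 → ∀ r ∈ (pSEBLaw D ε).support,
      (r.2 : ℝ) ≤ K * (d * n * (z / ε ^ 3 * Real.log (1 / ε)
        + 1 / ε ^ 4 * Real.log (1 / ε) ^ 2)) := by
  obtain ⟨C, hC, hsz⟩ := exists_sizes_le
  refine ⟨43 + 3136 * C + 47 * C ^ 2, by positivity, fun n z d hn hd D ε hε hε1 r hr => ?_⟩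
  have hz := D.pos_of_pos hn
  rw [pSEBLaw, PMF.mem_support_map_iff] at hr
  obtain ⟨r', hr', rfl⟩ := hr
  have hT := ((runs_pSEB (D := D) hn hz hd (rfl : ε / 12 = ε / 12)).of_mem_support hr').1
  obtain ⟨h1, h2, h3, h4⟩ := hsz ε hε hε1
  have htrials : ((sizes (ε / 12)).trials : ℝ) ≤ 96 * (1 / ε) * (sizes (ε / 12)).total + 1 := by
    rw [trials_sizes]
    refine (Nat.ceil_lt_add_one (by positivity)).le.trans (le_of_eq ?_)
    push_cast
    field_simp
    ring
  have htotal : (sizes (ε / 12)).total = 1 + (sizes (ε / 12)).est + (sizes (ε / 12)).runs *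
    (sizes (ε / 12)).steps + comparisonSize (ε / 12)
      ((sizes (ε / 12)).runs * (sizes (ε / 12)).steps + 1) := rfl
  set sz := sizes (ε / 12) with hszdef
  set cmp := comparisonSize (ε / 12) (sz.runs * sz.steps + 1) with hcmp
  set x := 1 / ε with hx
  set L := Real.log x with hL
  have hx9 : 9 ≤ x := by
    rw [hx, le_div_iff₀ hε]; linarith
  have hx0 : 0 < x := by linarith
  have hL1 : 1 ≤ L := by
    rw [hL, Real.le_log_iff_exp_le hx0]
    linarith [Real.exp_one_lt_d9]
  have e2 : 1 / ε ^ 2 = x ^ 2 := by rw [hx]; field_simp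
  have e3 : (z : ℝ) / ε ^ 3 = z * x ^ 3 := by rw [hx]; field_simp
  have e4 : 1 / ε ^ 4 = x ^ 4 := by rw [hx]; field_simp
  rw [e2] at h1 h2 h3 h4
  rw [e3, e4]
  set A := x ^ 2 * L with hA
  have hA1 : 1 ≤ A := one_le_mul_of_one_le_of_one_le (one_le_pow₀ (by linarith)) hL1
  have hCA : 1 ≤ C * A := one_le_mul_of_one_le_of_one_le hC hA1
  have hn1 : (1 : ℝ) ≤ n := by exact_mod_cast hn
  have hz1 : (1 : ℝ) ≤ z := by exact_mod_cast hz
  have hd1 : (1 : ℝ) ≤ d := by exact_mod_cast hd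
  set U : ℝ := n * d with hU
  have hU1 : 1 ≤ U := one_le_mul_of_one_le_of_one_le hn1 hd1
  have hU0 : 0 ≤ U := by linarith
  have hk : (sz.total : ℝ) ≤ 4 * (C * A) := by
    rw [htotal]
    push_cast
    linarith
  have hk1 : (1 : ℝ) ≤ sz.total := by
    rw [htotal]
    push_cast
    have : (0 : ℝ) ≤ sz.runs * sz.steps := by positivity
    linarith [Nat.cast_nonneg (α := ℝ) sz.est, Nat.cast_nonneg (α := ℝ) cmp]
  -- The left side is at most 98 · x · total, and total ≤ 4CA.
  have htk : (sz.trials : ℝ) + sz.total ≤ 392 * C * (x * A) := by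
    have h5 : (sz.total : ℝ) ≤ x * sz.total := le_mul_of_one_le_left (by linarith) (by linarith)
    have h6 : x * sz.total ≤ x * (4 * (C * A)) := mul_le_mul_of_nonneg_left hk hx0.le
    linarith
  -- The dominant part is the selection: O(A) candidates on O(A) sets. The constant is 47 = 7 + 9 +
  -- 12 + 1 + 18 from the summands of `e`.
  have hmed : (medianSteps n d sz cmp : ℝ) ≤ 47 * C ^ 2 * (U * A ^ 2) := by
    have m0 : U ≤ U * (C * A) := le_mul_of_one_le_right hU0 hCA
    have m1 : (sz.est : ℝ) * (6 * U + 1) ≤ C * A * (7 * U) :=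
      mul_le_mul h1 (by linarith) (by linarith) (by linarith)
    have m2 : (sz.runs : ℝ) * sz.steps * (12 * U) ≤ C * A * (12 * U) :=
      mul_le_mul_of_nonneg_right h3 (by linarith)
    have m3 : (cmp : ℝ) * (6 * U + 1) ≤ C * A * (7 * U) :=
      mul_le_mul h4 (by linarith) (by linarith) (by linarith)
    have m4 : ((sz.runs : ℝ) * sz.steps + 1) * (cmp * (6 * U + 1) + 2) ≤
        2 * (C * A) * (9 * (U * (C * A))) :=
      mul_le_mul (by linarith) (by linarith) (by positivity) (by linarith)
    have m5 : C * A ≤ U * (C * A) := le_mul_of_one_le_left (by linarith) hU1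
    have m6 : U * (C * A) ≤ U * (C * A) * (C * A) :=
      le_mul_of_one_le_right (by positivity) hCA
    have e : (medianSteps n d sz cmp : ℝ) = sz.est * (6 * U + 1) + 9 +
        (sz.runs * sz.steps * (12 * U) + sz.runs) +
        (sz.runs * sz.steps + 1) * (cmp * (6 * U + 1) + 2) := by
      rw [medianSteps, hU]
      push_cast
      ring
    rw [e]
    calc _ ≤ 47 * (U * (C * A) * (C * A)) := by linarith
      _ = _ := by ring
  have hW1 : 1 ≤ U * z := one_le_mul_of_one_le_of_one_le hU1 hz1
  have hxA : 1 ≤ x * A := one_le_mul_of_one_le_of_one_le (by linarith) hA1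
  have hnz : (n : ℝ) * z ≤ U * z := by
    rw [hU]
    exact mul_le_mul_of_nonneg_right (le_mul_of_one_le_right (by linarith) hd1) (by linarith)
  have hdW : (d : ℝ) ≤ U * z := by
    have h5 : (d : ℝ) ≤ U := le_mul_of_one_le_left (by linarith) hn1
    exact h5.trans (le_mul_of_one_le_right hU0 hz1)
  have hWxA : U * z ≤ U * z * (x * A) := le_mul_of_one_le_right (by linarith) hxA
  have hsamp : ((sz.trials : ℝ) + sz.total) * (8 * (U * z)) ≤
      392 * C * (x * A) * (8 * (U * z)) := mul_le_mul_of_nonneg_right htk (by linarith)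
  have hTr : (r'.2 : ℝ) ≤ 39 + n * z * 3 + (sz.trials + sz.total) * (8 * (U * z)) +
      medianSteps n d sz cmp + d := by
    have : (r'.2 : ℝ) ≤ ((39 + n * z * 3 + (sz.trials + sz.total) * (8 * (n * z * d)) +
        medianSteps n d sz cmp + d : ℕ) : ℝ) := by exact_mod_cast hT
    refine this.trans (le_of_eq ?_)
    rw [hU]
    push_cast
    ring
  -- Here 43 = 39 + 3 + 1 collects the lower order terms and 3136 = 392 · 8 the sampling. With A =
  -- x²L the two summands are the two terms of the claimed bound.
  have hfin : (r'.2 : ℝ) ≤ (43 + 3136 * C) * (U * z * (x * A)) + 47 * C ^ 2 * (U * A ^ 2) := by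
    linarith
  have hP : 0 ≤ U * z * (x * A) := by positivity
  have hQ : 0 ≤ U * A ^ 2 := by positivity
  calc (r'.2 : ℝ) ≤ (43 + 3136 * C) * (U * z * (x * A)) + 47 * C ^ 2 * (U * A ^ 2) := hfin
    _ ≤ (43 + 3136 * C + 47 * C ^ 2) * (U * z * (x * A) + U * A ^ 2) := by
        have h5 : 0 ≤ 47 * C ^ 2 * (U * z * (x * A)) := by positivity
        have h6 : 0 ≤ (43 + 3136 * C) * (U * A ^ 2) := by positivity
        linarith
    _ = _ := by rw [hU, hA]; ring

end RunningTimeBound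

end PSEB

theorem mainTheorem2 :
    ∃ K : ℝ, 0 < K ∧
      ∀ (n z d : ℕ), 0 < n → 0 < d →
      ∀ (D : PSEB.ProbPoints n z d) (ε : ℝ), 0 < ε → ε < 1 / 9 →
        (∃ cOpt : EuclideanSpace ℝ (Fin d),
          (∀ c, D.expCost cOpt ≤ D.expCost c) ∧
          1 / 8 ≤ (PSEB.pSEBLaw D ε).toOuterMeasure
            {r | D.expCost r.1 ≤ (1 + ε) * D.expCost cOpt}) ∧
        ∀ r ∈ (PSEB.pSEBLaw D ε).support,
          (r.2 : ℝ) ≤ K * (d * n * (z / ε ^ 3 * Real.log (1 / ε)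
            + 1 / ε ^ 4 * Real.log (1 / ε) ^ 2)) := by
  obtain ⟨K, hK, hrun⟩ := PSEB.exists_runningTime_le
  refine ⟨K, hK, fun n z d hn hd D ε hε hε1 => ⟨?_, hrun n z d hn hd D ε hε hε1⟩⟩
  obtain ⟨cOpt, hopt⟩ := PSEB.exists_minimizer D.prod_prob_nonneg D.realization
  exact ⟨cOpt, hopt, PSEB.eighth_le_pSEBLaw D hε hε1 cOpt⟩
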